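/- **Definition (3-crossed module).** Let $G,H,L,M$ be groups. Write ${}^ab$ for the action of $a$ on $b$. A 3-crossed module $T=(M\xrightarrow{\partial}L\xrightarrow{\partial}H\xrightarrow{\partial}G)$ consists of group homomorphisms $\partial$; left actions by automorphisms of $G$ on $H,L,M$, of $H$ on $L,M$ and of $L$ on $M$ (each of $G,H,L$ acting on itself by conjugation); and functions $\{-,-\}:H\times H\to L$ (Peiffer lifting), $\{-,-,-\}:H^3\to M$ and $\{-,-,-\}':H^3\to M$ (left and right Homanian), $\{-,-\}_{HL}:H\times L\to M$ and $\{-,-\}'_{HL}:H\times L\to M$ (HL- and HL'-lifting), $\{-,-\}_{LL}:L\times L\to M$ (LL-lifting), such that for all $g\in G$, $h,h_i\in H$, $l,l',l_i\in L$, $m,m'\in M$: 1. $\partial\partial=1$; $\partial$ is equivariant: $\partial({}^gh)={}^g\partial h$, $\partial({}^gl)={}^g\partial l$, $\partial({}^gm)={}^g\partial m$, $\partial({}^hl)={}^h\partial l$, $\partial({}^hm)={}^h\partial m$, $\partial({}^lm)={}^l\partial m$. 2. All six liftings are $G$-equivariant, i.e. ${}^g\{a,b\}_*=\{{}^ga,{}^gb\}_*$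 for the four two-variable liftings and ${}^g\{a,b,c\}_*=\{{}^ga,{}^gb,{}^gc\}_*$ for the two Homanians; moreover ${}^h\{l_2,l_1\}_{LL}=\{{}^hl_2,{}^hl_1\}_{LL}$. 3. $\partial\{h_2,h_1\}=h_2h_1h_2^{-1}\,{}^{\partial h_2}h_1^{-1}$. 4. $\partial\{h,l\}_{HL}\,{}^hl=l\{\partial l^{-1},h\}$; $\ \partial\{h,l\}'_{HL}\,{}^{\partial h}l={}^hl\,\{h,\partial l^{-1}\}$; $\ \partial\{l,l'\}_{LL}\,{}^{\partial l}l'=ll'l^{-1}$. 5. $\{h_3h_2,h_1\}=\partial\{h_3,h_2,h_1\}\;{}^{h_3}\{h_2,h_1\}\;\{h_3,{}^{\partial h_2}h_1\}$; $\ \{h_3,h_2h_1\}=\partial\{h_3,h_2,h_1\}'\;\{h_3,h_2\}\;{}^{({}^{\partial h_3}h_2)}\{h_3,h_1\}$. 6. ${}^{\partial m}m'=mm'm^{-1}$; $\ {}^lm=m\{\partial m^{-1},l\}_{LL}$; $\ {}^hm=m\{h,\partial m^{-1}\}_{HL}$; $\ {}^{\partial h}m={}^hm\,\{h,\partial m^{-1}\}'_{HL}$.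 7. $\{l_3l_2,l_1\}_{LL}={}^{l_3}\{l_2,l_1\}_{LL}\{l_3,{}^{\partial l_2}l_1\}_{LL}$; $\ \{l_3,l_2l_1\}_{LL}=\{l_3,l_2\}_{LL}\,{}^{({}^{\partial l_3}l_2)}\{l_3,l_1\}_{LL}$. 8. $\{h_2h_1,l\}_{HL}={}^l\{\partial l^{-1},h_2,h_1\}'\{h_2,l\}_{HL}\,{}^{h_2}\{h_1,l\}_{HL}$. 9. $\{h,l_2l_1\}_{HL}={}^{l_2l_1}\{\partial l_1^{-1},\partial l_2^{-1},h\}\;{}^{l_2l_1}\{l_1^{-1},\{\partial l_2^{-1},h\}\}_{LL}^{-1}\;\{h,l_2\}_{HL}\;{}^{({}^hl_2)}\{h,l_1\}_{HL}$. 10. $\{h_2h_1,l\}'_{HL}={}^{({}^{h_2h_1}l)}\{h_2,h_1,\partial l^{-1}\}\;{}^{h_2}\{h_1,l\}'_{HL}\;\{h_2,{}^{\partial h_1}l\}'_{HL}$. 11. $\{h,l_2l_1\}'_{HL}={}^{({}^h(l_2l_1))}\{h,\partial l_1^{-1},\partial l_2^{-1}\}'\;{}^{({}^hl_2)}\{h,l_1\}'_{HL}\;{}^{({}^hl_2\,{}^{\partial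 h}l_1)}\{{}^{\partial h}l_1^{-1},\{h,\partial l_2^{-1}\}\}_{LL}^{-1}\;\{h,l_2\}'_{HL}$. 12. $\{h_4h_3,h_2,h_1\}\;{}^{({}^{h_4h_3}\{h_2,h_1\})}\{h_4,h_3,{}^{\partial h_2}h_1\}=\{h_4,h_3h_2,h_1\}\;{}^{h_4}\{h_3,h_2,h_1\}$. 13. $\{h_4,h_3h_2,h_1\}'\{h_4,h_3,h_2\}'=\{h_4,h_3,h_2h_1\}'\;{}^{\{h_4,h_3\}}\bigl({}^{({}^{\partial h_4}h_3)}\{h_4,h_2,h_1\}'\bigr)$. 14. $\{h_4,h_3,h_2h_1\}\;{}^{({}^{h_4}\{h_3,h_2h_1\})}\{h_4,{}^{\partial h_3}h_2,{}^{\partial h_3}h_1\}'\;{}^{h_4}\{h_3,h_2,h_1\}'=\{h_4h_3,h_2,h_1\}'\;{}^{\{h_4h_3,h_2\}}\bigl({}^{({}^{\partial(h_4h_3)}h_2)}\{h_4,h_3,h_1\}\bigr)\;\{h_4,h_3,h_2\}\;{}^{({}^{h_4}\{h_3,h_2\})}\bigl\{\{h_4,{}^{\partial h_3}h_2\},{}^{({}^{\partial(h_4h_3)}h_2\,h_4)}\{h_3,h_1\}\bigr\}_{LL}$.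 15. ${}^{({}^{h_3}\{h_2,h_1\})}\bigl(\{h_3,{}^{\partial h_2}h_1,h_2\}'^{-1}\{h_3,\partial\{h_2,h_1\}^{-1},h_2h_1\}'\bigr)\;\{h_3,\{h_2,h_1\}\}'_{HL}\;\bigl\{{}^{\partial h_3}\{h_2,h_1\},{}^{\partial({}^{\partial h_3}\{h_2,h_1\}^{-1})}\{h_3,h_2h_1\}\bigr\}_{LL}\;\{h_3,h_2,h_1\}'$ $=\{h_3,h_2,h_1\}^{-1}\;{}^{\{h_3h_2,h_1\}}\{{}^{\partial(h_3h_2)}h_1,\{h_3,h_2\}\}_{HL}^{-1}\;\bigl\{\{h_3,h_2\},{}^{\partial\{h_3,h_2\}^{-1}}\{h_3h_2,h_1\}\bigr\}_{LL}^{-1}\;{}^{\{h_3,h_2\}}\bigl(\{\partial\{h_3,h_2\}^{-1},h_3h_2,h_1\}^{-1}\{{}^{\partial h_3}h_2,h_3,h_1\}\bigr)$. 16. ${}^l\{\partial l',l^{-1}\}_{HL}\;{}^{ll'l^{-1}l'^{-1}}\{l',l\}_{LL}={}^{({}^{\partial l}l')}\{\partial l,l'^{-1}\}'_{HL}\,\{l,l'\}_{LL}^{-1}$.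 17. $\{\partial m,l\}_{LL}\{l,\partial m\}_{LL}=\{\partial l,\partial m\}_{HL}=\{\partial l,\partial m\}'^{-1}_{HL}$; $\ \{\partial m,\partial m'\}_{LL}=mm'm^{-1}m'^{-1}$. **Definition (the simplicial set $M_T$).** An element of $(M_T)_n$ is a quadruple of functions $g_{ij}\in G$, $h_{ijk}\in H$, $l_{ijkp}\in L$, $m_{ijkpq}\in M$, defined on the weakly increasing pairs, triples, quadruples, quintuples of $[n]=\{0<\dots<n\}$, such that for all $i\le j\le k\le p\le q\le x$ in $[n]$: (a) $g_{ik}=\partial(h_{ijk})g_{jk}g_{ij}$; (b) $\partial(l_{ijkp})\,h_{ikp}\,{}^{g_{kp}}h_{ijk}=h_{ijp}h_{jkp}$; (c) $\partial(m_{ijkpq})\;{}^{h_{ijq}}l_{jkpq}\;l_{ijpq}\;{}^{h_{ipq}}({}^{g_{pq}}l_{ijkp})=l_{ijkq}\;{}^{h_{ikq}}\{h_{kpq},{}^{g_{pq}g_{kp}}h_{ijk}\}^{-1}\;l_{ikpq}$; (d) the 5-simplex identity $${}^{L_DL_E}M_5\cdot{}^{L_DL_EL_F}M_4\cdot M_3\cdot{}^{L_A}M_2\cdot{}^{L_AL_BL_C}M_1={}^{L_K}M'_{13}\cdot{}^{L_KL_N}M'_{12}\cdot{}^{L_K}M'_{11}\cdot{}^{L_KL_L}M'_{10}\cdot{}^{L_KL_LL_M}M'_9\cdot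 M'_8\cdot{}^{L_GL_I}M'_7\cdot{}^{L_GL_I}M'_6\cdot{}^{L_G}M'_5\cdot{}^{L_GL_HL_IL_J}M'_4\cdot{}^{L_GL_H}M'_3\cdot M'_2\cdot{}^{L_AL_B}M'_1 ,$$ where, with $u=g_{qx}g_{pq}$, $a={}^{ug_{kp}}h_{ijk}$, $b={}^{u}(h_{ikp}\,{}^{g_{kp}}h_{ijk})$, $\lambda={}^{u}l_{ijkp}$, $\lambda'={}^{g_{px}}l_{ijkp}$, $Y=\{h_{pqx},b\}$, $\mu=l_{kpqx}$, $c=h_{kqx}\,{}^{g_{qx}}h_{kpq}$, $v={}^{g_{kx}}h_{ijk}$, $Z=\{c,a\}$: - $L_A={}^{h_{ijx}h_{jkx}}l_{kpqx}$, $L_B={}^{h_{ijx}}l_{jkqx}$, $L_C=l_{ijqx}$, $L_D=L_K=l_{ijkx}$, $L_E={}^{h_{ikx}v}l_{kpqx}$, $L_F={}^{h_{ikx}}\{h_{kqx},{}^{g_{qx}g_{kq}}h_{ijk}\}^{-1}$, $L_G={}^{h_{ijx}}l_{jkpx}$, $L_H={}^{h_{ijx}h_{jpx}}\{h_{pqx},{}^uh_{jkp}\}^{-1}$,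 $L_I=l_{ijpx}$, $L_J={}^{h_{ipx}}\{h_{pqx},{}^uh_{ijp}\}^{-1}$, $L_L={}^{h_{ikx}}\{h_{kpx},{}^{g_{px}g_{kp}}h_{ijk}\}^{-1}$, $L_M=l_{ikpx}$, $L_N={}^{h_{ikx}}\{h_{kpx}h_{pqx},a\}^{-1}$; - $M_1={}^{h_{iqx}}({}^{g_{qx}}m_{ijkpq})$, $M_2=m_{ijkqx}$, $M_3=\{l_{ijkx},L_E\}_{LL}$, $M_4=\{l_{ikqx},{}^{h_{iqx}\,{}^{g_{qx}}h_{ikq}}\{{}^{g_{qx}}h_{kpq},a\}^{-1}\}_{LL}^{-1}$, $M_5={}^{h_{ikx}}\bigl({}^{\{h_{kqx},{}^{g_{qx}g_{kq}}h_{ijk}\}^{-1}\,{}^{h_{kqx}}\{{}^{g_{qx}}h_{kpq},a\}^{-1}}\{h_{kqx},{}^{g_{qx}}h_{kpq},a\}^{-1}\bigr)$; - $M'_1=\{l_{ijqx},{}^{h_{iqx}\,{}^{g_{qx}}h_{ijq}}({}^{g_{qx}}l_{jkpq})\}_{LL}^{-1}$, $M'_2={}^{h_{ijx}}m_{jkpqx}$,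 $M'_3=m_{ijpqx}$, $M'_4=\{l_{ipqx},{}^{h_{iqx}\,{}^{g_{qx}}h_{ipq}}\lambda\}_{LL}^{-1}$, $M'_5=\{l_{ijpx},{}^{h_{ipx}\,{}^{g_{px}}h_{ijp}}\{h_{pqx},{}^uh_{jkp}\}^{-1}\}_{LL}$, - $M'_6={}^{h_{ipx}}\bigl({}^{({}^{({}^{g_{px}}h_{ijp})}\{h_{pqx},{}^uh_{jkp}\}^{-1})\{h_{pqx},{}^uh_{ijp}\}^{-1}}\{h_{pqx},{}^uh_{ijp},{}^uh_{jkp}\}'^{-1}\bigr)$, - $M'_7={}^{h_{ipx}}\bigl({}^{\lambda'Y^{-1}}({}^{({}^{h_{pqx}}\lambda^{-1})}\{h_{pqx},\partial\lambda,b\}')\cdot{}^{\lambda'Y^{-1}}\{h_{pqx},\lambda^{-1}\}'_{HL}\cdot\{\lambda',Y^{-1}\}_{LL}\bigr)$, - $M'_8=m_{ijkpx}$, $M'_9={}^{h_{ipx}}\bigl({}^{({}^{({}^{g_{px}}h_{ikp})}\{h_{pqx},a\}^{-1})\{h_{pqx},{}^uh_{ikp}\}^{-1}}\{h_{pqx},{}^uh_{ikp},a\}'\bigr)$,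 $M'_{10}=\{l_{ikpx},{}^{h_{ipx}\,{}^{g_{px}}h_{ikp}}\{h_{pqx},a\}^{-1}\}_{LL}^{-1}$, - $M'_{11}={}^{h_{ikx}}\bigl({}^{\{h_{kpx},{}^{g_{px}g_{kp}}h_{ijk}\}^{-1}\,{}^{h_{kpx}}\{h_{pqx},a\}^{-1}}\{h_{kpx},h_{pqx},a\}^{-1}\bigr)$, $M'_{12}=m_{ikpqx}^{-1}$, - $M'_{13}={}^{h_{ikx}}\bigl({}^{({}^v\mu)Z^{-1}\mu^{-1}}\{\partial\mu,c,a\}\cdot{}^{({}^v\mu)}({}^{\mu^{-1}}\{\mu,Z^{-1}\}_{LL}\cdot\{v,\mu^{-1}\}_{HL})\bigr)$; (e) $g_{ii}=1$; $h_{iij}=h_{ijj}=1$; $l_{iijk}=l_{ijjk}=l_{ijkk}=1$; $m_{iijkp}=m_{ijjkp}=m_{ijkkp}=m_{ijkpp}=1$. A monotone map $\delta:[n']\to[n]$ acts by precomposition, e.g. $(\delta^*g)_{ij}=g_{\delta(i)\delta(j)}$. **Theorem.** Let $T=(M\to L\to H\to G)$ be a 3-crossed module. Then the simplicial set $M_T$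 is a quasi-category, i.e. for all $n\ge2$ and $0<j<n$ every map $\Lambda^n_j\to M_T$ extends to a map $\Delta^n\to M_T$. -/

import Mathlib

open CategoryTheory

universe u₁ u₂ u₃ u₄

/-- A 3-crossed module `M → L → H → G`.  The actions are given by
`MulDistribMulAction` (left actions by group automorphisms, written `g • h`); each of `G`, `H`, `L`
acts on itself by conjugation, which is written out.

* `pf h₂ h₁` is the Peiffer lifting `{h₂, h₁}`;
* `lhom h₃ h₂ h₁` is the left Homanian `{h₃, h₂, h₁}`;
* `rhom h₃ h₂ h₁` is the right Homanian `{h₃, h₂, h₁}'`;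
* `hl h l` is the HL-Peiffer lifting `{h, l}_HL`;
* `hl' h l` is the HL'-Peiffer lifting `{h, l}'_HL`;
* `ll l₂ l₁` is the LL-Peiffer lifting `{l₂, l₁}_LL`. -/
structure ThreeCrossedModule (G : Type u₁) (H : Type u₂) (L : Type u₃) (M : Type u₄)
    [Group G] [Group H] [Group L] [Group M]
    [MulDistribMulAction G H] [MulDistribMulAction G L] [MulDistribMulAction G M]
    [MulDistribMulAction H L] [MulDistribMulAction H M] [MulDistribMulAction L M] where
  /-- the boundary `∂ : H → G` -/
  dH : H →* G
  /-- the boundary `∂ : L → H` -/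
  dL : L →* H
  /-- the boundary `∂ : M → L` -/
  dM : M →* L
  pf : H → H → L
  lhom : H → H → H → M
  rhom : H → H → H → M
  hl : H → L → M
  hl' : H → L → M
  ll : L → L → M
  -- a complex of groups
  dH_dL : ∀ l : L, dH (dL l) = 1
  dL_dM : ∀ m : M, dL (dM m) = 1
  -- equivariance of the boundaries
  dH_smul : ∀ (g : G) (h : H), dH (g • h) = g * dH h * g⁻¹
  dL_smul : ∀ (g : G) (l : L), dL (g • l) = g • dL l
  dM_smul : ∀ (g : G) (m : M), dM (g • m) = g • dM m
  dL_smulH : ∀ (h : H) (l : L), dL (h • l) = h * dL l * h⁻¹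
  dM_smulH : ∀ (h : H) (m : M), dM (h • m) = h • dM m
  dM_smulL : ∀ (l : L) (m : M), dM (l • m) = l * dM m * l⁻¹
  -- equivariance of the liftings
  smul_pf : ∀ (g : G) (h₂ h₁ : H), g • pf h₂ h₁ = pf (g • h₂) (g • h₁)
  smul_lhom : ∀ (g : G) (h₃ h₂ h₁ : H),
    g • lhom h₃ h₂ h₁ = lhom (g • h₃) (g • h₂) (g • h₁)
  smul_rhom : ∀ (g : G) (h₃ h₂ h₁ : H),
    g • rhom h₃ h₂ h₁ = rhom (g • h₃) (g • h₂) (g • h₁)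
  smul_ll : ∀ (g : G) (l₂ l₁ : L), g • ll l₂ l₁ = ll (g • l₂) (g • l₁)
  smulH_ll : ∀ (h : H) (l₂ l₁ : L), h • ll l₂ l₁ = ll (h • l₂) (h • l₁)
  smul_hl : ∀ (g : G) (h : H) (l : L), g • hl h l = hl (g • h) (g • l)
  smul_hl' : ∀ (g : G) (h : H) (l : L), g • hl' h l = hl' (g • h) (g • l)
  -- boundaries of the liftings
  dL_pf : ∀ h₂ h₁ : H, dL (pf h₂ h₁) = h₂ * h₁ * h₂⁻¹ * dH h₂ • h₁⁻¹
  dM_hl : ∀ (h : H) (l : L), dM (hl h l) * h • l = l * pf (dL l⁻¹) h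
  dM_hl' : ∀ (h : H) (l : L), dM (hl' h l) * dH h • l = h • l * pf h (dL l⁻¹)
  dM_ll : ∀ l l' : L, dM (ll l l') * dL l • l' = l * l' * l⁻¹
  dM_lhom : ∀ h₃ h₂ h₁ : H,
    pf (h₃ * h₂) h₁ = dM (lhom h₃ h₂ h₁) * h₃ • pf h₂ h₁ * pf h₃ (dH h₂ • h₁)
  dM_rhom : ∀ h₃ h₂ h₁ : H,
    pf h₃ (h₂ * h₁) = dM (rhom h₃ h₂ h₁) * pf h₃ h₂ * (dH h₃ • h₂) • pf h₃ h₁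
  -- the actions on `M`
  dM_smulM : ∀ m m' : M, dM m • m' = m * m' * m⁻¹
  smulL_eq : ∀ (l : L) (m : M), l • m = m * ll (dM m⁻¹) l
  smulH_eq : ∀ (h : H) (m : M), h • m = m * hl h (dM m⁻¹)
  dH_smulM : ∀ (h : H) (m : M), dH h • m = h • m * hl' h (dM m⁻¹)
  -- expansions of products
  ll_mul_left : ∀ l₃ l₂ l₁ : L, ll (l₃ * l₂) l₁ = l₃ • ll l₂ l₁ * ll l₃ (dL l₂ • l₁)
  ll_mul_right : ∀ l₃ l₂ l₁ : L, ll l₃ (l₂ * l₁) = ll l₃ l₂ * (dL l₃ • l₂) • ll l₃ l₁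
  hl_mul_left : ∀ (h₂ h₁ : H) (l : L),
    hl (h₂ * h₁) l = l • rhom (dL l⁻¹) h₂ h₁ * hl h₂ l * h₂ • hl h₁ l
  hl_mul_right : ∀ (h : H) (l₂ l₁ : L),
    hl h (l₂ * l₁) =
      (l₂ * l₁) • lhom (dL l₁⁻¹) (dL l₂⁻¹) h * (l₂ * l₁) • (ll l₁⁻¹ (pf (dL l₂⁻¹) h))⁻¹ *
        hl h l₂ * (h • l₂) • hl h l₁
  hl'_mul_left : ∀ (h₂ h₁ : H) (l : L),
    hl' (h₂ * h₁) l =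
      ((h₂ * h₁) • l) • lhom h₂ h₁ (dL l⁻¹) * h₂ • hl' h₁ l * hl' h₂ (dH h₁ • l)
  hl'_mul_right : ∀ (h : H) (l₂ l₁ : L),
    hl' h (l₂ * l₁) =
      (h • (l₂ * l₁)) • rhom h (dL l₁⁻¹) (dL l₂⁻¹) * (h • l₂) • hl' h l₁ *
        (h • l₂ * dH h • l₁) • (ll (dH h • l₁⁻¹) (pf h (dL l₂⁻¹)))⁻¹ * hl' h l₂
  -- coherence of the Homanians
  lhom_lhom : ∀ h₄ h₃ h₂ h₁ : H,
    lhom (h₄ * h₃) h₂ h₁ * ((h₄ * h₃) • pf h₂ h₁) • lhom h₄ h₃ (dH h₂ • h₁) =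
      lhom h₄ (h₃ * h₂) h₁ * h₄ • lhom h₃ h₂ h₁
  rhom_rhom : ∀ h₄ h₃ h₂ h₁ : H,
    rhom h₄ (h₃ * h₂) h₁ * rhom h₄ h₃ h₂ =
      rhom h₄ h₃ (h₂ * h₁) * pf h₄ h₃ • (dH h₄ • h₃) • rhom h₄ h₂ h₁
  lhom_rhom : ∀ h₄ h₃ h₂ h₁ : H,
    lhom h₄ h₃ (h₂ * h₁) * (h₄ • pf h₃ (h₂ * h₁)) • rhom h₄ (dH h₃ • h₂) (dH h₃ • h₁) *
        h₄ • rhom h₃ h₂ h₁ =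
      rhom (h₄ * h₃) h₂ h₁ *
        pf (h₄ * h₃) h₂ • (dH (h₄ * h₃) • h₂) • lhom h₄ h₃ h₁ *
        lhom h₄ h₃ h₂ *
        (h₄ • pf h₃ h₂) • ll (pf h₄ (dH h₃ • h₂)) (((dH (h₄ * h₃) • h₂) * h₄) • pf h₃ h₁)
  yangBaxter : ∀ h₃ h₂ h₁ : H,
    (h₃ • pf h₂ h₁) •
          ((rhom h₃ (dH h₂ • h₁) h₂)⁻¹ * rhom h₃ (dL (pf h₂ h₁)⁻¹) (h₂ * h₁)) *
        hl' h₃ (pf h₂ h₁) *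
        ll (dH h₃ • pf h₂ h₁) (dL (dH h₃ • (pf h₂ h₁)⁻¹) • pf h₃ (h₂ * h₁)) *
        rhom h₃ h₂ h₁ =
      (lhom h₃ h₂ h₁)⁻¹ *
        pf (h₃ * h₂) h₁ • (hl (dH (h₃ * h₂) • h₁) (pf h₃ h₂))⁻¹ *
        (ll (pf h₃ h₂) (dL (pf h₃ h₂)⁻¹ • pf (h₃ * h₂) h₁))⁻¹ *
        pf h₃ h₂ •
          ((lhom (dL (pf h₃ h₂)⁻¹) (h₃ * h₂) h₁)⁻¹ * lhom (dH h₃ • h₂) h₃ h₁)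
  -- compatibility of the LL-, HL- and HL'-liftings
  ll_swap : ∀ l l' : L,
    l • hl (dL l') l⁻¹ * (l * l' * l⁻¹ * l'⁻¹) • ll l' l =
      (dL l • l') • hl' (dL l) l'⁻¹ * (ll l l')⁻¹
  ll_dM_mul : ∀ (l : L) (m : M), ll (dM m) l * ll l (dM m) = hl (dL l) (dM m)
  hl_dL_dM : ∀ (l : L) (m : M), hl (dL l) (dM m) = (hl' (dL l) (dM m))⁻¹
  ll_dM_dM : ∀ m m' : M, ll (dM m) (dM m') = m * m' * m⁻¹ * m'⁻¹

namespace ThreeCrossedModule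

variable {G : Type u₁} {H : Type u₂} {L : Type u₃} {M : Type u₄}
  [Group G] [Group H] [Group L] [Group M]
  [MulDistribMulAction G H] [MulDistribMulAction G L] [MulDistribMulAction G M]
  [MulDistribMulAction H L] [MulDistribMulAction H M] [MulDistribMulAction L M]

variable (G H L M) in
/-- Colorings of the weakly increasing pairs, triples, quadruples and quintuples of `[n]` by
elements of `G`, `H`, `L` and `M`.  The order hypotheses are filled in automatically. -/
@[ext]
structure Coloring (n : ℕ) where
  g : ∀ (i j : Fin (n + 1)) (_ : i ≤ j := by order), G
  h : ∀ (i j k : Fin (n + 1)) (_ : i ≤ j := by order) (_ : j ≤ k := by order), H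
  l : ∀ (i j k p : Fin (n + 1)) (_ : i ≤ j := by order) (_ : j ≤ k := by order)
    (_ : k ≤ p := by order), L
  m : ∀ (i j k p q : Fin (n + 1)) (_ : i ≤ j := by order) (_ : j ≤ k := by order)
    (_ : k ≤ p := by order) (_ : p ≤ q := by order), M

/-- The 5-simplex identity for the vertices `i ≤ j ≤ k ≤ p ≤ q ≤ x`. -/
def FiveCocycle (T : ThreeCrossedModule G H L M) {n : ℕ} (c : Coloring G H L M n)
    (i j k p q x : Fin (n + 1)) (_ : i ≤ j) (_ : j ≤ k) (_ : k ≤ p) (_ : p ≤ q) (_ : q ≤ x) :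
    Prop :=
  let LA : L := (c.h i j x * c.h j k x) • c.l k p q x
  let LB : L := c.h i j x • c.l j k q x
  let LC : L := c.l i j q x
  let LD : L := c.l i j k x
  let LE : L := (c.h i k x * c.g k x • c.h i j k) • c.l k p q x
  let LF : L := c.h i k x • (T.pf (c.h k q x) ((c.g q x * c.g k q) • c.h i j k))⁻¹
  let M1 : M := c.h i q x • c.g q x • c.m i j k p q
  let M2 : M := c.m i j k q x
  let M3 : M := T.ll (c.l i j k x) ((c.h i k x * c.g k x • c.h i j k) • c.l k p q x)
  let M4 : M := (T.ll (c.l i k q x) ((c.h i q x * c.g q x • c.h i k q) •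
    (T.pf (c.g q x • c.h k p q) ((c.g q x * c.g p q * c.g k p) • c.h i j k))⁻¹))⁻¹
  let M5 : M := c.h i k x •
    ((T.pf (c.h k q x) ((c.g q x * c.g k q) • c.h i j k))⁻¹ *
      c.h k q x • (T.pf (c.g q x • c.h k p q) ((c.g q x * c.g p q * c.g k p) • c.h i j k))⁻¹) •
    (T.lhom (c.h k q x) (c.g q x • c.h k p q) ((c.g q x * c.g p q * c.g k p) • c.h i j k))⁻¹
  let LG : L := c.h i j x • c.l j k p x
  let LH : L := (c.h i j x * c.h j p x) •
    (T.pf (c.h p q x) ((c.g q x * c.g p q) • c.h j k p))⁻¹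
  let LI : L := c.l i j p x
  let LJ : L := c.h i p x • (T.pf (c.h p q x) ((c.g q x * c.g p q) • c.h i j p))⁻¹
  let LK : L := c.l i j k x
  let LL : L := c.h i k x • (T.pf (c.h k p x) ((c.g p x * c.g k p) • c.h i j k))⁻¹
  let LM : L := c.l i k p x
  let LN : L := c.h i k x •
    (T.pf (c.h k p x * c.h p q x) ((c.g q x * c.g p q * c.g k p) • c.h i j k))⁻¹
  let M1' : M := (T.ll (c.l i j q x)
    ((c.h i q x * c.g q x • c.h i j q) • c.g q x • c.l j k p q))⁻¹
  let M2' : M := c.h i j x • c.m j k p q x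
  let M3' : M := c.m i j p q x
  let M4' : M := (T.ll (c.l i p q x)
    ((c.h i q x * c.g q x • c.h i p q) • (c.g q x * c.g p q) • c.l i j k p))⁻¹
  let M5' : M := T.ll (c.l i j p x) ((c.h i p x * c.g p x • c.h i j p) •
    (T.pf (c.h p q x) ((c.g q x * c.g p q) • c.h j k p))⁻¹)
  let M6' : M := c.h i p x •
    ((c.g p x • c.h i j p) • (T.pf (c.h p q x) ((c.g q x * c.g p q) • c.h j k p))⁻¹ *
      (T.pf (c.h p q x) ((c.g q x * c.g p q) • c.h i j p))⁻¹) •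
    (T.rhom (c.h p q x) ((c.g q x * c.g p q) • c.h i j p) ((c.g q x * c.g p q) • c.h j k p))⁻¹
  let P7 : L := c.g p x • c.l i j k p *
    (T.pf (c.h p q x) ((c.g q x * c.g p q) • (c.h i k p * c.g k p • c.h i j k)))⁻¹
  let M7' : M := c.h i p x •
    (P7 • (c.h p q x • (c.g q x * c.g p q) • (c.l i j k p)⁻¹) •
        T.rhom (c.h p q x) ((c.g q x * c.g p q) • T.dL (c.l i j k p))
          ((c.g q x * c.g p q) • (c.h i k p * c.g k p • c.h i j k)) *
      P7 • T.hl' (c.h p q x) ((c.g q x * c.g p q) • (c.l i j k p)⁻¹) *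
      T.ll (c.g p x • c.l i j k p)
        (T.pf (c.h p q x) ((c.g q x * c.g p q) • (c.h i k p * c.g k p • c.h i j k)))⁻¹)
  let M8' : M := c.m i j k p x
  let M9' : M := c.h i p x •
    ((c.g p x • c.h i k p) •
        (T.pf (c.h p q x) ((c.g q x * c.g p q * c.g k p) • c.h i j k))⁻¹ *
      (T.pf (c.h p q x) ((c.g q x * c.g p q) • c.h i k p))⁻¹) •
    T.rhom (c.h p q x) ((c.g q x * c.g p q) • c.h i k p)
      ((c.g q x * c.g p q * c.g k p) • c.h i j k)
  let M10' : M := (T.ll (c.l i k p x) ((c.h i p x * c.g p x • c.h i k p) •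
    (T.pf (c.h p q x) ((c.g q x * c.g p q * c.g k p) • c.h i j k))⁻¹))⁻¹
  let M11' : M := c.h i k x •
    ((T.pf (c.h k p x) ((c.g p x * c.g k p) • c.h i j k))⁻¹ *
      c.h k p x • (T.pf (c.h p q x) ((c.g q x * c.g p q * c.g k p) • c.h i j k))⁻¹) •
    (T.lhom (c.h k p x) (c.h p q x) ((c.g q x * c.g p q * c.g k p) • c.h i j k))⁻¹
  let M12' : M := (c.m i k p q x)⁻¹
  let Z : L := T.pf (c.h k q x * c.g q x • c.h k p q)
    ((c.g q x * c.g p q * c.g k p) • c.h i j k)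
  let M13' : M := c.h i k x •
    (((c.g k x • c.h i j k) • c.l k p q x * Z⁻¹ * (c.l k p q x)⁻¹) •
        T.lhom (T.dL (c.l k p q x)) (c.h k q x * c.g q x • c.h k p q)
          ((c.g q x * c.g p q * c.g k p) • c.h i j k) *
      ((c.g k x • c.h i j k) • c.l k p q x) •
        ((c.l k p q x)⁻¹ • T.ll (c.l k p q x) Z⁻¹ *
          T.hl (c.g k x • c.h i j k) (c.l k p q x)⁻¹))
  (LD * LE) • M5 * (LD * LE * LF) • M4 * M3 * LA • M2 * (LA * LB * LC) • M1 =
    LK • M13' * (LK * LN) • M12' * LK • M11' * (LK * LL) • M10' * (LK * LL * LM) • M9' *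
      M8' * (LG * LI) • M7' * (LG * LI) • M6' * LG • M5' *
      (LG * LH * LI * LJ) • M4' * (LG * LH) • M3' * M2' * (LA * LB) • M1'

/-- The `n`-simplices of the simplicial set of `T`: colorings satisfying the cocycle conditions and
the normalization conditions. -/
@[ext]
structure Simplex (T : ThreeCrossedModule G H L M) (n : ℕ) extends Coloring G H L M n where
  cocycle₂ : ∀ (i j k : Fin (n + 1)) (_ : i ≤ j) (_ : j ≤ k),
    g i k = T.dH (h i j k) * g j k * g i j
  cocycle₃ : ∀ (i j k p : Fin (n + 1)) (_ : i ≤ j) (_ : j ≤ k) (_ : k ≤ p),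
    T.dL (l i j k p) * h i k p * g k p • h i j k = h i j p * h j k p
  cocycle₄ : ∀ (i j k p q : Fin (n + 1)) (_ : i ≤ j) (_ : j ≤ k) (_ : k ≤ p) (_ : p ≤ q),
    T.dM (m i j k p q) * h i j q • l j k p q * l i j p q * h i p q • g p q • l i j k p =
      l i j k q * h i k q • (T.pf (h k p q) ((g p q * g k p) • h i j k))⁻¹ * l i k p q
  cocycle₅ : ∀ (i j k p q x : Fin (n + 1)) (hij : i ≤ j) (hjk : j ≤ k) (hkp : k ≤ p)
    (hpq : p ≤ q) (hqx : q ≤ x), T.FiveCocycle toColoring i j k p q x hij hjk hkp hpq hqx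
  g_refl : ∀ i : Fin (n + 1), g i i = 1
  h_left : ∀ (i j : Fin (n + 1)) (_ : i ≤ j), h i i j = 1
  h_right : ∀ (i j : Fin (n + 1)) (_ : i ≤ j), h i j j = 1
  l_left : ∀ (i j k : Fin (n + 1)) (_ : i ≤ j) (_ : j ≤ k), l i i j k = 1
  l_mid : ∀ (i j k : Fin (n + 1)) (_ : i ≤ j) (_ : j ≤ k), l i j j k = 1
  l_right : ∀ (i j k : Fin (n + 1)) (_ : i ≤ j) (_ : j ≤ k), l i j k k = 1
  m_1 : ∀ (i j k p : Fin (n + 1)) (_ : i ≤ j) (_ : j ≤ k) (_ : k ≤ p), m i i j k p = 1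
  m_2 : ∀ (i j k p : Fin (n + 1)) (_ : i ≤ j) (_ : j ≤ k) (_ : k ≤ p), m i j j k p = 1
  m_3 : ∀ (i j k p : Fin (n + 1)) (_ : i ≤ j) (_ : j ≤ k) (_ : k ≤ p), m i j k k p = 1
  m_4 : ∀ (i j k p : Fin (n + 1)) (_ : i ≤ j) (_ : j ≤ k) (_ : k ≤ p), m i j k p p = 1

/-- Precomposition of a coloring with a monotone map. -/
def Coloring.comap {n n' : ℕ} (c : Coloring G H L M n) (δ : Fin (n' + 1) →o Fin (n + 1)) :
    Coloring G H L M n' where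
  g i j h₁ := c.g (δ i) (δ j) (δ.monotone h₁)
  h i j k h₁ h₂ := c.h (δ i) (δ j) (δ k) (δ.monotone h₁) (δ.monotone h₂)
  l i j k p h₁ h₂ h₃ :=
    c.l (δ i) (δ j) (δ k) (δ p) (δ.monotone h₁) (δ.monotone h₂) (δ.monotone h₃)
  m i j k p q h₁ h₂ h₃ h₄ :=
    c.m (δ i) (δ j) (δ k) (δ p) (δ q) (δ.monotone h₁) (δ.monotone h₂) (δ.monotone h₃)
      (δ.monotone h₄)

/-- Precomposition of a simplex with a monotone map. -/
def Simplex.comap {T : ThreeCrossedModule G H L M} {n n' : ℕ} (s : T.Simplex n)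
    (δ : Fin (n' + 1) →o Fin (n + 1)) : T.Simplex n' where
  toColoring := s.toColoring.comap δ
  cocycle₂ _ _ _ h₁ h₂ := s.cocycle₂ _ _ _ (δ.monotone h₁) (δ.monotone h₂)
  cocycle₃ _ _ _ _ h₁ h₂ h₃ :=
    s.cocycle₃ _ _ _ _ (δ.monotone h₁) (δ.monotone h₂) (δ.monotone h₃)
  cocycle₄ _ _ _ _ _ h₁ h₂ h₃ h₄ :=
    s.cocycle₄ _ _ _ _ _ (δ.monotone h₁) (δ.monotone h₂) (δ.monotone h₃) (δ.monotone h₄)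
  cocycle₅ _ _ _ _ _ _ h₁ h₂ h₃ h₄ h₅ :=
    s.cocycle₅ _ _ _ _ _ _ (δ.monotone h₁) (δ.monotone h₂) (δ.monotone h₃) (δ.monotone h₄)
      (δ.monotone h₅)
  g_refl _ := s.g_refl _
  h_left _ _ h₁ := s.h_left _ _ (δ.monotone h₁)
  h_right _ _ h₁ := s.h_right _ _ (δ.monotone h₁)
  l_left _ _ _ h₁ h₂ := s.l_left _ _ _ (δ.monotone h₁) (δ.monotone h₂)
  l_mid _ _ _ h₁ h₂ := s.l_mid _ _ _ (δ.monotone h₁) (δ.monotone h₂)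
  l_right _ _ _ h₁ h₂ := s.l_right _ _ _ (δ.monotone h₁) (δ.monotone h₂)
  m_1 _ _ _ _ h₁ h₂ h₃ := s.m_1 _ _ _ _ (δ.monotone h₁) (δ.monotone h₂) (δ.monotone h₃)
  m_2 _ _ _ _ h₁ h₂ h₃ := s.m_2 _ _ _ _ (δ.monotone h₁) (δ.monotone h₂) (δ.monotone h₃)
  m_3 _ _ _ _ h₁ h₂ h₃ := s.m_3 _ _ _ _ (δ.monotone h₁) (δ.monotone h₂) (δ.monotone h₃)
  m_4 _ _ _ _ h₁ h₂ h₃ := s.m_4 _ _ _ _ (δ.monotone h₁) (δ.monotone h₂) (δ.monotone h₃)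

/-- The simplicial set `M_T` of a 3-crossed module `T`. -/
def simplicialSet (T : ThreeCrossedModule G H L M) : SSet.{max u₁ u₂ u₃ u₄} where
  obj Δ := T.Simplex Δ.unop.len
  map δ := ↾fun s => s.comap δ.unop.toOrderHom
  map_id _ := rfl
  map_comp _ _ := rfl

end ThreeCrossedModule

/-!
An inner horn `Λ^N_r` determines all cells of the simplex except possibly the `(N-1)`-cell
opposite to the vertex `r` and the cell of top dimension.

For `N ≤ 5` the cocycle condition on the `N`-simplex can be solved for the missing `(N-1)`-cell,
which enters exactly once, up to an inverse and the action of group elements. It has to be checked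
that this cell satisfies the cocycle condition of its own dimension. This holds since applying `∂`
to the condition on the `N`-simplex gives an equation which is also solved by the required
boundary: for `N = 4` this is `PeifferComplex.tetra_mul`, for `N = 5` it is
`PeifferComplex.Coherent.fiveLeft_eq_fiveRight`. For `N ≥ 7` nothing is missing, because the
cocycle conditions involve at most six vertices.

The main point is `N = 6`. All cells are given, and the 5-simplex identity holds for six of the
seven faces; it has to be deduced for the last one (`Cover.five_of_horn`). The two sides of the
identity have the same boundary in `L`, so they differ by an element of the kernel of `∂ : M → L`,
which is central in `M` and on which `H` and `L` act trivially. The claim is that the alternating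
sum of these deviations over the seven faces vanishes. The computation in the nonabelian group `M`
is avoided by comparing the 3-crossed module with a cover.

* `exists_cover` provides a complex `N → F → Γ` over `L → H → G`, with a Peiffer lifting, in which
  `M` embeds as the kernel of `N → F`. It is built from the free precrossed module resolving the
  2-crossed module `coker (M → L) → H → G` (`IsTwoCrossed.resolution`). As the kernel of `F → Γ`
  is a free group, its extension by `M` splits, and all actions can be chosen on free generators.
  The Peiffer lifting can be chosen equivariantly because `Γ` acts freely on nontrivial words.
* In such a cover the boundaries of the liftings, for instance
  `pf (c * b) a * (c • pf b a * pf c (∂b • a))⁻¹`, lie in `M`. They satisfy the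
  laws of a 3-crossed module and the 5-simplex identity for formal reasons
  (`PeifferComplex.lawful_boundary`,
  `PeifferComplex.Coherent.fiveLeft_eq_fiveRight`).
* The liftings of `T`, evaluated on the cover, deviate from these by functions with values in
  `ker ∂`. The laws for both kinds of liftings imply abelian laws for the deviations, which are
  collected in the structure `LinearLiftings` (`Cover.linear`). Since a `6`-simplex lifts to the
  cover (`Cover.exists_lift`), its deviations from the 5-simplex identity can be computed from
  these abelian liftings (`Cover.toCoeff_five`).
* The vanishing of the alternating sum is thereby reduced to `LinearLiftings.Cone.omega_eq_zero`.
  All data are transported to the last vertex, so that the edges of the spine become trivial. Then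
  the sum is a combination of the interchange law for two tetrahedra (`LinearLiftings.QL_QR`), of
  a pentagon relation for each of the two arguments of the Peiffer commutator
  (`LinearLiftings.QL_pentagon`, `LinearLiftings.QR_pentagon`), of the Yang–Baxter law
  (`LinearLiftings.QL_QR_swap`), and of identities for the bilinear form given by the LL-lifting.
-/

/-! ### Liftings with values in an abelian group, and their expansion laws -/

namespace ThreeCrossedModule

/-- Liftings with values in an abelian group `A`, over a precrossed module `d : F → Γ`. The laws are
those of a 3-crossed module in which the boundaries of the liftings are written out in `F`: the
Peiffer lifting becomes the Peiffer commutator `x * y * x⁻¹ * (d x • y)⁻¹`, and the role of the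
group `L` is played by the kernel of `d`. The functions `hl`, `hl'`, `ll` are defined on all of `F`,
but their laws only concern arguments in the kernel. -/
structure LinearLiftings (Γ : Type*) (F : Type*) (A : Type*) [Group Γ] [Group F]
    [AddCommGroup A] [MulDistribMulAction Γ F] [DistribMulAction Γ A] where
  d : F →* Γ
  d_smul : ∀ (γ : Γ) (f : F), d (γ • f) = γ * d f * γ⁻¹
  d_smul_A : ∀ (f : F) (a : A), d f • a = a
  lhom : F → F → F → A
  rhom : F → F → F → A
  hl : F → F → A
  hl' : F → F → A
  ll : F → F → A
  smul_lhom : ∀ (γ : Γ) (c b a : F), γ • lhom c b a = lhom (γ • c) (γ • b) (γ • a)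
  smul_rhom : ∀ (γ : Γ) (c b a : F), γ • rhom c b a = rhom (γ • c) (γ • b) (γ • a)
  smul_hl : ∀ (γ : Γ) (c l : F), d l = 1 → γ • hl c l = hl (γ • c) (γ • l)
  smul_hl' : ∀ (γ : Γ) (c l : F), d l = 1 → γ • hl' c l = hl' (γ • c) (γ • l)
  smul_ll : ∀ (γ : Γ) (l k : F), d l = 1 → d k = 1 → γ • ll l k = ll (γ • l) (γ • k)
  ll_conj : ∀ (f l k : F), d l = 1 → d k = 1 → ll (f * l * f⁻¹) (f * k * f⁻¹) = ll l k
  ll_mul_left : ∀ l₂ l₁ k : F, d l₂ = 1 → d l₁ = 1 → d k = 1 →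
    ll (l₂ * l₁) k = ll l₂ k + ll l₁ k
  ll_mul_right : ∀ l k₂ k₁ : F, d l = 1 → d k₂ = 1 → d k₁ = 1 →
    ll l (k₂ * k₁) = ll l k₂ + ll l k₁
  hl_mul_left : ∀ c b l : F, d l = 1 → hl (c * b) l = rhom l⁻¹ c b + hl c l + hl b l
  hl_mul_right : ∀ c l₂ l₁ : F, d l₂ = 1 → d l₁ = 1 →
    hl c (l₂ * l₁) = lhom l₁⁻¹ l₂⁻¹ c - ll l₁⁻¹ (l₂⁻¹ * c * l₂ * c⁻¹) + hl c l₂ + hl c l₁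
  hl'_mul_left : ∀ c b l : F, d l = 1 →
    hl' (c * b) l = lhom c b l⁻¹ + hl' b l + hl' c (d b • l)
  hl'_mul_right : ∀ c l₂ l₁ : F, d l₂ = 1 → d l₁ = 1 →
    hl' c (l₂ * l₁) = rhom c l₁⁻¹ l₂⁻¹ + hl' c l₁
      - ll (d c • l₁⁻¹) (c * l₂⁻¹ * c⁻¹ * (d c • l₂⁻¹)⁻¹) + hl' c l₂
  lhom_lhom : ∀ e c b a : F,
    lhom (e * c) b a + lhom e c (d b • a) = lhom e (c * b) a + lhom c b a
  rhom_rhom : ∀ e c b a : F,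
    rhom e (c * b) a + rhom e c b = rhom e c (b * a) + rhom e b a
  lhom_rhom : ∀ e c b a : F,
    lhom e c (b * a) + rhom e (d c • b) (d c • a) + rhom c b a =
      rhom (e * c) b a + lhom e c a + lhom e c b +
        ll (e * (d c • b) * e⁻¹ * (d e • d c • b)⁻¹)
          (((d (e * c) • b) * e) * (c * a * c⁻¹ * (d c • a)⁻¹) * ((d (e * c) • b) * e)⁻¹)
  yangBaxter : ∀ c b a p q : F, p = b * a * b⁻¹ * (d b • a)⁻¹ → q = c * b * c⁻¹ * (d c • b)⁻¹ →
    rhom c b a - rhom c (d b • a) b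
      + (rhom c p⁻¹ (b * a) + hl' c p
          - ll (d c • p⁻¹) (c * (b * a) * c⁻¹ * (d c • (b * a))⁻¹))
      + lhom c b a - lhom (d c • b) c a
      + (lhom q⁻¹ (c * b) a - ll q⁻¹ (c * b * a * (c * b)⁻¹ * (d (c * b) • a)⁻¹)
          + hl (d (c * b) • a) q) = 0
  ll_swap : ∀ l k : F, d l = 1 → d k = 1 → hl k l⁻¹ + ll k l = hl' l k⁻¹ - ll l k

namespace LinearLiftings

variable {Γ : Type*} {F : Type*} {A : Type*} [Group Γ] [Group F]
    [AddCommGroup A] [MulDistribMulAction Γ F] [DistribMulAction Γ A]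
  (D : LinearLiftings Γ F A)

/-- The Peiffer commutator of a precrossed module. -/
def P (x y : F) : F := x * y * x⁻¹ * (D.d x • y)⁻¹

/-- The deviation belonging to the passage from the Peiffer commutator of `c` and `a` to that of
`μ * c` and `a`, for `μ` in the kernel of `d`. -/
def NL (μ c a : F) : A := D.lhom μ c a - D.ll μ (D.P c a) + D.hl (D.d c • a) μ⁻¹

/-- The deviation belonging to the passage from the Peiffer commutator of `c` and `b` to that of
`c` and `l * b`, for `l` in the kernel of `d`. -/
def NR (c l b : F) : A := D.rhom c l b + D.hl' c l⁻¹ - D.ll (D.d c • l) (D.P c b)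

@[simp] lemma d_P (x y : F) : D.d (D.P x y) = 1 := by
  simp [P, D.d_smul]

lemma d_conj {l : F} (f : F) (h : D.d l = 1) : D.d (f * l * f⁻¹) = 1 := by
  simp [h]

lemma d_act {l : F} (γ : Γ) (h : D.d l = 1) : D.d (γ • l) = 1 := by
  simp [h, D.d_smul]

lemma P_eq (x y : F) : x * y * x⁻¹ * (D.d x • y)⁻¹ = D.P x y := rfl

lemma P_mul_left (x z y : F) :
    D.P (x * z) y = x * D.P z y * x⁻¹ * D.P x (D.d z • y) := by
  simp only [P, map_mul, mul_smul]; group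

lemma P_mul_right (c x y : F) :
    D.P c (x * y) = D.P c x * ((D.d c • x) * D.P c y * (D.d c • x)⁻¹) := by
  simp only [P, smul_mul']; group

lemma P_left {l : F} (h : D.d l = 1) (y : F) : D.P l y = l * y * l⁻¹ * y⁻¹ := by
  simp [P, h]

lemma ll_one_left {k : F} (hk : D.d k = 1) : D.ll 1 k = 0 := by
  simpa using D.ll_mul_left 1 1 k (map_one _) (map_one _) hk

lemma ll_one_right {k : F} (hk : D.d k = 1) : D.ll k 1 = 0 := by
  simpa using D.ll_mul_right k 1 1 hk (map_one _) (map_one _)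

lemma ll_inv_left {l k : F} (hl : D.d l = 1) (hk : D.d k = 1) : D.ll l⁻¹ k = -D.ll l k := by
  have := D.ll_mul_left l⁻¹ l k (by simp [hl]) hl hk
  rw [inv_mul_cancel, D.ll_one_left hk] at this
  exact eq_neg_of_add_eq_zero_left this.symm

lemma ll_inv_right {l k : F} (hl : D.d l = 1) (hk : D.d k = 1) : D.ll l k⁻¹ = -D.ll l k := by
  have := D.ll_mul_right l k⁻¹ k hl (by simp [hk]) hk
  rw [inv_mul_cancel, D.ll_one_right hl] at this
  exact eq_neg_of_add_eq_zero_left this.symm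

lemma ll_conj_right {f l k : F} (hf : D.d f = 1) (hl : D.d l = 1) (hk : D.d k = 1) :
    D.ll l (f * k * f⁻¹) = D.ll l k := by
  rw [D.ll_mul_right _ _ _ hl (by simp [hf, hk]) (by simp [hf]), D.ll_mul_right _ _ _ hl hf hk,
    D.ll_inv_right hl hf]
  abel

lemma ll_act {l k : F} (f : F) (hl : D.d l = 1) (hk : D.d k = 1) :
    D.ll (D.d f • l) (D.d f • k) = D.ll l k := by
  rw [← D.smul_ll _ _ _ hl hk, D.d_smul_A]

/-- Whiskering an argument of `ll` only depends on the image of the whisker in `Γ`. -/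
lemma ll_conj_congr {f g l k : F} (h : D.d f = D.d g) (hl : D.d l = 1) (hk : D.d k = 1) :
    D.ll l (f * k * f⁻¹) = D.ll l (g * k * g⁻¹) := by
  have := D.ll_conj_right (f := f * g⁻¹) (l := l) (k := g * k * g⁻¹) (by simp [h]) hl
    (by simp [hk])
  rw [← this]; congr 1; group

/-- `NL` is a cocycle in the element of the kernel. -/
lemma NL_mul {μ₂ μ₁ : F} (h₂ : D.d μ₂ = 1) (h₁ : D.d μ₁ = 1) (c a : F) :
    D.NL (μ₂ * μ₁) c a = D.NL μ₂ (μ₁ * c) a + D.NL μ₁ c a := by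
  have e1 := D.hl_mul_right (D.d c • a) μ₁⁻¹ μ₂⁻¹ (by simp [h₁]) (by simp [h₂])
  have e2 := D.lhom_lhom μ₂ μ₁ c a
  have e3 := D.ll_mul_left μ₂ μ₁ (D.P c a) h₂ h₁ (by simp)
  have e4 := D.ll_mul_right μ₂ (μ₁ * D.P c a * μ₁⁻¹) (D.P μ₁ (D.d c • a)) h₂ (by simp [h₁])
    (by simp)
  have e5 := D.ll_conj_right (f := μ₁) (l := μ₂) (k := D.P c a) h₁ h₂ (by simp)
  rw [← P_mul_left, e5, D.P_left h₁] at e4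
  simp only [inv_inv] at e1
  simp only [NL, map_mul, h₁, one_mul, mul_inv_rev]
  rw [e1]
  linear_combination (norm := abel) e2 - e3 + e4

/-- `NR` is a cocycle in the element of the kernel. -/
lemma NR_mul {l₂ l₁ : F} (h₂ : D.d l₂ = 1) (h₁ : D.d l₁ = 1) (c b : F) :
    D.NR c (l₂ * l₁) b = D.NR c l₂ (l₁ * b) + D.NR c l₁ b := by
  have a1 := D.d_act (D.d c) h₁
  have a2 := D.d_act (D.d c) h₂
  have e1 := D.hl'_mul_right c l₁⁻¹ l₂⁻¹ (by simp [h₁]) (by simp [h₂])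
  have e2 := D.rhom_rhom c l₂ l₁ b
  have e3 := D.ll_mul_left (D.d c • l₂) (D.d c • l₁) (D.P c b) a2 a1 (by simp)
  have e4 := D.ll_mul_right (D.d c • l₂) (D.P c l₁)
    ((D.d c • l₁) * D.P c b * (D.d c • l₁)⁻¹) a2 (by simp) (by simp [a1])
  rw [← P_mul_right, D.ll_conj_right a1 a2 (by simp)] at e4
  simp only [inv_inv, P_eq] at e1
  simp only [NR, smul_mul', mul_inv_rev]
  rw [e1]
  linear_combination (norm := abel) e2 - e3 + e4

lemma NL_mul' {μ₁ μ : F} (h₂ : D.d μ = 1) (h₁ : D.d μ₁ = 1) {c c' a : F} (hc : c' = μ₁ * c) :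
    D.NL μ c' a = D.NL (μ * μ₁) c a - D.NL μ₁ c a := by
  rw [D.NL_mul h₂ h₁, hc, add_sub_cancel_right]

lemma NR_mul' {μ₁ μ : F} (h₂ : D.d μ = 1) (h₁ : D.d μ₁ = 1) {c b b' : F} (hc : b' = μ₁ * b) :
    D.NR c μ b' = D.NR c (μ * μ₁) b - D.NR c μ₁ b := by
  rw [D.NR_mul h₂ h₁, hc, add_sub_cancel_right]

lemma hl'_act (f c l : F) (h : D.d l = 1) : D.hl' (D.d f • c) (D.d f • l) = D.hl' c l := by
  rw [← D.smul_hl' _ _ _ h, D.d_smul_A]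

lemma hl_act (f c l : F) (h : D.d l = 1) : D.hl (D.d f • c) (D.d f • l) = D.hl c l := by
  rw [← D.smul_hl _ _ _ h, D.d_smul_A]

/-- By the Yang–Baxter law, multiplying `v` by the conjugate `v * μ * v⁻¹` amounts to multiplying it
by `μ` from the right. -/
lemma NR_conj {μ : F} (hμ : D.d μ = 1) (c v : F) :
    D.NR c (v * μ * v⁻¹) v = D.rhom c v μ + D.hl' c μ⁻¹
      + D.ll (D.P c v) ((c * v) * μ * (c * v)⁻¹) := by
  have hm (γ : Γ) : D.d (γ • μ) = 1 := D.d_act γ hμ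
  have y := D.yangBaxter c v μ _ _ rfl rfl
  simp only [P_eq] at y
  have hP := D.d_P c v
  set p := D.P c v with hp
  have e1 : D.rhom c (D.P v μ)⁻¹ (v * μ) + D.hl' c (D.P v μ)
      - D.ll (D.d c • (D.P v μ)⁻¹) (D.P c (v * μ)) = D.NR c (D.P v μ)⁻¹ (v * μ) := by
    simp [NR]
  have e2 : D.lhom p⁻¹ (c * v) μ - D.ll p⁻¹ (D.P (c * v) μ) + D.hl (D.d (c * v) • μ) p
     = D.NL p⁻¹ (c * v) μ := by
    simp [NL]
  have e3 : D.NR c (D.P v μ)⁻¹ (v * μ) = D.NR c (D.d v • μ) v - D.NR c (v * μ * v⁻¹) v := by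
    rw [D.NR_mul' (μ₁ := v * μ * v⁻¹) (b := v) (by simp) (by simp [hμ]) (by group)]
    congr 2
    simp only [P]; group
  have e4 := D.ll_swap p⁻¹ (D.d (c * v) • μ) (by simp [hP]) (hm _)
  have e5 := D.hl'_mul_left p⁻¹ (c * v) μ⁻¹ (by simp [hμ])
  have e5' : p⁻¹ * (c * v) = (D.d c • v) * c := by simp only [hp, P]; group
  rw [e5', D.hl'_mul_left _ _ _ (by simp [hμ]), D.hl'_mul_left _ _ _ (by simp [hμ]),
    D.hl'_act _ _ _ (by simp [hμ])] at e5
  rw [D.ll_inv_left hP (hm _), D.ll_inv_right (hm _) hP] at e4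
  have e6 : (c * v) * μ * (c * v)⁻¹ = D.P (c * v) μ * (D.d (c * v) • μ) := by
    simp [P, mul_assoc]
  rw [e1, e2, e3] at y
  rw [e6, D.ll_mul_right _ _ _ hP (by simp) (hm _)]
  simp only [NL, NR, inv_inv, smul_inv', map_mul, mul_smul, ← hp] at y e4 e5 ⊢
  rw [D.ll_inv_left hP (by simp)] at y
  linear_combination (norm := abel) e4 - e5 - y

/-- By the Yang–Baxter law, multiplying `c` by the conjugate `c * μ * c⁻¹` amounts to multiplying it
by `μ` from the right. -/
lemma NL_conj {μ : F} (hμ : D.d μ = 1) (c v : F) :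
    D.NL (c * μ * c⁻¹) c v = D.lhom c μ v + D.hl v μ⁻¹
      + D.ll (D.P c v) ((c * v) * μ * (c * v)⁻¹) := by
  have x := D.NR_conj hμ c v
  have y := D.yangBaxter c μ v _ _ rfl rfl
  simp only [P_eq] at y
  have hm (γ : Γ) : D.d (γ • μ) = 1 := D.d_act γ hμ
  have e1 : D.rhom c (D.P μ v)⁻¹ (μ * v) + D.hl' c (D.P μ v)
      - D.ll (D.d c • (D.P μ v)⁻¹) (D.P c (μ * v)) = D.NR c (D.P μ v)⁻¹ (μ * v) := by
    simp [NR]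
  have e2 : D.lhom (D.P c μ)⁻¹ (c * μ) v - D.ll (D.P c μ)⁻¹ (D.P (c * μ) v)
      + D.hl (D.d (c * μ) • v) (D.P c μ) = D.NL (D.P c μ)⁻¹ (c * μ) v := by
    simp [NL]
  have e3 : D.NR c (D.P μ v)⁻¹ (μ * v) = D.NR c (v * μ * v⁻¹) v - D.NR c μ v := by
    rw [D.NR_mul' (μ₁ := μ) (b := v) (by simp) hμ rfl]
    congr 2
    simp [P, hμ]; group
  have e4 : D.NL (D.P c μ)⁻¹ (c * μ) v = D.NL (D.d c • μ) c v - D.NL (c * μ * c⁻¹) c v := by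
    rw [D.NL_mul' (μ₁ := c * μ * c⁻¹) (c := c) (by simp) (by simp [hμ]) (by group)]
    congr 2
    simp only [P]; group
  rw [e1, e2, e3, e4, hμ, one_smul] at y
  have e5 := D.hl_act c v μ⁻¹ (by simp [hμ])
  rw [smul_inv'] at e5
  simp only [NL, NR] at *
  linear_combination (norm := abel) x - y + e5

lemma lhom_mul_left {μ : F} (hμ : D.d μ = 1) (c b a : F) :
    D.lhom (μ * c) b a - D.lhom c b a =
      D.NL μ (c * b) a - D.NL μ c (D.d b • a) + D.ll μ (c * D.P b a * c⁻¹) := by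
  have e := D.lhom_lhom μ c b a
  have e2 := D.ll_mul_right μ _ _ hμ (D.d_conj c (D.d_P b a)) (D.d_P c (D.d b • a))
  rw [← P_mul_left] at e2
  simp only [NL, map_mul, mul_smul]
  linear_combination (norm := abel) e + e2

lemma lhom_mul_mid {μ : F} (hμ : D.d μ = 1) (c b a : F) :
    D.lhom c (μ * b) a - D.lhom c b a =
      D.NL (c * μ * c⁻¹) (c * b) a - D.NL μ b a
        - D.ll (D.P c (D.d b • a)) ((c * (D.d b • a)) * μ * (c * (D.d b • a))⁻¹) := by
  have e := D.lhom_lhom c μ b a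
  have e1 := D.lhom_mul_left (D.d_conj c hμ) c b a
  rw [inv_mul_cancel_right] at e1
  have e2 := D.NL_conj hμ c (D.d b • a)
  have e3 := D.ll_conj c μ (D.P b a) hμ (D.d_P _ _)
  simp only [NL] at *
  linear_combination (norm := abel) e1 - e - e2 + e3

lemma NR_add (c l b : F) :
    D.rhom c l b = D.NR c l b - D.hl' c l⁻¹ + D.ll (D.d c • l) (D.P c b) := by
  simp only [NR]; abel

lemma lhom_mul_right {l : F} (hl : D.d l = 1) (c b a : F) :
    D.lhom c b (l * a) - D.lhom c b a =
      D.NR (c * b) l a - D.NR c (D.d b • l) (D.d b • a) - D.NR b l a := by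
  have hm (γ : Γ) : D.d (γ • l) = 1 := D.d_act γ hl
  have e := D.lhom_rhom c b l a
  simp only [P_eq] at e
  have e1 := D.hl'_mul_left c b l⁻¹ (by simp [hl])
  have e2 := D.ll_mul_right (D.d c • D.d b • l) _ _ (hm _ |> D.d_act _)
    (D.d_conj c (D.d_P b a)) (D.d_P c (D.d b • a))
  rw [← P_mul_left] at e2
  have e3 : D.ll (D.P c (D.d b • l)) ((D.d (c * b) • l * c) * D.P b a * (D.d (c * b) • l * c)⁻¹)
      = D.ll (D.d b • l) (D.P b a) - D.ll (D.d c • D.d b • l) (c * D.P b a * c⁻¹) := by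
    have h : (D.d (c * b) • l * c) * D.P b a * (D.d (c * b) • l * c)⁻¹ =
      (D.d (c * b) • l) * (c * D.P b a * c⁻¹) * (D.d (c * b) • l)⁻¹ := by group
    rw [h, D.ll_conj_right (hm _) (D.d_P _ _) (by simp), P,
      D.ll_mul_left _ _ _ (by simp [hm]) (by simp [D.d_act _ (hm (D.d b))]) (by simp),
      D.ll_inv_left (D.d_act _ (hm _)) (by simp), D.ll_conj _ _ _ (hm _) (by simp)]
    abel
  rw [e3] at e
  simp only [NR_add, inv_inv] at *
  simp only [smul_inv', map_mul, mul_smul] at *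
  linear_combination (norm := abel) e - e1 + e2

lemma rhom_mul_left {μ : F} (hμ : D.d μ = 1) (c b a : F) :
    D.rhom (μ * c) b a - D.rhom c b a =
      D.NL μ c (b * a) - D.NL μ c b - D.NL μ c a := by
  have e := D.lhom_rhom μ c b a
  simp only [P_eq, hμ, one_smul, map_mul, one_mul] at e
  have e1 := D.hl_mul_left (D.d c • b) (D.d c • a) μ⁻¹ (by simp [hμ])
  rw [inv_inv] at e1
  have hP := D.d_P c a
  have e2 := D.ll_mul_right μ _ _ hμ (D.d_P c b) (D.d_conj (D.d c • b) hP)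
  rw [← P_mul_right] at e2
  have h : (D.d c • b * μ) * D.P c a * (D.d c • b * μ)⁻¹ = ((D.d c • b) * μ * (D.d c • b)⁻¹) *
      ((D.d c • b) * D.P c a * (D.d c • b)⁻¹) * ((D.d c • b) * μ * (D.d c • b)⁻¹)⁻¹ := by group
  have h' : μ * D.d c • b * μ⁻¹ * (D.d c • b)⁻¹ =
      μ * ((D.d c • b) * μ * (D.d c • b)⁻¹)⁻¹ := by group
  rw [h, h', D.ll_conj_right (by simp [hμ]) (by simp [hμ]) (by simp [hP]),
    D.ll_mul_left _ _ _ hμ (by simp [hμ]) (by simp [hP]),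
    D.ll_inv_left (by simp [hμ]) (by simp [hP]), D.ll_conj _ _ _ hμ hP] at e
  simp only [NL, smul_mul'] at *
  linear_combination (norm := abel) e2 - e - e1

lemma rhom_mul_mid {l : F} (hl : D.d l = 1) (c b a : F) :
    D.rhom c (l * b) a - D.rhom c b a = D.NR c l (b * a) - D.NR c l b
      + D.ll (D.d c • l) ((D.d c • b) * D.P c a * (D.d c • b)⁻¹) := by
  have e := D.rhom_rhom c l b a
  have e2 := D.ll_mul_right (D.d c • l) _ _ (D.d_act _ hl) (D.d_P c b)
    (D.d_conj (D.d c • b) (D.d_P c a))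
  rw [← P_mul_right] at e2
  simp only [NR] at *
  linear_combination (norm := abel) e + e2

lemma rhom_mul_right {l : F} (hl : D.d l = 1) (c b a : F) :
    D.rhom c b (l * a) - D.rhom c b a = D.NR c (b * l * b⁻¹) (b * a) - D.NR c l a
      - D.ll (D.P c b) ((c * b) * l * (c * b)⁻¹) := by
  have e := D.rhom_rhom c b l a
  have e1 := D.rhom_mul_mid (D.d_conj b hl) c b a
  rw [inv_mul_cancel_right] at e1
  have h : D.ll (D.d c • (b * l * b⁻¹)) ((D.d c • b) * D.P c a * (D.d c • b)⁻¹)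
      = D.ll (D.d c • l) (D.P c a) := by
    rw [← D.ll_conj (D.d c • b) _ _ (D.d_act _ hl) (D.d_P c a)]
    simp only [smul_mul', smul_inv']
  rw [h] at e1
  have e2 := D.NR_conj hl c b
  simp only [NR] at *
  linear_combination (norm := abel) e1 - e - e2

/-- `NL` and `NR` interchange: elements `μ` and `l` of the kernel may be multiplied to the two
arguments of the Peiffer commutator in either order. -/
lemma NL_mul_right {μ l : F} (hμ : D.d μ = 1) (hl : D.d l = 1) (c a : F) :
    D.NL μ c (l * a) - D.NL μ c a = D.NR (μ * c) l a - D.NR c l a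
      - D.ll (D.d c • l) ((D.d c • a) * μ * (D.d c • a)⁻¹) - D.ll μ (c * l * c⁻¹) := by
  have hm := D.d_act (D.d c) hl
  have e := D.lhom_mul_right hl μ c a
  have e1 := D.hl_mul_left (D.d c • l) (D.d c • a) μ⁻¹ (by simp [hμ])
  have e2 := D.ll_swap μ (D.d c • l) hμ hm
  have e3 : D.ll μ (D.P c (l * a)) = D.ll μ (c * l * c⁻¹) + D.ll μ (D.P c a)
      - D.ll μ (D.d c • l) := by
    have h : D.P c (l * a) = (c * l * c⁻¹) * D.P c a * (D.d c • l)⁻¹ := by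
      simp only [P, smul_mul']; group
    rw [h, D.ll_mul_right _ _ _ hμ (by simp [hl]) (by simp [hm]),
      D.ll_mul_right _ _ _ hμ (by simp [hl]) (by simp), D.ll_inv_right hμ hm]
    abel
  have e4 : D.ll (D.d c • l) (D.P μ (D.d c • a)) = D.ll (D.d c • l) μ
      - D.ll (D.d c • l) ((D.d c • a) * μ * (D.d c • a)⁻¹) := by
    have h : D.P μ (D.d c • a) = μ * ((D.d c • a) * μ * (D.d c • a)⁻¹)⁻¹ := by
      rw [D.P_left hμ]; group
    rw [h, D.ll_mul_right _ _ _ hm hμ (by simp [hμ]), D.ll_inv_right hm (by simp [hμ])]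
    abel
  simp only [NL, NR, smul_mul', hμ, one_smul, inv_inv, e3, e4] at *
  linear_combination (norm := abel) e + e1 + e2

end LinearLiftings
end ThreeCrossedModule

/-! ### Deviation of a tetrahedron on one side of the Peiffer lifting -/

namespace ThreeCrossedModule
namespace LinearLiftings

variable {Γ : Type*} {F : Type*} {A : Type*} [Group Γ] [Group F]
    [AddCommGroup A] [MulDistribMulAction Γ F] [DistribMulAction Γ A]
  (D : LinearLiftings Γ F A)

/-- The deviation on a tetrahedron whose triangles `α, β, γ, ε` satisfy `d (γ * ε) = d (α * β)`,
placed in the first argument of the Peiffer commutator with `a`. -/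
def QL (α β γ ε a : F) : A :=
  D.lhom γ ε a - D.lhom α β a - D.NL (γ * ε * (α * β)⁻¹) (α * β) a

/-- The deviation on a tetrahedron whose triangles `x, y, z, w` satisfy `d (z * w) = d (x * y)`,
placed in the second argument of the Peiffer commutator with `c`. -/
def QR (c x y z w : F) : A :=
  D.rhom c z w - D.rhom c x y - D.NR c (z * w * (x * y)⁻¹) (x * y)

/-- The interchange of a tetrahedron `α, β, γ, ε` in the first argument with a tetrahedron `x, y, z,
w` in the second argument of the Peiffer commutator. -/
lemma QL_QR {α β γ ε x y z w : F} (hμ : D.d (γ * ε) = D.d (α * β))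
    (hl : D.d (z * w) = D.d (x * y)) :
    D.QL α β γ ε z + D.QL α β γ ε w - D.QL α β γ ε x - D.QL α β γ ε y =
      D.QR γ (D.d ε • x) (D.d ε • y) (D.d ε • z) (D.d ε • w) + D.QR ε x y z w
      - D.QR α (D.d β • x) (D.d β • y) (D.d β • z) (D.d β • w) - D.QR β x y z w
      + (D.ll (D.P γ (D.d ε • x)) (((D.d (α * β) • x) * γ) * D.P ε y * ((D.d (α * β) • x) * γ)⁻¹)
        - D.ll (D.P α (D.d β • x)) (((D.d (α * β) • x) * α) * D.P β y * ((D.d (α * β) • x) * α)⁻¹)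
        - D.ll (D.P γ (D.d ε • z)) (((D.d (α * β) • z) * γ) * D.P ε w * ((D.d (α * β) • z) * γ)⁻¹)
        + D.ll (D.P α (D.d β • z)) (((D.d (α * β) • z) * α) * D.P β w * ((D.d (α * β) • z) * α)⁻¹)
        + D.ll (D.d (α * β) • (z * w * (x * y)⁻¹))
            ((D.d (α * β) • (x * y)) * (γ * ε * (α * β)⁻¹) * (D.d (α * β) • (x * y))⁻¹)
        + D.ll (γ * ε * (α * β)⁻¹) ((α * β) * (z * w * (x * y)⁻¹) * (α * β)⁻¹)) := by
  have dμ : D.d (γ * ε * (α * β)⁻¹) = 1 := by rw [map_mul, hμ, map_inv, mul_inv_cancel]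
  have dl : D.d (z * w * (x * y)⁻¹) = 1 := by rw [map_mul, hl, map_inv, mul_inv_cancel]
  have e1 := D.lhom_rhom γ ε z w
  have e2 := D.lhom_rhom γ ε x y
  have e3 := D.lhom_rhom α β z w
  have e4 := D.lhom_rhom α β x y
  have e5 := D.lhom_mul_right dl γ ε (x * y)
  have e6 := D.lhom_mul_right dl α β (x * y)
  have e7 := D.rhom_mul_left dμ (α * β) z w
  have e8 := D.rhom_mul_left dμ (α * β) x y
  have e9 := D.NL_mul_right dμ dl (α * β) (x * y)
  rw [hμ] at e1 e2
  simp only [inv_mul_cancel_right, P_eq] at e1 e2 e3 e4 e5 e6 e7 e8 e9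
  simp only [QL, QR, ← smul_mul', ← smul_inv'] at *
  linear_combination (norm := abel) e5 - e6 - e9 - e7 + e8 - e1 + e2 + e3 - e4

/-- The value of `lhom` on a word with three letters in the first argument; by `L3_eq` it does not
depend on the bracketing. -/
def L3 (c₃ c₂ c₁ a : F) : A := D.lhom (c₃ * c₂) c₁ a + D.lhom c₃ c₂ (D.d c₁ • a)

/-- The value of `rhom` on a word with three letters in the second argument; by `R3_eq` it does not
depend on the bracketing. -/
def R3 (c b₃ b₂ b₁ : F) : A := D.rhom c (b₃ * b₂) b₁ + D.rhom c b₃ b₂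

lemma L3_eq (c₃ c₂ c₁ a : F) : D.L3 c₃ c₂ c₁ a = D.lhom c₃ (c₂ * c₁) a + D.lhom c₂ c₁ a :=
  D.lhom_lhom _ _ _ _

lemma R3_eq (c b₃ b₂ b₁ : F) : D.R3 c b₃ b₂ b₁ = D.rhom c b₃ (b₂ * b₁) + D.rhom c b₂ b₁ :=
  D.rhom_rhom _ _ _ _

lemma NL_trans {u v w : F} (h₁ : D.d u = D.d v) (h₂ : D.d v = D.d w) (a : F) :
    D.NL (u * w⁻¹) w a = D.NL (u * v⁻¹) v a + D.NL (v * w⁻¹) w a := by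
  have := D.NL_mul (μ₂ := u * v⁻¹) (μ₁ := v * w⁻¹) (by simp [h₁]) (by simp [h₂]) w a
  simpa [mul_assoc] using this

lemma NR_trans {u v w : F} (h₁ : D.d u = D.d v) (h₂ : D.d v = D.d w) (c : F) :
    D.NR c (u * w⁻¹) w = D.NR c (u * v⁻¹) v + D.NR c (v * w⁻¹) w := by
  have := D.NR_mul (l₂ := u * v⁻¹) (l₁ := v * w⁻¹) (by simp [h₁]) (by simp [h₂]) c w
  simpa [mul_assoc] using this

/-- A tetrahedron in the first two letters of a word with three letters. -/
lemma L3_left {c₃ c₂ c₃' c₂' : F} (h : D.d (c₃' * c₂') = D.d (c₃ * c₂)) (c₁ a : F) :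
    D.L3 c₃' c₂' c₁ a = D.L3 c₃ c₂ c₁ a + D.QL c₃ c₂ c₃' c₂' (D.d c₁ • a)
      + D.NL ((c₃' * c₂' * c₁) * (c₃ * c₂ * c₁)⁻¹) (c₃ * c₂ * c₁) a
      + D.ll (c₃' * c₂' * (c₃ * c₂)⁻¹) ((c₃ * c₂) * D.P c₁ a * (c₃ * c₂)⁻¹) := by
  have e := D.lhom_mul_left (μ := c₃' * c₂' * (c₃ * c₂)⁻¹) (by rw [map_mul, h, map_inv,
    mul_inv_cancel]) (c₃ * c₂) c₁ a
  have h1 : (c₃' * c₂' * c₁) * (c₃ * c₂ * c₁)⁻¹ = c₃' * c₂' * (c₃ * c₂)⁻¹ := by group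
  rw [inv_mul_cancel_right] at e
  rw [h1]
  simp only [L3, QL]
  linear_combination (norm := abel) e

/-- A tetrahedron in the last two letters of a word with three letters. -/
lemma L3_right {c₂ c₁ c₂' c₁' : F} (h : D.d (c₂' * c₁') = D.d (c₂ * c₁)) (c₃ a : F) :
    D.L3 c₃ c₂' c₁' a = D.L3 c₃ c₂ c₁ a + D.QL c₂ c₁ c₂' c₁' a
      + D.NL ((c₃ * c₂' * c₁') * (c₃ * c₂ * c₁)⁻¹) (c₃ * c₂ * c₁) a
      - D.ll (D.P c₃ (D.d (c₂ * c₁) • a))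
        ((c₃ * (D.d (c₂ * c₁) • a)) * (c₂' * c₁' * (c₂ * c₁)⁻¹) *
          (c₃ * (D.d (c₂ * c₁) • a))⁻¹) := by
  have e := D.lhom_mul_mid (μ := c₂' * c₁' * (c₂ * c₁)⁻¹) (by rw [map_mul, h, map_inv,
    mul_inv_cancel]) c₃ (c₂ * c₁) a
  have h1 : (c₃ * c₂' * c₁') * (c₃ * c₂ * c₁)⁻¹ = c₃ * (c₂' * c₁' * (c₂ * c₁)⁻¹) * c₃⁻¹ := by
    group
  rw [inv_mul_cancel_right] at e
  rw [h1]
  simp only [L3_eq, QL, mul_assoc c₃ c₂ c₁]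
  linear_combination (norm := abel) e

/-- A tetrahedron in the first two letters of a word with three letters. -/
lemma R3_left {b₃ b₂ b₃' b₂' : F} (h : D.d (b₃' * b₂') = D.d (b₃ * b₂)) (c b₁ : F) :
    D.R3 c b₃' b₂' b₁ = D.R3 c b₃ b₂ b₁ + D.QR c b₃ b₂ b₃' b₂'
      + D.NR c ((b₃' * b₂' * b₁) * (b₃ * b₂ * b₁)⁻¹) (b₃ * b₂ * b₁)
      + D.ll (D.d c • (b₃' * b₂' * (b₃ * b₂)⁻¹))
        ((D.d c • (b₃ * b₂)) * D.P c b₁ * (D.d c • (b₃ * b₂))⁻¹) := by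
  have e := D.rhom_mul_mid (l := b₃' * b₂' * (b₃ * b₂)⁻¹) (by rw [map_mul, h, map_inv,
    mul_inv_cancel]) c (b₃ * b₂) b₁
  have h1 : (b₃' * b₂' * b₁) * (b₃ * b₂ * b₁)⁻¹ = b₃' * b₂' * (b₃ * b₂)⁻¹ := by group
  rw [inv_mul_cancel_right] at e
  rw [h1]
  simp only [R3, QR]
  linear_combination (norm := abel) e

/-- A tetrahedron in the last two letters of a word with three letters. -/
lemma R3_right {b₂ b₁ b₂' b₁' : F} (h : D.d (b₂' * b₁') = D.d (b₂ * b₁)) (c b₃ : F) :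
    D.R3 c b₃ b₂' b₁' = D.R3 c b₃ b₂ b₁ + D.QR c b₂ b₁ b₂' b₁'
      + D.NR c ((b₃ * b₂' * b₁') * (b₃ * b₂ * b₁)⁻¹) (b₃ * b₂ * b₁)
      - D.ll (D.P c b₃) ((c * b₃) * (b₂' * b₁' * (b₂ * b₁)⁻¹) * (c * b₃)⁻¹) := by
  have e := D.rhom_mul_right (l := b₂' * b₁' * (b₂ * b₁)⁻¹) (by rw [map_mul, h, map_inv,
    mul_inv_cancel]) c b₃ (b₂ * b₁)
  have h1 : (b₃ * b₂' * b₁') * (b₃ * b₂ * b₁)⁻¹ = b₃ * (b₂' * b₁' * (b₂ * b₁)⁻¹) * b₃⁻¹ := by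
    group
  rw [inv_mul_cancel_right] at e
  rw [h1]
  simp only [R3_eq, QR, mul_assoc b₃ b₂ b₁]
  linear_combination (norm := abel) e

/-- The Yang–Baxter law, for the degenerate tetrahedra which interchange two letters of a word at
the cost of an action. -/
lemma QL_QR_swap (c b a : F) :
    D.QL c b (D.d c • b) c a + D.QR c b a (D.d b • a) b = 0 := by
  have y := D.yangBaxter c b a _ _ rfl rfl
  have h1 : (D.d c • b) * c * (c * b)⁻¹ = (D.P c b)⁻¹ := by simp only [P]; group
  have h2 : (D.d b • a) * b * (b * a)⁻¹ = (D.P b a)⁻¹ := by simp only [P]; group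
  simp only [P_eq] at y
  simp only [QL, QR, h1, h2, NL, NR, inv_inv]
  linear_combination (norm := abel) -y

end LinearLiftings
end ThreeCrossedModule

/-! ### Pentagon relations, and the bilinear form twisted by a group element -/

namespace ThreeCrossedModule
namespace LinearLiftings

variable {Γ : Type*} {F : Type*} {A : Type*} [Group Γ] [Group F]
    [AddCommGroup A] [MulDistribMulAction Γ F] [DistribMulAction Γ A]
  (D : LinearLiftings Γ F A)

/-- The relation between the five tetrahedra of a 4-simplex in the first argument of the Peiffer
commutator: both sides compare the same two words with three letters.  The sixth term, on the right,
belongs to the interchange of the triangles `s'` and `c₁` which have no common edge. -/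
lemma QL_pentagon {c₃ c₂ c₁ x y y' z t s s' : F} (a : F)
    (h1 : D.d (x * y) = D.d (c₂ * c₁)) (h2 : D.d (z * t) = D.d (c₃ * x))
    (h3 : D.d (s * s') = D.d (t * y)) (h4 : D.d (y' * s') = D.d (c₃ * c₂))
    (h5 : D.d (z * s) = D.d (y' * (D.d s' • c₁))) :
    D.QL c₂ c₁ x y a + D.QL c₃ x z t (D.d y • a) + D.QL t y s s' a
      - D.QL c₃ c₂ y' s' (D.d c₁ • a) - D.QL y' (D.d s' • c₁) z s (D.d s' • a) =
    D.QL s' c₁ (D.d s' • c₁) s' a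
      + D.ll (D.P c₃ (D.d (c₂ * c₁) • a)) ((c₃ * (D.d (c₂ * c₁) • a)) *
          (x * y * (c₂ * c₁)⁻¹) * (c₃ * (D.d (c₂ * c₁) • a))⁻¹)
      - D.ll (z * t * (c₃ * x)⁻¹) ((c₃ * x) * D.P y a * (c₃ * x)⁻¹)
      + D.ll (D.P z (D.d (t * y) • a)) ((z * (D.d (t * y) • a)) *
          (s * s' * (t * y)⁻¹) * (z * (D.d (t * y) • a))⁻¹)
      + D.ll (y' * s' * (c₃ * c₂)⁻¹) ((c₃ * c₂) * D.P c₁ a * (c₃ * c₂)⁻¹)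
      - D.ll (D.P y' (D.d (s' * c₁) • a)) ((y' * (D.d (s' * c₁) • a)) *
          ((D.d s' • c₁) * s' * (s' * c₁)⁻¹) * (y' * (D.d (s' * c₁) • a))⁻¹)
      + D.ll (z * s * (y' * (D.d s' • c₁))⁻¹)
          ((y' * (D.d s' • c₁)) * D.P s' a * (y' * (D.d s' • c₁))⁻¹) := by
  have h6 : D.d ((D.d s' • c₁) * s') = D.d (s' * c₁) := by simp [D.d_smul]
  simp only [map_mul] at h1 h2 h3 h4 h5 h6
  have e1 := D.L3_right (by simpa using h1) c₃ a
  have e2 := D.L3_left (by simpa using h2) y a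
  have e3 := D.L3_right (by simpa using h3) z a
  have e4 := D.L3_left (by simpa using h4) c₁ a
  have e5 := D.L3_right (by simpa using h6) y' a
  have e6 := D.L3_left (by simpa using h5) s' a
  have n1 := D.NL_trans (u := z * t * y) (v := c₃ * x * y) (w := c₃ * c₂ * c₁)
    (by simp [h2]) (by simp only [map_mul, mul_assoc, h1]) a
  have n2 := D.NL_trans (u := z * s * s') (v := z * t * y) (w := c₃ * c₂ * c₁)
    (by simp only [map_mul, mul_assoc, h3])
    (by simp only [map_mul, h2]; simp only [mul_assoc, h1]) a
  have n3 := D.NL_trans (u := y' * (D.d s' • c₁) * s') (v := y' * s' * c₁) (w := c₃ * c₂ * c₁)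
    (by simp only [map_mul, mul_assoc, h6]) (by simp only [map_mul, h4]) a
  have n4 := D.NL_trans (u := z * s * s') (v := y' * (D.d s' • c₁) * s') (w := c₃ * c₂ * c₁)
    (by simp only [map_mul, h5])
    (by simp only [map_mul, mul_assoc, h6]; simp only [← mul_assoc, h4]) a
  linear_combination (norm := abel) e4 + e5 + e6 - e1 - e2 - e3 + n1 + n2 - n3 - n4

/-- The relation between the five tetrahedra of a 4-simplex in the second argument of the Peiffer
commutator: both sides compare the same two words with three letters.  The sixth term, on the right,
belongs to the interchange of the triangles `s'` and `b₁` which have no common edge. -/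
lemma QR_pentagon {b₃ b₂ b₁ x y y' z t s s' : F} (c : F)
    (h1 : D.d (x * y) = D.d (b₂ * b₁)) (h2 : D.d (z * t) = D.d (b₃ * x))
    (h3 : D.d (s * s') = D.d (t * y)) (h4 : D.d (y' * s') = D.d (b₃ * b₂))
    (h5 : D.d (z * s) = D.d (y' * (D.d s' • b₁))) :
    D.QR c b₂ b₁ x y + D.QR c b₃ x z t + D.QR c t y s s'
      - D.QR c b₃ b₂ y' s' - D.QR c y' (D.d s' • b₁) z s =
    D.QR c s' b₁ (D.d s' • b₁) s'
      + D.ll (D.P c b₃) ((c * b₃) * (x * y * (b₂ * b₁)⁻¹) * (c * b₃)⁻¹)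
      - D.ll (D.d c • (z * t * (b₃ * x)⁻¹))
        ((D.d c • (b₃ * x)) * D.P c y * (D.d c • (b₃ * x))⁻¹)
      + D.ll (D.P c z) ((c * z) * (s * s' * (t * y)⁻¹) * (c * z)⁻¹)
      + D.ll (D.d c • (y' * s' * (b₃ * b₂)⁻¹))
        ((D.d c • (b₃ * b₂)) * D.P c b₁ * (D.d c • (b₃ * b₂))⁻¹)
      - D.ll (D.P c y') ((c * y') * ((D.d s' • b₁) * s' * (s' * b₁)⁻¹) * (c * y')⁻¹)
      + D.ll (D.d c • (z * s * (y' * (D.d s' • b₁))⁻¹))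
        ((D.d c • (y' * (D.d s' • b₁))) * D.P c s' * (D.d c • (y' * (D.d s' • b₁)))⁻¹) := by
  have h6 : D.d ((D.d s' • b₁) * s') = D.d (s' * b₁) := by simp [D.d_smul]
  simp only [map_mul] at h1 h2 h3 h4 h5 h6
  have e1 := D.R3_right (by simpa using h1) c b₃
  have e2 := D.R3_left (by simpa using h2) c y
  have e3 := D.R3_right (by simpa using h3) c z
  have e4 := D.R3_left (by simpa using h4) c b₁
  have e5 := D.R3_right (by simpa using h6) c y'
  have e6 := D.R3_left (by simpa using h5) c s'
  have n1 := D.NR_trans (u := z * t * y) (v := b₃ * x * y) (w := b₃ * b₂ * b₁)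
    (by simp [h2]) (by simp only [map_mul, mul_assoc, h1]) c
  have n2 := D.NR_trans (u := z * s * s') (v := z * t * y) (w := b₃ * b₂ * b₁)
    (by simp only [map_mul, mul_assoc, h3])
    (by simp only [map_mul, h2]; simp only [mul_assoc, h1]) c
  have n3 := D.NR_trans (u := y' * (D.d s' • b₁) * s') (v := y' * s' * b₁) (w := b₃ * b₂ * b₁)
    (by simp only [map_mul, mul_assoc, h6]) (by simp only [map_mul, h4]) c
  have n4 := D.NR_trans (u := z * s * s') (v := y' * (D.d s' • b₁) * s') (w := b₃ * b₂ * b₁)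
    (by simp only [map_mul, h5])
    (by simp only [map_mul, mul_assoc, h6]; simp only [← mul_assoc, h4]) c
  linear_combination (norm := abel) e4 + e5 + e6 - e1 - e2 - e3 + n1 + n2 - n3 - n4

/-- `B X g Y` is `ll X (f * Y * f⁻¹)` for any `f` with `d f = g`; see `ll_eq_B`. It is zero if there
is no such `f`, which keeps it bilinear for all `g`. -/
noncomputable def B (X : F) (g : Γ) (Y : F) : A :=
  open Classical in
  if h : ∃ f, D.d f = g then D.ll X (h.choose * Y * h.choose⁻¹) else 0

lemma ll_eq_B {X Y : F} (f : F) (hX : D.d X = 1) (hY : D.d Y = 1) :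
    D.ll X (f * Y * f⁻¹) = D.B X (D.d f) Y := by
  have h : ∃ f', D.d f' = D.d f := ⟨f, rfl⟩
  rw [B, dif_pos h]
  exact (D.ll_conj_congr h.choose_spec hX hY).symm

/-- Identities for `B X g` hold trivially if `g` is not in the range of `d`, and otherwise they are
identities for `ll`. -/
lemma B_induction {g : Γ} {p : Prop} (h₁ : (¬ ∃ f, D.d f = g) → p) (h₂ : ∀ f, D.d f = g → p) :
    p := by
  by_cases h : ∃ f, D.d f = g
  · exact h₂ _ h.choose_spec
  · exact h₁ h

lemma B_mul_right {X Y Z : F} (g : Γ) (hX : D.d X = 1) (hY : D.d Y = 1) (hZ : D.d Z = 1) :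
    D.B X g (Y * Z) = D.B X g Y + D.B X g Z := by
  refine D.B_induction (g := g) (fun h => by simp [B, h]) ?_
  rintro f rfl
  rw [← D.ll_eq_B f hX (by simp [hY, hZ]), ← D.ll_eq_B f hX hY, ← D.ll_eq_B f hX hZ,
    ← D.ll_mul_right _ _ _ hX (by simp [hY]) (by simp [hZ])]
  congr 1; group

lemma B_mul_left {X X' Y : F} (g : Γ) (hX : D.d X = 1) (hX' : D.d X' = 1) (hY : D.d Y = 1) :
    D.B (X * X') g Y = D.B X g Y + D.B X' g Y := by
  refine D.B_induction (g := g) (fun h => by simp [B, h]) ?_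
  rintro f rfl
  rw [← D.ll_eq_B f (by simp [hX, hX']) hY, ← D.ll_eq_B f hX hY, ← D.ll_eq_B f hX' hY,
    ← D.ll_mul_left _ _ _ hX hX' (by simp [hY])]

lemma B_inv_right {X Y : F} (g : Γ) (hX : D.d X = 1) (hY : D.d Y = 1) :
    D.B X g Y⁻¹ = - D.B X g Y := by
  refine D.B_induction (g := g) (fun h => by simp [B, h]) ?_
  rintro f rfl
  rw [← D.ll_eq_B f hX (by simp [hY]), ← D.ll_eq_B f hX hY, ← D.ll_inv_right hX (by simp [hY])]
  congr 1; group

lemma B_inv_left {X Y : F} (g : Γ) (hX : D.d X = 1) (hY : D.d Y = 1) :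
    D.B X⁻¹ g Y = - D.B X g Y := by
  refine D.B_induction (g := g) (fun h => by simp [B, h]) ?_
  rintro f rfl
  rw [← D.ll_eq_B f (by simp [hX]) hY, ← D.ll_eq_B f hX hY, ← D.ll_inv_left hX (by simp [hY])]

lemma B_conj_right {X Y : F} (g : Γ) (f : F) (hX : D.d X = 1) (hY : D.d Y = 1) :
    D.B X g (f * Y * f⁻¹) = D.B X (g * D.d f) Y := by
  refine D.B_induction (g := g) (fun h => ?_) ?_
  · have : ¬ ∃ f', D.d f' = g * D.d f := fun ⟨f', h'⟩ => h ⟨f' * f⁻¹, by simp [h']⟩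
    simp [B, h, this]
  · rintro f' rfl
    rw [← map_mul, ← D.ll_eq_B _ hX hY, ← D.ll_eq_B _ hX (by simp [hY])]
    congr 1; group

lemma B_conj_left {X Y : F} (g : Γ) (f : F) (hX : D.d X = 1) (hY : D.d Y = 1) :
    D.B (f * X * f⁻¹) g Y = D.B X ((D.d f)⁻¹ * g) Y := by
  refine D.B_induction (g := g) (fun h => ?_) ?_
  · have : ¬ ∃ f', D.d f' = (D.d f)⁻¹ * g := fun ⟨f', h'⟩ => h ⟨f * f', by simp [h']⟩
    simp [B, h, this]
  · rintro f' rfl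
    rw [← map_inv, ← map_mul, ← D.ll_eq_B _ hX hY, ← D.ll_eq_B _ (by simp [hX]) hY,
      ← D.ll_conj f X _ hX (by simp [hY])]
    congr 1; group

lemma B_act_left {X Y : F} (g : Γ) (f : F) (hX : D.d X = 1) (hY : D.d Y = 1) :
    D.B (D.d f • X) g Y = D.B X ((D.d f)⁻¹ * g * D.d f) ((D.d f)⁻¹ • Y) := by
  refine D.B_induction (g := g) (fun h => ?_) ?_
  · have : ¬ ∃ f', D.d f' = (D.d f)⁻¹ * g * D.d f := fun ⟨f', h'⟩ =>
      h ⟨f * f' * f⁻¹, by simp [h', mul_assoc]⟩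
    simp [B, h, this]
  · rintro f' rfl
    have h : (D.d f)⁻¹ * D.d f' * D.d f = D.d ((D.d f)⁻¹ • f') := by
      rw [D.d_smul, inv_inv]
    rw [h, ← D.ll_eq_B _ hX (D.d_act _ hY), ← D.ll_eq_B _ (D.d_act _ hX) hY,
      ← D.ll_act f hX (by simp [D.d_act _ hY])]
    simp only [smul_mul', smul_inv', smul_inv_smul]

end LinearLiftings
end ThreeCrossedModule

/-! ### Relations between the tetrahedra of a 6-simplex with trivial spine -/

namespace ThreeCrossedModule
namespace LinearLiftings

variable {Γ : Type*} {F : Type*} {A : Type*} [Group Γ] [Group F]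
    [AddCommGroup A] [MulDistribMulAction Γ F] [DistribMulAction Γ A]
  (D : LinearLiftings Γ F A)

lemma smul_P (γ : Γ) (x y : F) : γ • D.P x y = D.P (γ • x) (γ • y) := by
  simp only [P, smul_mul', smul_inv', D.d_smul, smul_smul]
  group

lemma B_P_mul_right {X : F} (hX : D.d X = 1) (g : Γ) (c x y : F) :
    D.B X g (D.P c (x * y)) =
      D.B X g (D.P c x) + D.B X (g * (D.d c * D.d x * (D.d c)⁻¹)) (D.P c y) := by
  rw [P_mul_right, D.B_mul_right _ hX (by simp) (by simp), D.B_conj_right _ _ hX (by simp),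
    D.d_smul]

lemma B_P_mul_left {X : F} (hX : D.d X = 1) (g : Γ) (x y a : F) :
    D.B X g (D.P (x * y) a) =
      D.B X (g * D.d x) (D.P y a) + D.B X g (D.P x (D.d y • a)) := by
  rw [P_mul_left, D.B_mul_right _ hX (by simp) (by simp), D.B_conj_right _ _ hX (by simp)]

/-- Expansion of the Peiffer commutators of `c` with the two sides of a tetrahedron. -/
lemma B_P_of_eq {X l : F} (hX : D.d X = 1) (hl : D.d l = 1) (g : Γ) (c : F) {x y z w : F}
    (h : z * w = l * (x * y)) :
    D.B X (g * D.d c) l - D.B X g (D.d c • l) =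
      D.B X g (D.P c z) + D.B X (g * (D.d c * D.d z * (D.d c)⁻¹)) (D.P c w)
      - D.B X g (D.P c x) - D.B X (g * (D.d c * D.d x * (D.d c)⁻¹)) (D.P c y) := by
  have h1 := D.B_P_mul_right hX g c z w
  have hl' := D.d_act (D.d c) hl
  rw [h, D.B_P_mul_right hX, D.B_P_mul_right hX, P, D.B_mul_right _ hX (by simp [hl])
    (by simp [hl']), D.B_conj_right _ _ hX hl, D.B_inv_right _ hX hl'] at h1
  simp only [hl, mul_one, mul_inv_cancel] at h1
  linear_combination (norm := abel) h1

/-- Expansion of the Peiffer commutators of the two sides of a tetrahedron with `a`. -/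
lemma B_P_of_eq' {X l : F} (hX : D.d X = 1) (hl : D.d l = 1) (g : Γ) (a : F) {x y z w : F}
    (h : z * w = l * (x * y)) :
    D.B X g l - D.B X (g * (D.d (x * y) * D.d a * (D.d (x * y))⁻¹)) l =
      D.B X (g * D.d z) (D.P w a) + D.B X g (D.P z (D.d w • a))
      - D.B X (g * D.d x) (D.P y a) - D.B X g (D.P x (D.d y • a)) := by
  have h1 := D.B_P_mul_left hX g z w a
  have h2 : D.P l (D.d (x * y) • a) =
      l * ((D.d (x * y) • a) * l * (D.d (x * y) • a)⁻¹)⁻¹ := by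
    rw [D.P_left hl]; group
  rw [h, D.B_P_mul_left hX, D.B_P_mul_left hX, h2, D.B_mul_right _ hX hl (by simp [hl]),
    D.B_inv_right _ hX (by simp [hl]), D.B_conj_right _ _ hX hl, D.d_smul] at h1
  simp only [hl, mul_one] at h1
  linear_combination (norm := abel) h1

/-- Edges `γ`, triangles `K` and tetrahedra `L` of a `6`-simplex which satisfy the cocycle
conditions of `d : F → Γ` and for which the edges of the spine `0 → 1 → ⋯ → 6` are trivial. -/
structure Cone (γ : ℕ → ℕ → Γ) (K : ℕ → ℕ → ℕ → F) (L : ℕ → ℕ → ℕ → ℕ → F) : Prop where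
  d_K : ∀ i j k, i < j → j < k → k ≤ 6 → D.d (K i j k) = γ i k * (γ i j)⁻¹ * (γ j k)⁻¹
  K_mul : ∀ i j k p, i < j → j < k → k < p → p ≤ 6 →
    K i j p * K j k p = L i j k p * (K i k p * γ k p • K i j k)
  spine : ∀ i, i < 6 → γ i (i + 1) = 1

variable {D}
variable {γ : ℕ → ℕ → Γ} {K : ℕ → ℕ → ℕ → F} {L : ℕ → ℕ → ℕ → ℕ → F}

namespace Cone

variable (C : D.Cone γ K L)
include C

lemma d_L (i j k p : ℕ) (hij : i < j) (hjk : j < k) (hkp : k < p) (hp : p ≤ 6) :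
    D.d (L i j k p) = 1 := by
  have h := congrArg D.d (C.K_mul i j k p hij hjk hkp hp)
  simp only [map_mul, D.d_smul, C.d_K i j p hij (by lia) hp, C.d_K j k p hjk hkp hp,
    C.d_K i k p (by lia) hkp hp, C.d_K i j k hij hjk (by lia)] at h
  have h2 : γ i p * (γ i j)⁻¹ * (γ j p)⁻¹ * (γ j p * (γ j k)⁻¹ * (γ k p)⁻¹) =
    γ i p * (γ i k)⁻¹ * (γ k p)⁻¹ * (γ k p * (γ i k * (γ i j)⁻¹ * (γ j k)⁻¹) * (γ k p)⁻¹) := by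
    group
  rw [h2] at h
  exact right_eq_mul.mp h

/-- Since the spine is trivial, all edges lie in the range of `d`, so that the form `B` is
available. -/
lemma exists_d (i j : ℕ) (hij : i < j) (hj : j ≤ 6) : ∃ f, D.d f = γ i j := by
  obtain ⟨n, rfl⟩ := Nat.exists_eq_add_of_lt hij
  induction n with
  | zero => exact ⟨1, by rw [map_one, add_zero, C.spine i (by lia)]⟩
  | succ n ih =>
    obtain ⟨f, hf⟩ := ih (by lia) (by lia)
    refine ⟨K i (i + n + 1) (i + (n + 1) + 1) * f, ?_⟩
    have := C.spine (i + n + 1) (by lia)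
    rw [map_mul, C.d_K _ _ _ (by lia) (by lia) (by lia), hf,
      show i + (n + 1) + 1 = i + n + 1 + 1 by lia, this]
    group

/-- The relation between the `3`-cells of a `4`-simplex. -/
lemma L_mul (i j k p q : ℕ) (hij : i < j) (hjk : j < k) (hkp : k < p) (hpq : p < q)
    (hq : q ≤ 6) :
    K i j q * L j k p q * (K i j q)⁻¹ * L i j p q * (K i p q * γ p q • L i j k p * (K i p q)⁻¹) =
      L i j k q * (K i k q * (D.P (K k p q) ((γ p q * γ k p) • K i j k))⁻¹ * (K i k q)⁻¹)
        * L i k p q := by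
  have a1 := C.K_mul j k p q hjk hkp hpq hq
  have a2 := C.K_mul i j p q hij (by lia) hpq hq
  have a3 := congrArg (γ p q • ·) (C.K_mul i j k p hij hjk hkp (by lia))
  have a4 := C.K_mul i j k q hij hjk (by lia) hq
  have a5 := C.K_mul i k p q (by lia) hkp hpq hq
  simp only [smul_mul'] at a3
  rw [eq_mul_inv_of_mul_eq a1.symm, eq_mul_inv_of_mul_eq a2.symm,
    eq_mul_inv_of_mul_eq a3.symm, eq_mul_inv_of_mul_eq a4.symm,
    eq_mul_inv_of_mul_eq a5.symm]
  have h : D.d (K k p q) * (γ p q * γ k p) = γ k q := by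
    rw [C.d_K k p q hkp hpq hq]; group
  simp only [P, smul_smul, h]
  group

/-- The relation between the tetrahedra of a `4`-simplex in the second argument of `B`. -/
lemma B_L_mul_right {X : F} (hX : D.d X = 1) (g : Γ) (i j k p q : ℕ) (hij : i < j) (hjk : j < k)
    (hkp : k < p) (hpq : p < q) (hq : q ≤ 6) :
    D.B X (g * D.d (K i j q)) (L j k p q) + D.B X g (L i j p q)
        + D.B X (g * D.d (K i p q)) (γ p q • L i j k p) =
      D.B X g (L i j k q)
        - D.B X (g * D.d (K i k q)) (D.P (K k p q) ((γ p q * γ k p) • K i j k))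
        + D.B X g (L i k p q) := by
  have h := congrArg (D.B X g) (C.L_mul i j k p q hij hjk hkp hpq hq)
  have d1 := C.d_L j k p q hjk hkp hpq hq
  have d2 := C.d_L i j p q hij (by lia) hpq hq
  have d3 := D.d_act (γ p q) (C.d_L i j k p hij hjk hkp (by lia))
  have d4 := C.d_L i j k q hij hjk (by lia) hq
  have d5 := C.d_L i k p q (by lia) hkp hpq hq
  have d6 := D.d_P (K k p q) ((γ p q * γ k p) • K i j k)
  rwa [D.B_mul_right _ hX (by simp [d1, d2]) (by simp [d3]),
    D.B_mul_right _ hX (by simp [d1]) d2,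
    D.B_mul_right (Y := L i j k q * _) _ hX (by simp [d4]) d5,
    D.B_mul_right (Y := L i j k q) _ hX d4 (by simp),
    D.B_conj_right _ _ hX d1, D.B_conj_right _ _ hX d3, D.B_conj_right _ _ hX (by simp),
    D.B_inv_right _ hX d6, ← sub_eq_add_neg] at h

/-- The relation between the tetrahedra of a `4`-simplex in the first argument of `B`. -/
lemma B_L_mul_left {Y : F} (hY : D.d Y = 1) (g : Γ) (i j k p q : ℕ) (hij : i < j) (hjk : j < k)
    (hkp : k < p) (hpq : p < q) (hq : q ≤ 6) :
    D.B (L j k p q) ((D.d (K i j q))⁻¹ * g) Y + D.B (L i j p q) g Y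
        + D.B (L i j k p) ((γ p q)⁻¹ * ((D.d (K i p q))⁻¹ * g) * γ p q) ((γ p q)⁻¹ • Y) =
      D.B (L i j k q) g Y
        - D.B (D.P (K k p q) ((γ p q * γ k p) • K i j k)) ((D.d (K i k q))⁻¹ * g) Y
        + D.B (L i k p q) g Y := by
  have h := congrArg (D.B · g Y) (C.L_mul i j k p q hij hjk hkp hpq hq)
  have d1 := C.d_L j k p q hjk hkp hpq hq
  have d2 := C.d_L i j p q hij (by lia) hpq hq
  have d3' := C.d_L i j k p hij hjk hkp (by lia)
  have d3 := D.d_act (γ p q) d3'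
  have d4 := C.d_L i j k q hij hjk (by lia) hq
  have d5 := C.d_L i k p q (by lia) hkp hpq hq
  have d6 := D.d_P (K k p q) ((γ p q * γ k p) • K i j k)
  obtain ⟨f, hf⟩ := C.exists_d p q hpq hq
  rw [D.B_mul_left _ (by simp [d1, d2]) (by simp [d3]) hY,
    D.B_mul_left _ (by simp [d1]) d2 hY,
    D.B_mul_left (X := L i j k q * _) _ (by simp [d4]) d5 hY,
    D.B_mul_left (X := L i j k q) _ d4 (by simp) hY,
    D.B_conj_left _ _ d1 hY, D.B_conj_left _ _ d3 hY, D.B_conj_left _ _ (by simp) hY,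
    D.B_inv_left _ d6 hY, ← sub_eq_add_neg] at h
  rwa [← hf, D.B_act_left _ _ d3' hY, hf] at h

end Cone
end LinearLiftings
end ThreeCrossedModule

/-! ### The abelian 5-simplex identity and its alternating sum -/

namespace ThreeCrossedModule
namespace LinearLiftings

variable {Γ : Type*} {F : Type*} {A : Type*} [Group Γ] [Group F]
    [AddCommGroup A] [MulDistribMulAction Γ F] [DistribMulAction Γ A]
  (D : LinearLiftings Γ F A)

/-- The contribution of `ll` to the deviation from the 5-simplex identity. -/
def omegaLL (γ : ℕ → ℕ → Γ) (K : ℕ → ℕ → ℕ → F) (L : ℕ → ℕ → ℕ → ℕ → F)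
    (i j k p q x : ℕ) : A :=
  D.ll (L i k q x) ((K i q x * γ q x • K i k q) *
      D.P (γ q x • K k p q) ((γ q x * γ p q * γ k p) • K i j k) * (K i q x * γ q x • K i k q)⁻¹)
  + D.ll (L i j k x) ((K i k x * γ k x • K i j k) * L k p q x * (K i k x * γ k x • K i j k)⁻¹)
  - D.ll (L i k p x) ((K i p x * γ p x • K i k p) *
      D.P (K p q x) ((γ q x * γ p q * γ k p) • K i j k) * (K i p x * γ p x • K i k p)⁻¹)
  + D.ll (L i j p x) ((K i p x * γ p x • K i j p) *
      D.P (K p q x) ((γ q x * γ p q) • K j k p) * (K i p x * γ p x • K i j p)⁻¹)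
  + D.ll (L i p q x) ((K i q x * γ q x • K i p q) *
      (γ q x * γ p q) • L i j k p * (K i q x * γ q x • K i p q)⁻¹)
  + D.ll (L i j q x) ((K i q x * γ q x • K i j q) *
      γ q x • L j k p q * (K i q x * γ q x • K i j q)⁻¹)

/-- The deviation from the 5-simplex identity in the abelian setting, apart from the contribution of
the `4`-cells. -/
def omega (γ : ℕ → ℕ → Γ) (K : ℕ → ℕ → ℕ → F) (L : ℕ → ℕ → ℕ → ℕ → F)
    (i j k p q x : ℕ) : A :=
  D.QL (K k q x) (γ q x • K k p q) (K k p x) (K p q x) ((γ q x * γ p q * γ k p) • K i j k)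
  + D.QR (K p q x) ((γ q x * γ p q) • K i k p) ((γ q x * γ p q * γ k p) • K i j k)
      ((γ q x * γ p q) • K i j p) ((γ q x * γ p q) • K j k p)
  + D.omegaLL γ K L i j k p q x

variable {D}
variable {γ : ℕ → ℕ → Γ} {K : ℕ → ℕ → ℕ → F} {L : ℕ → ℕ → ℕ → ℕ → F}

/-- The deviations on the seven faces of a `6`-simplex add up to zero. The contributions of `lhom`
and `rhom` cancel by the interchange law for the tetrahedra `3456` and `0123`, the two pentagon
relations for `23456` and `01234`, and the Yang–Baxter law. There remain values of the bilinear
form, which cancel by the relations between the tetrahedra of the `4`-faces. -/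
theorem Cone.omega_eq_zero (C : D.Cone γ K L) :
    D.omega γ K L 1 2 3 4 5 6 - D.omega γ K L 0 2 3 4 5 6 + D.omega γ K L 0 1 3 4 5 6
      - D.omega γ K L 0 1 2 4 5 6 + D.omega γ K L 0 1 2 3 5 6 - D.omega γ K L 0 1 2 3 4 6
      + D.omega γ K L 0 1 2 3 4 5 = 0 := by
  have g01 := C.spine 0 (by simp)
  have g12 := C.spine 1 (by simp)
  have g23 := C.spine 2 (by simp)
  have g34 := C.spine 3 (by simp)
  have g45 := C.spine 4 (by simp)
  have g56 := C.spine 5 (by simp)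
  simp only [Nat.reduceAdd] at g01 g12 g23 g34 g45 g56
  have hm (i j k p : ℕ) (hij : i < j) (hjk : j < k) (hkp : k < p) (hp : p ≤ 6) :
      K i j p * K j k p * (K i k p * γ k p • K i j k)⁻¹ = L i j k p :=
    mul_inv_eq_of_eq_mul (C.K_mul i j k p hij hjk hkp hp)
  have dL := C.d_L
  have dK := C.d_K
  have dP := D.d_P
  have m1 : K 3 4 6 * K 4 5 6 * (K 3 5 6 * K 3 4 5)⁻¹ = L 3 4 5 6 := by
    simpa [g56] using hm 3 4 5 6
  have m2 : K 0 1 3 * K 1 2 3 * (K 0 2 3 * K 0 1 2)⁻¹ = L 0 1 2 3 := by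
    simpa [g23] using hm 0 1 2 3
  have m3 : K 2 3 5 * K 3 4 5 * (K 2 4 5 * K 2 3 4)⁻¹ = L 2 3 4 5 := by
    simpa [g45] using hm 2 3 4 5
  have m4 : K 2 3 6 * K 3 5 6 * (K 2 5 6 * K 2 3 5)⁻¹ = L 2 3 5 6 := by
    simpa [g56] using hm 2 3 5 6
  have m5 : K 2 4 6 * K 4 5 6 * (K 2 5 6 * K 2 4 5)⁻¹ = L 2 4 5 6 := by
    simpa [g56] using hm 2 4 5 6
  have m6 : K 2 3 6 * K 3 4 6 * (K 2 4 6 * (D.d (K 4 5 6) • K 2 3 4))⁻¹ = L 2 3 4 6 := by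
    simpa [dK, g56, g45] using hm 2 3 4 6
  have n1 : K 0 2 4 * K 2 3 4 * (K 0 3 4 * K 0 2 3)⁻¹ = L 0 2 3 4 := by
    simpa [g34] using hm 0 2 3 4
  have n2 : K 0 1 4 * K 1 3 4 * (K 0 3 4 * K 0 1 3)⁻¹ = L 0 1 3 4 := by
    simpa [g34] using hm 0 1 3 4
  have n3 : K 1 2 4 * K 2 3 4 * (K 1 3 4 * K 1 2 3)⁻¹ = L 1 2 3 4 := by
    simpa [g34] using hm 1 2 3 4
  have n4 : K 0 1 4 * K 1 2 4 * (K 0 2 4 * (D.d (K 2 3 4) • K 0 1 2))⁻¹ = L 0 1 2 4 := by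
    simpa [dK, g34, g23] using hm 0 1 2 4
  have hd {x y z w l : F} (h : x * y * (z * w)⁻¹ = l) (hl : D.d l = 1) :
      D.d (x * y) = D.d (z * w) := by
    rw [← h, map_mul, map_inv] at hl
    exact mul_inv_eq_one.mp hl
  -- the relations which involve `lhom` and `rhom`
  have e1 := D.QL_QR (hd m1 (by simp [dL])) (hd m2 (by simp [dL]))
  have e2 := D.QL_pentagon (K 0 1 2) (hd m3 (by simp [dL])) (hd m4 (by simp [dL]))
    (hd m1 (by simp [dL])) (hd m5 (by simp [dL])) (hd m6 (by simp [dL]))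
  have e3 := D.QR_pentagon (K 4 5 6) (hd m2 (by simp [dL])) (hd n2 (by simp [dL]))
    (hd n3 (by simp [dL])) (hd n1 (by simp [dL])) (hd n4 (by simp [dL]))
  have e4 := D.QL_QR_swap (K 4 5 6) (K 2 3 4) (K 0 1 2)
  have s1 : (D.d (K 4 5 6) • K 2 3 4) * K 4 5 6 * (K 4 5 6 * K 2 3 4)⁻¹ =
    (D.P (K 4 5 6) (K 2 3 4))⁻¹ := by simp only [P]; group
  have s2 : (D.d (K 2 3 4) • K 0 1 2) * K 2 3 4 * (K 2 3 4 * K 0 1 2)⁻¹ =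
    (D.P (K 2 3 4) (K 0 1 2))⁻¹ := by simp only [P]; group
  simp only [m1, m2, m3, m4, m5, m6, n1, n2, n3, n4, s1, s2] at e1 e2 e3
  -- the relations which only involve the bilinear form
  have a1 := C.B_L_mul_left (Y := L 2 3 4 5) (by simp [dL]) (D.d (K 0 1 6 * K 1 2 6 * K 2 5 6))
    0 1 2 5 6 (by simp) (by simp) (by simp) (by simp) le_rfl
  have a2 := C.B_L_mul_left (Y := L 3 4 5 6) (by simp [dL]) (D.d (K 0 1 6 * K 1 2 6 * K 2 3 6))
    0 1 2 3 6 (by simp) (by simp) (by simp) (by simp) le_rfl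
  have a3 := C.B_L_mul_left (Y := D.P (K 3 4 5) (K 1 2 3)) (D.d_P _ _)
    (D.d (K 0 1 6 * K 1 3 6 * K 3 5 6)) 0 1 3 5 6 (by simp) (by simp) (by simp) (by simp) le_rfl
  have a4 := C.B_L_mul_left (Y := L 1 2 3 4) (by simp [dL]) (D.d (K 0 1 6 * K 1 4 6 * K 4 5 6))
    0 1 4 5 6 (by simp) (by simp) (by simp) (by simp) le_rfl
  have a5 := C.B_L_mul_left (Y := D.P (K 4 5 6) (K 1 2 3)) (D.d_P _ _)
    (D.d (K 0 1 6 * K 1 3 6 * K 3 4 6)) 0 1 3 4 6 (by simp) (by simp) (by simp) (by simp) le_rfl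
  have a6 := C.B_L_mul_left (Y := D.P (K 2 3 4) (K 0 1 2)) (D.d_P _ _)
    (D.d (K 0 2 6 * K 2 4 6 * K 4 5 6)) 0 2 4 5 6 (by simp) (by simp) (by simp) (by simp) le_rfl
  have a7 := C.B_L_mul_left (Y := D.P (K 3 4 5) (K 0 1 2)) (D.d_P _ _)
    (D.d (K 0 2 6 * K 2 3 6 * K 3 5 6)) 0 2 3 5 6 (by simp) (by simp) (by simp) (by simp) le_rfl
  have a8 := C.B_L_mul_left (Y := D.P (K 4 5 6) (K 0 1 2)) (D.d_P _ _)
    (D.d (K 0 2 6 * K 2 3 6 * K 3 4 6)) 0 2 3 4 6 (by simp) (by simp) (by simp) (by simp) le_rfl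
  have a9 := C.B_L_mul_left (Y := L 0 1 2 3) (by simp [dL]) (D.d (K 0 3 6 * K 3 4 6 * K 4 5 6))
    0 3 4 5 6 (by simp) (by simp) (by simp) (by simp) le_rfl
  have a10 := C.B_L_mul_left (Y := D.P (K 4 5 6) (K 2 3 4)) (D.d_P _ _)
    (D.d (K 0 1 6 * K 1 2 6 * K 2 4 6)) 0 1 2 4 6 (by simp) (by simp) (by simp) (by simp) le_rfl
  have b1 := C.B_L_mul_right (X := L 0 1 2 6) (by simp [dL]) (D.d (K 0 1 6 * K 1 2 6))
    2 3 4 5 6 (by simp) (by simp) (by simp) (by simp) (by simp)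
  have b2 := C.B_L_mul_right (X := L 0 1 5 6) (by simp [dL]) (D.d (K 0 1 6 * K 1 5 6))
    1 2 3 4 5 (by simp) (by simp) (by simp) (by simp) (by simp)
  have b3 := C.B_L_mul_right (X := L 0 4 5 6) (by simp [dL]) (D.d (K 0 4 6 * K 4 5 6))
    0 1 2 3 4 (by simp) (by simp) (by simp) (by simp) (by simp)
  have b4 := D.B_P_of_eq (X := L 0 3 5 6) (by simp [dL])
    (dL 0 1 2 3 (by simp) (by simp) (by simp) (by simp))
    (D.d (K 0 3 6 * K 3 5 6)) (K 3 4 5) (C.K_mul 0 1 2 3 (by simp) (by simp) (by simp) (by simp))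
  have b5 := D.B_P_of_eq (X := L 0 1 4 6) (by simp [dL])
    (dL 1 2 3 4 (by simp) (by simp) (by simp) (by simp))
    (D.d (K 0 1 6 * K 1 4 6)) (K 4 5 6) (C.K_mul 1 2 3 4 (by simp) (by simp) (by simp) (by simp))
  have b6 := D.B_P_of_eq (X := L 0 3 4 6) (by simp [dL])
    (dL 0 1 2 3 (by simp) (by simp) (by simp) (by simp))
    (D.d (K 0 3 6 * K 3 4 6)) (K 4 5 6) (C.K_mul 0 1 2 3 (by simp) (by simp) (by simp) (by simp))
  have b7 := D.B_P_of_eq' (X := L 0 2 5 6) (by simp [dL])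
    (dL 2 3 4 5 (by simp) (by simp) (by simp) (by simp))
    (D.d (K 0 2 6 * K 2 5 6)) (K 0 1 2) (C.K_mul 2 3 4 5 (by simp) (by simp) (by simp) (by simp))
  have b8 := D.B_P_of_eq' (X := L 0 2 3 6) (by simp [dL])
    (dL 3 4 5 6 (by simp) (by simp) (by simp) (by simp))
    (D.d (K 0 2 6 * K 2 3 6)) (K 0 1 2) (C.K_mul 3 4 5 6 (by simp) (by simp) (by simp) (by simp))
  have b9 := D.B_P_of_eq' (X := L 0 1 3 6) (by simp [dL])
    (dL 3 4 5 6 (by simp) (by simp) (by simp) (by simp))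
    (D.d (K 0 1 6 * K 1 3 6)) (K 1 2 3) (C.K_mul 3 4 5 6 (by simp) (by simp) (by simp) (by simp))
  have b10 := D.B_P_of_eq (X := L 0 2 4 6) (by simp [dL]) (dP (K 2 3 4) (K 0 1 2))
    (D.d (K 0 2 6 * K 2 4 6)) (K 4 5 6) (z := K 2 3 4) (w := K 0 1 2)
    (x := D.d (K 2 3 4) • K 0 1 2) (y := K 2 3 4) (by simp only [P]; group)
  -- all values of `ll` are written as values of `B` with arguments in normal form
  simp only [omega, omegaLL]
  simp (disch := simp [dL, D.d_smul]) only [D.ll_eq_B] at e1 e2 e3 ⊢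
  simp (disch := simp [dL, D.d_smul]) only [D.B_act_left, D.B_inv_right] at e1 e2 e3
  simp (disch := simp) only [dK, map_mul, D.d_smul, smul_P, smul_mul', smul_smul,
    g01, g12, g23, g34, g45, g56, mul_assoc, mul_inv_rev, inv_inv, inv_one,
    mul_inv_cancel_left, inv_mul_cancel_left, mul_inv_cancel, inv_mul_cancel, one_mul, mul_one,
    one_smul] at e1 e2 e3 a1 a2 a3 a4 a5 a6 a7 a8 a9 a10 b1 b2 b3 b4 b5 b6 b7 b8 b9 b10 e4 ⊢
  linear_combination (norm := abel) e1 + e2 + e3 + e4 + a1 + a2 + a3 + a4 - a5 + a6 - a7 + a8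
    + a9 + a10 + b1 - b2 + b3 - b4 + b5 + b6 - b7 - b8 + b9 + b10

end LinearLiftings
end ThreeCrossedModule

/-! ### Transport along the spine -/

namespace ThreeCrossedModule
namespace LinearLiftings

variable {Γ : Type*} {F : Type*} {A : Type*} [Group Γ] [Group F]
    [AddCommGroup A] [MulDistribMulAction Γ F] [DistribMulAction Γ A]
  (D : LinearLiftings Γ F A)

lemma smul_NL (γ : Γ) {μ : F} (hμ : D.d μ = 1) (c a : F) :
    γ • D.NL μ c a = D.NL (γ • μ) (γ • c) (γ • a) := by
  have h : D.d (γ • c) • γ • a = γ • D.d c • a := by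
    rw [D.d_smul, smul_smul, inv_mul_cancel_right, mul_smul]
  rw [NL, NL, smul_add, smul_sub, D.smul_lhom, D.smul_ll _ _ _ hμ (by simp),
    D.smul_hl _ _ _ (by simp [hμ]), D.smul_P, h, smul_inv']

lemma smul_NR (γ : Γ) {l : F} (hl : D.d l = 1) (c b : F) :
    γ • D.NR c l b = D.NR (γ • c) (γ • l) (γ • b) := by
  have h : D.d (γ • c) • γ • l = γ • D.d c • l := by
    rw [D.d_smul, smul_smul, inv_mul_cancel_right, mul_smul]
  rw [NR, NR, smul_sub, smul_add, D.smul_rhom, D.smul_ll _ _ _ (D.d_act _ hl) (by simp),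
    D.smul_hl' _ _ _ (by simp [hl]), D.smul_P, h, smul_inv']

lemma smul_QL (u : Γ) {α β γ ε : F} (h : D.d (γ * ε) = D.d (α * β)) (a : F) :
    u • D.QL α β γ ε a = D.QL (u • α) (u • β) (u • γ) (u • ε) (u • a) := by
  simp only [QL, smul_sub, D.smul_lhom]
  rw [D.smul_NL _ (by rw [map_mul, h, map_inv, mul_inv_cancel])]
  simp only [smul_mul', smul_inv']

lemma smul_QR (u : Γ) {c x y z w : F} (h : D.d (z * w) = D.d (x * y)) :
    u • D.QR c x y z w = D.QR (u • c) (u • x) (u • y) (u • z) (u • w) := by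
  simp only [QR, smul_sub, D.smul_rhom]
  rw [D.smul_NR _ (by rw [map_mul, h, map_inv, mul_inv_cancel])]
  simp only [smul_mul', smul_inv']

/-- Edges, triangles and tetrahedra of a `6`-simplex satisfying the cocycle conditions of
`d : F → Γ`. -/
structure Coherent (g : ℕ → ℕ → Γ) (h : ℕ → ℕ → ℕ → F) (l : ℕ → ℕ → ℕ → ℕ → F) : Prop where
  g_mul : ∀ i j k, i < j → j < k → k ≤ 6 → g i k = D.d (h i j k) * g j k * g i j
  h_mul : ∀ i j k p, i < j → j < k → k < p → p ≤ 6 →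
    l i j k p * h i k p * g k p • h i j k = h i j p * h j k p

/-- Transport from the vertex `6 - n` to the vertex `6` along the spine. -/
def spineAux (g : ℕ → ℕ → Γ) : ℕ → Γ
  | 0 => 1
  | n + 1 => spineAux g n * g (5 - n) (6 - n)

/-- Transport from the vertex `k` to the vertex `6` along the spine. -/
def spineTransport (g : ℕ → ℕ → Γ) (k : ℕ) : Γ := spineAux g (6 - k)

lemma spineTransport_eq (g : ℕ → ℕ → Γ) {k : ℕ} (hk : k < 6) :
    spineTransport g k = spineTransport g (k + 1) * g k (k + 1) := by
  have h : 6 - k = (6 - (k + 1)) + 1 := by lia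
  rw [spineTransport, h, spineAux, spineTransport]
  congr 2 <;> lia

variable {D}
variable {g : ℕ → ℕ → Γ} {h : ℕ → ℕ → ℕ → F} {l : ℕ → ℕ → ℕ → ℕ → F}

namespace Coherent

variable (C : D.Coherent g h l)
include C

lemma d_h {i j k : ℕ} (hij : i < j) (hjk : j < k) (hk : k ≤ 6) :
    D.d (h i j k) = g i k * (g i j)⁻¹ * (g j k)⁻¹ := by
  rw [C.g_mul i j k hij hjk hk]; group

lemma d_l {i j k p : ℕ} (hij : i < j) (hjk : j < k) (hkp : k < p) (hp : p ≤ 6) :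
    D.d (l i j k p) = 1 := by
  have e := congrArg D.d (C.h_mul i j k p hij hjk hkp hp)
  simp only [map_mul, D.d_smul, C.d_h hij (hjk.trans hkp) hp, C.d_h hjk hkp hp,
    C.d_h (hij.trans hjk) hkp hp, C.d_h hij hjk (by lia)] at e
  have h2 : g i p * (g i j)⁻¹ * (g j p)⁻¹ * (g j p * (g j k)⁻¹ * (g k p)⁻¹) =
    (g i p * (g i k)⁻¹ * (g k p)⁻¹) *
      (g k p * (g i k * (g i j)⁻¹ * (g j k)⁻¹) * (g k p)⁻¹) := by
    group
  rw [h2, mul_assoc] at e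
  exact mul_eq_right.mp e

/-- Transporting everything to the last vertex along the spine trivializes the spine. -/
lemma cone : D.Cone
    (fun i j => spineTransport g j * g i j * (spineTransport g i)⁻¹)
    (fun i j k => spineTransport g k • h i j k)
    (fun i j k p => spineTransport g p • l i j k p) where
  d_K i j k hij hjk hk := by
    simp only [D.d_smul, C.d_h hij hjk hk]; group
  K_mul i j k p hij hjk hkp hp := by
    rw [← smul_mul', ← C.h_mul i j k p hij hjk hkp hp]
    simp only [smul_smul, smul_mul', inv_mul_cancel, mul_one, mul_assoc]
  spine i hi := by
    rw [spineTransport_eq g hi]; group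

/-- The deviation is equivariant for the transport to the last vertex. -/
lemma smul_omega {i j k p q x : ℕ} (hij : i < j) (hjk : j < k) (hkp : k < p) (hpq : p < q)
    (hqx : q < x) (hx : x ≤ 6) :
    D.omega
      (fun i j => spineTransport g j * g i j * (spineTransport g i)⁻¹)
      (fun i j k => spineTransport g k • h i j k)
      (fun i j k p => spineTransport g p • l i j k p) i j k p q x =
    spineTransport g x • D.omega g h l i j k p q x := by
  have d1 := C.d_l (i := i) (j := k) (k := q) (p := x) (by lia) (by lia) (by lia) hx
  have d2 := C.d_l (i := i) (j := j) (k := k) (p := x) (by lia) (by lia) (by lia) hx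
  have d3 := C.d_l (i := k) (j := p) (k := q) (p := x) (by lia) (by lia) (by lia) hx
  have d4 := C.d_l (i := i) (j := k) (k := p) (p := x) (by lia) (by lia) (by lia) hx
  have d5 := C.d_l (i := i) (j := j) (k := p) (p := x) (by lia) (by lia) (by lia) hx
  have d6 := C.d_l (i := i) (j := p) (k := q) (p := x) (by lia) (by lia) (by lia) hx
  have d7 := C.d_l (i := i) (j := j) (k := k) (p := p) (by lia) (by lia) (by lia) (by lia)
  have d8 := C.d_l (i := i) (j := j) (k := q) (p := x) (by lia) (by lia) (by lia) hx
  have d9 := C.d_l (i := j) (j := k) (k := p) (p := q) (by lia) (by lia) (by lia) (by lia)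
  have e1 : D.d (h k p x * h p q x) = D.d (h k q x * g q x • h k p q) := by
    rw [← C.h_mul k p q x hkp hpq hqx hx]; simp [d3]
  have e2 : D.d ((g q x * g p q) • h i j p * (g q x * g p q) • h j k p) =
      D.d ((g q x * g p q) • h i k p * (g q x * g p q * g k p) • h i j k) := by
    rw [← smul_mul', ← C.h_mul i j k p hij hjk hkp (by lia), mul_smul _ (g k p)]
    simp only [← smul_mul', mul_assoc, D.d_smul, map_mul, d7, one_mul]
  simp only [omega, omegaLL, smul_add, smul_sub]
  rw [D.smul_QL _ e1, D.smul_QR _ e2, D.smul_ll _ _ _ d1 (by simp),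
    D.smul_ll _ _ _ d2 (by simp [d3]), D.smul_ll _ _ _ d4 (by simp),
    D.smul_ll _ _ _ d5 (by simp), D.smul_ll _ _ _ d6 (D.d_conj _ (D.d_act _ d7)),
    D.smul_ll _ _ _ d8 (D.d_conj _ (D.d_act _ d9))]
  simp only [smul_smul, smul_mul', smul_inv', D.smul_P, mul_assoc,
    inv_mul_cancel_left, inv_mul_cancel, mul_one]

/-- The deviations on the seven faces of a `6`-simplex add up to zero, if the last one is
transported along the edge from `5` to `6`. -/
theorem omega_eq_zero :
    D.omega g h l 1 2 3 4 5 6 - D.omega g h l 0 2 3 4 5 6 + D.omega g h l 0 1 3 4 5 6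
      - D.omega g h l 0 1 2 4 5 6 + D.omega g h l 0 1 2 3 5 6 - D.omega g h l 0 1 2 3 4 6
      + g 5 6 • D.omega g h l 0 1 2 3 4 5 = 0 := by
  have e := C.cone.omega_eq_zero
  have h6 : spineTransport g 6 = 1 := rfl
  have h5 : spineTransport g 5 = g 5 6 := one_mul _
  rwa [C.smul_omega, C.smul_omega, C.smul_omega, C.smul_omega, C.smul_omega, C.smul_omega,
    C.smul_omega, h6, h5, one_smul, one_smul, one_smul, one_smul, one_smul, one_smul] at e
  all_goals simp

end Coherent
end LinearLiftings
end ThreeCrossedModule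

/-! ### Complexes with a Peiffer lifting, and the two sides of the 5-simplex identity -/

namespace ThreeCrossedModule

/-- A complex `L → H → G` of groups with compatible actions and a Peiffer lifting: the part of a
3-crossed module which does not involve `M`. -/
structure PeifferComplex (G H L : Type*) [Group G] [Group H] [Group L]
    [MulDistribMulAction G H] [MulDistribMulAction G L] [MulDistribMulAction H L] where
  dH : H →* G
  dL : L →* H
  pf : H → H → L
  dH_dL : ∀ l : L, dH (dL l) = 1
  dH_smul : ∀ (g : G) (h : H), dH (g • h) = g * dH h * g⁻¹
  dL_smul : ∀ (g : G) (l : L), dL (g • l) = g • dL l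
  dL_smulH : ∀ (h : H) (l : L), dL (h • l) = h * dL l * h⁻¹
  smul_smulH : ∀ (g : G) (h : H) (l : L), g • h • l = (g • h) • g • l
  smul_pf : ∀ (g : G) (h₂ h₁ : H), g • pf h₂ h₁ = pf (g • h₂) (g • h₁)
  dL_pf : ∀ h₂ h₁ : H, dL (pf h₂ h₁) = h₂ * h₁ * h₂⁻¹ * dH h₂ • h₁⁻¹

/-- Actions on, and liftings to, a type `M`, not subject to any axioms.  The actions are plain
functions, so that several of them on the same group do not interfere. -/
structure Liftings (G H L M : Type*) where
  aG : G → M → M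
  aH : H → M → M
  aL : L → M → M
  lhom : H → H → H → M
  rhom : H → H → H → M
  hl : H → L → M
  hl' : H → L → M
  ll : L → L → M

section five

variable {G H L M : Type*} [Group G] [Group H] [Group L] [Group M]
    [MulDistribMulAction G H] [MulDistribMulAction G L] [MulDistribMulAction H L]
    {ι : Type*}
  (P : PeifferComplex G H L) (o : Liftings G H L M)
  (g : ι → ι → G) (h : ι → ι → ι → H) (l : ι → ι → ι → ι → L) (m : ι → ι → ι → ι → ι → M)
  (i j k p q x : ι)

/-- The factor `M1` of the 5-simplex identity. -/
def fiveM1 : M := o.aH (h i q x) (o.aG (g q x) (m i j k p q))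

/-- The factor `M2` of the 5-simplex identity. -/
def fiveM2 : M := m i j k q x

/-- The factor `M3` of the 5-simplex identity. -/
def fiveM3 : M := o.ll (l i j k x) ((h i k x * g k x • h i j k) • l k p q x)

/-- The factor `M4` of the 5-simplex identity. -/
def fiveM4 : M := (o.ll (l i k q x) ((h i q x * g q x • h i k q) •
    (P.pf (g q x • h k p q) ((g q x * g p q * g k p) • h i j k))⁻¹))⁻¹

/-- The factor `M5` of the 5-simplex identity. -/
def fiveM5 : M := o.aH (h i k x)
    (o.aL ((P.pf (h k q x) ((g q x * g k q) • h i j k))⁻¹ *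
      h k q x • (P.pf (g q x • h k p q) ((g q x * g p q * g k p) • h i j k))⁻¹)
    (o.lhom (h k q x) (g q x • h k p q) ((g q x * g p q * g k p) • h i j k))⁻¹)

/-- The whiskering `LA` of the 5-simplex identity. -/
def fiveLA : L := (h i j x * h j k x) • l k p q x

/-- The whiskering `LB` of the 5-simplex identity. -/
def fiveLB : L := h i j x • l j k q x

/-- The whiskering `LC` of the 5-simplex identity. -/
def fiveLC : L := l i j q x

/-- The whiskering `LD = LK` of the 5-simplex identity. -/
def fiveLD : L := l i j k x

/-- The whiskering `LE` of the 5-simplex identity. -/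
def fiveLE : L := (h i k x * g k x • h i j k) • l k p q x

/-- The whiskering `LF` of the 5-simplex identity. -/
def fiveLF : L := h i k x • (P.pf (h k q x) ((g q x * g k q) • h i j k))⁻¹

/-- The whiskering `LG` of the 5-simplex identity. -/
def fiveLG : L := h i j x • l j k p x

/-- The whiskering `LH` of the 5-simplex identity. -/
def fiveLH : L := (h i j x * h j p x) • (P.pf (h p q x) ((g q x * g p q) • h j k p))⁻¹

/-- The whiskering `LI` of the 5-simplex identity. -/
def fiveLI : L := l i j p x

/-- The whiskering `LJ` of the 5-simplex identity. -/
def fiveLJ : L := h i p x • (P.pf (h p q x) ((g q x * g p q) • h i j p))⁻¹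

/-- The whiskering `LL` of the 5-simplex identity. -/
def fiveLL : L := h i k x • (P.pf (h k p x) ((g p x * g k p) • h i j k))⁻¹

/-- The whiskering `LM` of the 5-simplex identity. -/
def fiveLM : L := l i k p x

/-- The whiskering `LN` of the 5-simplex identity. -/
def fiveLN : L := h i k x •
    (P.pf (h k p x * h p q x) ((g q x * g p q * g k p) • h i j k))⁻¹

/-- The factor `M1'` of the 5-simplex identity. -/
def fiveM1' : M := (o.ll (l i j q x) ((h i q x * g q x • h i j q) • g q x • l j k p q))⁻¹

/-- The factor `M2'` of the 5-simplex identity. -/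
def fiveM2' : M := o.aH (h i j x) (m j k p q x)

/-- The factor `M3'` of the 5-simplex identity. -/
def fiveM3' : M := m i j p q x

/-- The factor `M4'` of the 5-simplex identity. -/
def fiveM4' : M := (o.ll (l i p q x)
    ((h i q x * g q x • h i p q) • (g q x * g p q) • l i j k p))⁻¹

/-- The factor `M5'` of the 5-simplex identity. -/
def fiveM5' : M := o.ll (l i j p x) ((h i p x * g p x • h i j p) •
    (P.pf (h p q x) ((g q x * g p q) • h j k p))⁻¹)

/-- The factor `M6'` of the 5-simplex identity. -/
def fiveM6' : M := o.aH (h i p x)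
    (o.aL ((g p x • h i j p) • (P.pf (h p q x) ((g q x * g p q) • h j k p))⁻¹ *
      (P.pf (h p q x) ((g q x * g p q) • h i j p))⁻¹)
    (o.rhom (h p q x) ((g q x * g p q) • h i j p) ((g q x * g p q) • h j k p))⁻¹)

/-- The whiskering which occurs in the factor `M7'`. -/
def fiveP7 : L := g p x • l i j k p *
    (P.pf (h p q x) ((g q x * g p q) • (h i k p * g k p • h i j k)))⁻¹

/-- The factor `M7'` of the 5-simplex identity. -/
def fiveM7' : M := o.aH (h i p x)
    (o.aL (fiveP7 P g h l i j k p q x) (o.aL (h p q x • (g q x * g p q) • (l i j k p)⁻¹)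
        (o.rhom (h p q x) ((g q x * g p q) • P.dL (l i j k p))
          ((g q x * g p q) • (h i k p * g k p • h i j k)))) *
      o.aL (fiveP7 P g h l i j k p q x) (o.hl' (h p q x) ((g q x * g p q) • (l i j k p)⁻¹)) *
      o.ll (g p x • l i j k p)
        (P.pf (h p q x) ((g q x * g p q) • (h i k p * g k p • h i j k)))⁻¹)

/-- The factor `M8'` of the 5-simplex identity. -/
def fiveM8' : M := m i j k p x

/-- The factor `M9'` of the 5-simplex identity. -/
def fiveM9' : M := o.aH (h i p x)
    (o.aL ((g p x • h i k p) •
        (P.pf (h p q x) ((g q x * g p q * g k p) • h i j k))⁻¹ *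
      (P.pf (h p q x) ((g q x * g p q) • h i k p))⁻¹)
    (o.rhom (h p q x) ((g q x * g p q) • h i k p) ((g q x * g p q * g k p) • h i j k)))

/-- The factor `M10'` of the 5-simplex identity. -/
def fiveM10' : M := (o.ll (l i k p x) ((h i p x * g p x • h i k p) •
    (P.pf (h p q x) ((g q x * g p q * g k p) • h i j k))⁻¹))⁻¹

/-- The factor `M11'` of the 5-simplex identity. -/
def fiveM11' : M := o.aH (h i k x)
    (o.aL ((P.pf (h k p x) ((g p x * g k p) • h i j k))⁻¹ *
      h k p x • (P.pf (h p q x) ((g q x * g p q * g k p) • h i j k))⁻¹)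
    (o.lhom (h k p x) (h p q x) ((g q x * g p q * g k p) • h i j k))⁻¹)

/-- The factor `M12'` of the 5-simplex identity. -/
def fiveM12' : M := (m i k p q x)⁻¹

/-- The Peiffer lifting which occurs in the factor `M13'`. -/
def fiveZ : L := P.pf (h k q x * g q x • h k p q) ((g q x * g p q * g k p) • h i j k)

/-- The factor `M13'` of the 5-simplex identity. -/
def fiveM13' : M := o.aH (h i k x)
    (o.aL ((g k x • h i j k) • l k p q x * (fiveZ P g h i j k p q x)⁻¹ * (l k p q x)⁻¹)
        (o.lhom (P.dL (l k p q x)) (h k q x * g q x • h k p q)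
          ((g q x * g p q * g k p) • h i j k)) *
      o.aL ((g k x • h i j k) • l k p q x)
        (o.aL (l k p q x)⁻¹ (o.ll (l k p q x) (fiveZ P g h i j k p q x)⁻¹) *
          o.hl (g k x • h i j k) (l k p q x)⁻¹))

/-- The left hand side of the 5-simplex identity. -/
def fiveLeft : M :=
  o.aL (fiveLD l i j k x * fiveLE g h l i j k p q x) (fiveM5 P o g h i j k p q x) *
  o.aL (fiveLD l i j k x * fiveLE g h l i j k p q x * fiveLF P g h i j k q x)
    (fiveM4 P o g h l i j k p q x) *
  fiveM3 o g h l i j k p q x *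
  o.aL (fiveLA h l i j k p q x) (fiveM2 m i j k q x) *
  o.aL (fiveLA h l i j k p q x * fiveLB h l i j k q x * fiveLC l i j q x)
    (fiveM1 o g h m i j k p q x)

/-- The right hand side of the 5-simplex identity. -/
def fiveRight : M :=
  o.aL (fiveLD l i j k x) (fiveM13' P o g h l i j k p q x) *
  o.aL (fiveLD l i j k x * fiveLN P g h i j k p q x) (fiveM12' m i k p q x) *
  o.aL (fiveLD l i j k x) (fiveM11' P o g h i j k p q x) *
  o.aL (fiveLD l i j k x * fiveLL P g h i j k p x) (fiveM10' P o g h l i j k p q x) *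
  o.aL (fiveLD l i j k x * fiveLL P g h i j k p x * fiveLM l i k p x)
    (fiveM9' P o g h i j k p q x) *
  fiveM8' m i j k p x *
  o.aL (fiveLG h l i j k p x * fiveLI l i j p x) (fiveM7' P o g h l i j k p q x) *
  o.aL (fiveLG h l i j k p x * fiveLI l i j p x) (fiveM6' P o g h i j k p q x) *
  o.aL (fiveLG h l i j k p x) (fiveM5' P o g h l i j k p q x) *
  o.aL (fiveLG h l i j k p x * fiveLH P g h i j k p q x * fiveLI l i j p x *
    fiveLJ P g h i j p q x) (fiveM4' o g h l i j k p q x) *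
  o.aL (fiveLG h l i j k p x * fiveLH P g h i j k p q x) (fiveM3' m i j p q x) *
  fiveM2' o h m i j k p q x *
  o.aL (fiveLA h l i j k p q x * fiveLB h l i j k q x) (fiveM1' o g h l i j k p q x)

end five
end ThreeCrossedModule

/-! ### The liftings given by boundaries -/

namespace ThreeCrossedModule
namespace PeifferComplex

variable {G H L : Type*} [Group G] [Group H] [Group L]
    [MulDistribMulAction G H] [MulDistribMulAction G L] [MulDistribMulAction H L]
  (P : PeifferComplex G H L)

/-- The liftings with values in `L` itself which measure the failure of `pf` to be multiplicative
and of `L → H → G` to be a 2-crossed module.  They are the boundaries of the liftings of a 3-crossed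
module. -/
def boundary : Liftings G H L L where
  aG g x := g • x
  aH h x := h • x
  aL l x := l * x * l⁻¹
  lhom c b a := P.pf (c * b) a * (c • P.pf b a * P.pf c (P.dH b • a))⁻¹
  rhom c b a := P.pf c (b * a) * (P.pf c b * (P.dH c • b) • P.pf c a)⁻¹
  hl h l := l * P.pf (P.dL l⁻¹) h * (h • l)⁻¹
  hl' h l := h • l * P.pf h (P.dL l⁻¹) * (P.dH h • l)⁻¹
  ll l l' := l * l' * l⁻¹ * (P.dL l • l')⁻¹

/-- The cocycle conditions up to dimension four for edges, triangles, tetrahedra and `4`-simplices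
with vertices at most `n`. -/
structure Coherent (n : ℕ) (g : ℕ → ℕ → G) (h : ℕ → ℕ → ℕ → H) (l : ℕ → ℕ → ℕ → ℕ → L)
    (m : ℕ → ℕ → ℕ → ℕ → ℕ → L) : Prop where
  g_mul : ∀ i j k, i < j → j < k → k ≤ n → g i k = P.dH (h i j k) * g j k * g i j
  h_mul : ∀ i j k p, i < j → j < k → k < p → p ≤ n →
    P.dL (l i j k p) * h i k p * g k p • h i j k = h i j p * h j k p
  l_mul : ∀ i j k p q, i < j → j < k → k < p → p < q → q ≤ n →
    m i j k p q * h i j q • l j k p q * l i j p q * h i p q • g p q • l i j k p =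
      l i j k q * h i k q • (P.pf (h k p q) ((g p q * g k p) • h i j k))⁻¹ * l i k p q

/-- The cancellation by which the left hand side of the 5-simplex identity for the boundary liftings
telescopes to a path around the boundary. -/
lemma fiveLeft_word {X : Type*} [Group X] (A B C D E F z q t₁ t₂ t t₃ s₁ s₂ s₃ : X) :
    D * E * (z * t⁻¹ * F⁻¹) * (D * E)⁻¹ *
      (D * E * F * (t * q * t₂⁻¹ * q⁻¹) * (D * E * F)⁻¹) *
      (D * E * D⁻¹ * A⁻¹) *
      (A * (D * F * q * (B * C * t₁)⁻¹) * A⁻¹) *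
      (A * B * C * (t₁ * t₂ * t₃ * (s₁ * s₂ * s₃)⁻¹) * (A * B * C)⁻¹) =
    D * E * z * q * t₃ * (A * B * C * s₁ * s₂ * s₃)⁻¹ := by
  group

/-- The cancellation by which the right hand side of the 5-simplex identity for the boundary
liftings telescopes to a path around the boundary. -/
lemma fiveRight_word {X : Type*} [Group X]
    (A B C D E z q t₃ s₁ s₂ s₃ G H I J L M N Q R S S' V V' W Y Y₀ J' Λ U : X) :
    D * (E * z * W⁻¹ * N⁻¹) * D⁻¹ *
      (D * N * (W * q * t₃ * (M * J' * R)⁻¹) * (D * N)⁻¹) *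
      (D * (N * V⁻¹ * L⁻¹) * D⁻¹) *
      (D * L * (V * M * V'⁻¹ * M⁻¹) * (D * L)⁻¹) *
      (D * L * M * (V' * J' * Y₀⁻¹) * (D * L * M)⁻¹) *
      (D * L * M * (G * I * Λ)⁻¹) *
      (G * I * (Λ * Y₀ * S'⁻¹ * U⁻¹) * (G * I)⁻¹) *
      (G * I * (U * J⁻¹ * Y⁻¹) * (G * I)⁻¹) *
      (G * (I * Y * I⁻¹ * H⁻¹) * G⁻¹) *
      (G * H * I * J * (S' * R * s₃⁻¹ * R⁻¹) * (G * H * I * J)⁻¹) *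
      (G * H * (I * J * R * (Q * C * s₂)⁻¹) * (G * H)⁻¹) *
      (G * H * Q * (A * B * S)⁻¹) *
      (A * B * (S * C * s₁⁻¹ * C⁻¹) * (A * B)⁻¹) =
    D * E * z * q * t₃ * (A * B * C * s₁ * s₂ * s₃)⁻¹ := by
  group

namespace Coherent

variable {P} {n : ℕ} {g : ℕ → ℕ → G} {h : ℕ → ℕ → ℕ → H} {l : ℕ → ℕ → ℕ → ℕ → L}
    {m : ℕ → ℕ → ℕ → ℕ → ℕ → L} (C : P.Coherent n g h l m)
include C

lemma m_eq {i j k p q : ℕ} (hij : i < j) (hjk : j < k) (hkp : k < p) (hpq : p < q)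
    (hq : q ≤ n) :
    m i j k p q = l i j k q * h i k q • (P.pf (h k p q) ((g p q * g k p) • h i j k))⁻¹ * l i k p q *
      (h i j q • l j k p q * l i j p q * h i p q • g p q • l i j k p)⁻¹ := by
  rw [eq_mul_inv_iff_mul_eq, ← C.l_mul i j k p q hij hjk hkp hpq hq]
  simp only [mul_assoc]

lemma dH_smul_smul {i j k : ℕ} (hij : i < j) (hjk : j < k) (hk : k ≤ n) {X : Type*}
    [MulAction G X] (x : X) : P.dH (h i j k) • g j k • g i j • x = g i k • x := by
  rw [C.g_mul i j k hij hjk hk, mul_smul, mul_smul]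

lemma dH_smul_smul' {i j k : ℕ} (hij : i < j) (hjk : j < k) (hk : k ≤ n) {X : Type*}
    [MulAction G X] (u : G) (x : X) :
    P.dH (u • h i j k) • u • g j k • g i j • x = u • g i k • x := by
  rw [← C.dH_smul_smul hij hjk hk, P.dH_smul, ← mul_smul _ u, inv_mul_cancel_right, mul_smul]

lemma dL_smul_smul {i j k p : ℕ} (hij : i < j) (hjk : j < k) (hkp : k < p) (hp : p ≤ n) (x : L) :
    P.dL (l i j k p) • h i k p • (g k p • h i j k) • x = h i j p • h j k p • x := by
  rw [← mul_smul (h i j p), ← C.h_mul i j k p hij hjk hkp hp, mul_smul, mul_smul]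

/-- The boundary of the left hand side of the 5-simplex identity. -/
theorem fiveLeft_eq {i j k p q x : ℕ} (hij : i < j) (hjk : j < k) (hkp : k < p) (hpq : p < q)
    (hqx : q < x) (hx : x ≤ n) :
    fiveLeft P P.boundary g h l m i j k p q x =
      l i j k x * (h i k x * g k x • h i j k) • l k p q x *
        h i k x • (P.pf (h k q x * g q x • h k p q) ((g q x * g p q * g k p) • h i j k))⁻¹ *
        l i k q x * h i q x • g q x • l i k p q *
        ((h i j x * h j k x) • l k p q x * h i j x • l j k q x * l i j q x *
          h i q x • g q x • h i j q • l j k p q * h i q x • g q x • l i j p q *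
          h i q x • g q x • h i p q • g p q • l i j k p)⁻¹ := by
  have e1 : fiveM1 P.boundary g h m i j k p q x =
      h i q x • g q x • l i j k q *
        h i q x • g q x • h i k q • (P.pf (h k p q) ((g p q * g k p) • h i j k))⁻¹ *
        h i q x • g q x • l i k p q *
      (h i q x • g q x • h i j q • l j k p q * h i q x • g q x • l i j p q *
          h i q x • g q x • h i p q • g p q • l i j k p)⁻¹ := by
    simp only [fiveM1, boundary, C.m_eq hij hjk hkp hpq (hqx.le.trans hx), smul_mul', smul_inv']
  have e2 := C.m_eq hij hjk (hkp.trans hpq) hqx hx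
  have e3 : fiveM3 P.boundary g h l i j k p q x =
      l i j k x * (h i k x * g k x • h i j k) • l k p q x * (l i j k x)⁻¹ *
        ((h i j x * h j k x) • l k p q x)⁻¹ := by
    simp only [fiveM3, boundary, mul_smul,
      C.dL_smul_smul hij hjk (hkp.trans (hpq.trans hqx)) hx]
  have e4 : fiveM4 P P.boundary g h l i j k p q x =
      (h i k x * h k q x) •
        (P.pf (g q x • h k p q) ((g q x * g p q * g k p) • h i j k))⁻¹ * l i k q x *
      (h i q x • g q x • h i k q • (P.pf (h k p q) ((g p q * g k p) • h i j k))⁻¹)⁻¹ *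
        (l i k q x)⁻¹ := by
    simp only [fiveM4, boundary, mul_smul,
      C.dL_smul_smul (hij.trans hjk) (hkp.trans hpq) hqx hx, P.smul_smulH, smul_inv', P.smul_pf]
    group
  have e5 : fiveM5 P P.boundary g h i j k p q x =
      h i k x • (P.pf (h k q x * g q x • h k p q) ((g q x * g p q * g k p) • h i j k))⁻¹ *
      ((h i k x * h k q x) •
        (P.pf (g q x • h k p q) ((g q x * g p q * g k p) • h i j k))⁻¹)⁻¹ *
      (h i k x • (P.pf (h k q x) ((g q x * g k q) • h i j k))⁻¹)⁻¹ := by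
    simp only [fiveM5, boundary, mul_smul, C.dH_smul_smul' hkp hpq (hqx.le.trans hx),
      smul_mul', smul_inv']
    group
  simp only [fiveLeft, e1, fiveM2, e2, e3, e4, e5]
  exact fiveLeft_word ..

lemma smul_h_mul {i j k p : ℕ} (hij : i < j) (hjk : j < k) (hkp : k < p) (hp : p ≤ n)
    (u v : G) :
    u • v • P.dL (l i j k p) * (u • v • h i k p * u • v • g k p • h i j k) =
      u • v • h i j p * u • v • h j k p := by
  simp only [← smul_mul', ← mul_assoc, C.h_mul i j k p hij hjk hkp hp]

/-- The boundary of the right hand side of the 5-simplex identity. -/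
theorem fiveRight_eq {i j k p q x : ℕ} (hij : i < j) (hjk : j < k) (hkp : k < p) (hpq : p < q)
    (hqx : q < x) (hx : x ≤ n) :
    fiveRight P P.boundary g h l m i j k p q x =
      l i j k x * (h i k x * g k x • h i j k) • l k p q x *
        h i k x • (P.pf (h k q x * g q x • h k p q) ((g q x * g p q * g k p) • h i j k))⁻¹ *
        l i k q x * h i q x • g q x • l i k p q *
        ((h i j x * h j k x) • l k p q x * h i j x • l j k q x * l i j q x *
          h i q x • g q x • h i j q • l j k p q * h i q x • g q x • l i j p q *
          h i q x • g q x • h i p q • g p q • l i j k p)⁻¹ := by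
  have e1 : fiveM1' P.boundary g h l i j k p q x =
      (h i j x * h j q x) • g q x • l j k p q * l i j q x *
        (h i q x • g q x • h i j q • l j k p q)⁻¹ * (l i j q x)⁻¹ := by
    simp only [fiveM1', boundary, mul_smul,
      C.dL_smul_smul hij (hjk.trans (hkp.trans hpq)) hqx hx, P.smul_smulH]
    group
  have e2 : fiveM2' P.boundary h m i j k p q x =
      h i j x • l j k p x *
        (h i j x * h j p x) • (P.pf (h p q x) ((g q x * g p q) • h j k p))⁻¹ *
        h i j x • l j p q x *
        ((h i j x * h j k x) • l k p q x * h i j x • l j k q x *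
          (h i j x * h j q x) • g q x • l j k p q)⁻¹ := by
    simp only [fiveM2', boundary, C.m_eq hjk hkp hpq hqx hx, smul_mul', smul_inv', mul_smul]
  have e3 : fiveM3' m i j p q x = l i j p x *
        h i p x • (P.pf (h p q x) ((g q x * g p q) • h i j p))⁻¹ * l i p q x *
        (h i j x • l j p q x * l i j q x * h i q x • g q x • l i j p q)⁻¹ :=
    C.m_eq hij (hjk.trans hkp) hpq hqx hx
  have e4 : fiveM4' P.boundary g h l i j k p q x =
      (h i p x * h p q x) • (g q x * g p q) • l i j k p * l i p q x *
        (h i q x • g q x • h i p q • g p q • l i j k p)⁻¹ * (l i p q x)⁻¹ := by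
    simp only [fiveM4', boundary, mul_smul,
      C.dL_smul_smul (hij.trans (hjk.trans hkp)) hpq hqx hx, P.smul_smulH]
    group
  have e5 : fiveM5' P P.boundary g h l i j k p q x =
      l i j p x * (h i p x * g p x • h i j p) •
        (P.pf (h p q x) ((g q x * g p q) • h j k p))⁻¹ * (l i j p x)⁻¹ *
        ((h i j x * h j p x) • (P.pf (h p q x) ((g q x * g p q) • h j k p))⁻¹)⁻¹ := by
    simp only [fiveM5', boundary, mul_smul,
      C.dL_smul_smul hij (hjk.trans hkp) (hpq.trans hqx) hx]
  have e6 : fiveM6' P P.boundary g h i j k p q x =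
      h i p x • (P.pf (h p q x) ((g q x * g p q) • (h i j p * h j k p)))⁻¹ *
      (h i p x • (P.pf (h p q x) ((g q x * g p q) • h i j p))⁻¹)⁻¹ *
      ((h i p x * g p x • h i j p) • (P.pf (h p q x) ((g q x * g p q) • h j k p))⁻¹)⁻¹ := by
    simp only [fiveM6', boundary, mul_smul, C.dH_smul_smul hpq hqx hx, smul_mul', smul_inv']
    group
  have e7 : fiveM7' P P.boundary g h l i j k p q x =
      h i p x • g p x • l i j k p *
      h i p x • (P.pf (h p q x) ((g q x * g p q) • (h i k p * g k p • h i j k)))⁻¹ *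
      ((h i p x * h p q x) • (g q x * g p q) • l i j k p)⁻¹ *
      (h i p x • (P.pf (h p q x) ((g q x * g p q) • (h i j p * h j k p)))⁻¹)⁻¹ := by
    simp only [fiveM7', fiveP7, boundary, mul_smul, C.dH_smul_smul hpq hqx hx, smul_mul',
      smul_inv', inv_inv, map_inv, C.smul_h_mul hij hjk hkp ((hpq.trans hqx).le.trans hx),
      P.dL_smul]
    group
  have e9 : fiveM9' P P.boundary g h i j k p q x =
      (h i p x * g p x • h i k p) • (P.pf (h p q x) ((g q x * g p q * g k p) • h i j k))⁻¹ *
      h i p x • (P.pf (h p q x) ((g q x * g p q) • h i k p))⁻¹ *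
      (h i p x • (P.pf (h p q x) ((g q x * g p q) • (h i k p * g k p • h i j k)))⁻¹)⁻¹ := by
    simp only [fiveM9', boundary, mul_smul, C.dH_smul_smul hpq hqx hx, smul_mul', smul_inv']
    group
  have e10 : fiveM10' P P.boundary g h l i j k p q x =
      (h i k x * h k p x) • (P.pf (h p q x) ((g q x * g p q * g k p) • h i j k))⁻¹ * l i k p x *
      ((h i p x * g p x • h i k p) • (P.pf (h p q x) ((g q x * g p q * g k p) • h i j k))⁻¹)⁻¹ *
        (l i k p x)⁻¹ := by
    simp only [fiveM10', boundary, mul_smul,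
      C.dL_smul_smul (hij.trans hjk) hkp (hpq.trans hqx) hx]
    group
  have e11 : fiveM11' P P.boundary g h i j k p q x =
      h i k x • (P.pf (h k p x * h p q x) ((g q x * g p q * g k p) • h i j k))⁻¹ *
      ((h i k x * h k p x) • (P.pf (h p q x) ((g q x * g p q * g k p) • h i j k))⁻¹)⁻¹ *
      (h i k x • (P.pf (h k p x) ((g p x * g k p) • h i j k))⁻¹)⁻¹ := by
    simp only [fiveM11', boundary, mul_smul, C.dH_smul_smul hpq hqx hx,
      smul_mul', smul_inv']
    group
  have e12 : fiveM12' m i k p q x =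
      h i k x • l k p q x * l i k q x * h i q x • g q x • l i k p q *
      (l i k p x * h i p x • (P.pf (h p q x) ((g q x * g p q) • h i k p))⁻¹ * l i p q x)⁻¹ := by
    rw [fiveM12', C.m_eq (hij.trans hjk) hkp hpq hqx hx, mul_inv_rev, inv_inv]
  have hv : P.dH (h k q x * g q x • h k p q) • g q x • g p q • g k p • h i j k =
      g k x • h i j k := by
    rw [map_mul, mul_smul, C.dH_smul_smul' hkp hpq (hqx.le.trans hx),
      C.dH_smul_smul (hkp.trans hpq) hqx hx]
  have hμ : P.dL (l k p q x) * (h k q x * g q x • h k p q) = h k p x * h p q x := by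
    rw [← C.h_mul k p q x hkp hpq hqx hx, mul_assoc]
  have e13 : fiveM13' P P.boundary g h l i j k p q x =
      (h i k x * g k x • h i j k) • l k p q x *
      h i k x • (P.pf (h k q x * g q x • h k p q) ((g q x * g p q * g k p) • h i j k))⁻¹ *
      (h i k x • l k p q x)⁻¹ *
      (h i k x • (P.pf (h k p x * h p q x) ((g q x * g p q * g k p) • h i j k))⁻¹)⁻¹ := by
    simp only [fiveM13', fiveZ, boundary, mul_smul, hv, hμ, smul_mul', smul_inv', inv_inv,
      map_inv]
    group
  simp only [fiveRight, e1, e2, e3, e4, e5, e6, e7, e9, e10, e11, e12, e13, fiveM8',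
    C.m_eq hij hjk hkp (hpq.trans hqx) hx]
  exact fiveRight_word ..

/-- The 5-simplex identity holds for the boundary liftings, as both sides have the same boundary
path. -/
theorem fiveLeft_eq_fiveRight {i j k p q x : ℕ} (hij : i < j) (hjk : j < k) (hkp : k < p)
    (hpq : p < q) (hqx : q < x) (hx : x ≤ n) :
    fiveLeft P P.boundary g h l m i j k p q x = fiveRight P P.boundary g h l m i j k p q x :=
  (C.fiveLeft_eq hij hjk hkp hpq hqx hx).trans (C.fiveRight_eq hij hjk hkp hpq hqx hx).symm

end Coherent
end PeifferComplex
end ThreeCrossedModule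

/-! ### The laws of a 3-crossed module after a homomorphism -/

namespace ThreeCrossedModule

section lawful

variable {G H L M N : Type*} [Group G] [Group H] [Group L] [Group M] [Group N]
    [MulDistribMulAction G H] [MulDistribMulAction G L] [MulDistribMulAction H L]

/-- The laws of the liftings of a 3-crossed module, imposed after applying `f`.  For the cover of a
3-crossed module by free groups they are needed after the projection to the kernel of `∂ : M → L`,
where they are consequences of the laws in `M` and in `L`. -/
structure Liftings.Lawful (P : PeifferComplex G H L) (o : Liftings G H L M) (f : M →* N) :
    Prop where
  smul_lhom : ∀ (g : G) (h₃ h₂ h₁ : H),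
    f (o.aG g (o.lhom h₃ h₂ h₁)) = f (o.lhom (g • h₃) (g • h₂) (g • h₁))
  smul_rhom : ∀ (g : G) (h₃ h₂ h₁ : H),
    f (o.aG g (o.rhom h₃ h₂ h₁)) = f (o.rhom (g • h₃) (g • h₂) (g • h₁))
  smul_ll : ∀ (g : G) (l₂ l₁ : L), f (o.aG g (o.ll l₂ l₁)) = f (o.ll (g • l₂) (g • l₁))
  smulH_ll : ∀ (h : H) (l₂ l₁ : L), f (o.aH h (o.ll l₂ l₁)) = f (o.ll (h • l₂) (h • l₁))
  smul_hl : ∀ (g : G) (h : H) (l : L), f (o.aG g (o.hl h l)) = f (o.hl (g • h) (g • l))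
  smul_hl' : ∀ (g : G) (h : H) (l : L), f (o.aG g (o.hl' h l)) = f (o.hl' (g • h) (g • l))
  ll_mul_left : ∀ l₃ l₂ l₁ : L,
    f (o.ll (l₃ * l₂) l₁) = f (o.aL l₃ (o.ll l₂ l₁) * o.ll l₃ (P.dL l₂ • l₁))
  ll_mul_right : ∀ l₃ l₂ l₁ : L,
    f (o.ll l₃ (l₂ * l₁)) = f (o.ll l₃ l₂ * o.aL (P.dL l₃ • l₂) (o.ll l₃ l₁))
  hl_mul_left : ∀ (h₂ h₁ : H) (l : L),
    f (o.hl (h₂ * h₁) l) =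
      f (o.aL l (o.rhom (P.dL l⁻¹) h₂ h₁) * o.hl h₂ l * o.aH h₂ (o.hl h₁ l))
  hl_mul_right : ∀ (h : H) (l₂ l₁ : L),
    f (o.hl h (l₂ * l₁)) =
      f (o.aL (l₂ * l₁) (o.lhom (P.dL l₁⁻¹) (P.dL l₂⁻¹) h) *
        o.aL (l₂ * l₁) (o.ll l₁⁻¹ (P.pf (P.dL l₂⁻¹) h))⁻¹ *
        o.hl h l₂ * o.aL (h • l₂) (o.hl h l₁))
  hl'_mul_left : ∀ (h₂ h₁ : H) (l : L),
    f (o.hl' (h₂ * h₁) l) =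
      f (o.aL ((h₂ * h₁) • l) (o.lhom h₂ h₁ (P.dL l⁻¹)) * o.aH h₂ (o.hl' h₁ l) *
        o.hl' h₂ (P.dH h₁ • l))
  hl'_mul_right : ∀ (h : H) (l₂ l₁ : L),
    f (o.hl' h (l₂ * l₁)) =
      f (o.aL (h • (l₂ * l₁)) (o.rhom h (P.dL l₁⁻¹) (P.dL l₂⁻¹)) *
        o.aL (h • l₂) (o.hl' h l₁) *
        o.aL (h • l₂ * P.dH h • l₁) (o.ll (P.dH h • l₁⁻¹) (P.pf h (P.dL l₂⁻¹)))⁻¹ *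
        o.hl' h l₂)
  lhom_lhom : ∀ h₄ h₃ h₂ h₁ : H,
    f (o.lhom (h₄ * h₃) h₂ h₁ *
        o.aL ((h₄ * h₃) • P.pf h₂ h₁) (o.lhom h₄ h₃ (P.dH h₂ • h₁))) =
      f (o.lhom h₄ (h₃ * h₂) h₁ * o.aH h₄ (o.lhom h₃ h₂ h₁))
  rhom_rhom : ∀ h₄ h₃ h₂ h₁ : H,
    f (o.rhom h₄ (h₃ * h₂) h₁ * o.rhom h₄ h₃ h₂) =
      f (o.rhom h₄ h₃ (h₂ * h₁) *
        o.aL (P.pf h₄ h₃) (o.aH (P.dH h₄ • h₃) (o.rhom h₄ h₂ h₁)))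
  lhom_rhom : ∀ h₄ h₃ h₂ h₁ : H,
    f (o.lhom h₄ h₃ (h₂ * h₁) *
        o.aL (h₄ • P.pf h₃ (h₂ * h₁)) (o.rhom h₄ (P.dH h₃ • h₂) (P.dH h₃ • h₁)) *
        o.aH h₄ (o.rhom h₃ h₂ h₁)) =
      f (o.rhom (h₄ * h₃) h₂ h₁ *
        o.aL (P.pf (h₄ * h₃) h₂) (o.aH (P.dH (h₄ * h₃) • h₂) (o.lhom h₄ h₃ h₁)) *
        o.lhom h₄ h₃ h₂ *
        o.aL (h₄ • P.pf h₃ h₂)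
          (o.ll (P.pf h₄ (P.dH h₃ • h₂)) (((P.dH (h₄ * h₃) • h₂) * h₄) • P.pf h₃ h₁)))
  yangBaxter : ∀ h₃ h₂ h₁ : H,
    f (o.aL (h₃ • P.pf h₂ h₁)
          ((o.rhom h₃ (P.dH h₂ • h₁) h₂)⁻¹ * o.rhom h₃ (P.dL (P.pf h₂ h₁)⁻¹) (h₂ * h₁)) *
        o.hl' h₃ (P.pf h₂ h₁) *
        o.ll (P.dH h₃ • P.pf h₂ h₁) (P.dL (P.dH h₃ • (P.pf h₂ h₁)⁻¹) • P.pf h₃ (h₂ * h₁)) *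
        o.rhom h₃ h₂ h₁) =
      f ((o.lhom h₃ h₂ h₁)⁻¹ *
        o.aL (P.pf (h₃ * h₂) h₁) (o.hl (P.dH (h₃ * h₂) • h₁) (P.pf h₃ h₂))⁻¹ *
        (o.ll (P.pf h₃ h₂) (P.dL (P.pf h₃ h₂)⁻¹ • P.pf (h₃ * h₂) h₁))⁻¹ *
        o.aL (P.pf h₃ h₂)
          ((o.lhom (P.dL (P.pf h₃ h₂)⁻¹) (h₃ * h₂) h₁)⁻¹ * o.lhom (P.dH h₃ • h₂) h₃ h₁))
  ll_swap : ∀ l l' : L,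
    f (o.aL l (o.hl (P.dL l') l⁻¹) * o.aL (l * l' * l⁻¹ * l'⁻¹) (o.ll l' l)) =
      f (o.aL (P.dL l • l') (o.hl' (P.dL l) l'⁻¹) * (o.ll l l')⁻¹)

/-- If two laws hold after `f` and `f'`, and `f''` is determined by `f` and `f'`, then they hold
after `f''`. -/
lemma Liftings.Lawful.of_forall {P : PeifferComplex G H L} {o : Liftings G H L M} {f : M →* N}
    {N' N'' : Type*} [Group N'] [Group N''] {f' : M →* N'} {f'' : M →* N''}
    (key : ∀ x y, f x = f y → f' x = f' y → f'' x = f'' y)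
    (w : o.Lawful P f) (w' : o.Lawful P f') : o.Lawful P f'' where
  smul_lhom _ _ _ _ := key _ _ (w.smul_lhom _ _ _ _) (w'.smul_lhom _ _ _ _)
  smul_rhom _ _ _ _ := key _ _ (w.smul_rhom _ _ _ _) (w'.smul_rhom _ _ _ _)
  smul_ll _ _ _ := key _ _ (w.smul_ll _ _ _) (w'.smul_ll _ _ _)
  smulH_ll _ _ _ := key _ _ (w.smulH_ll _ _ _) (w'.smulH_ll _ _ _)
  smul_hl _ _ _ := key _ _ (w.smul_hl _ _ _) (w'.smul_hl _ _ _)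
  smul_hl' _ _ _ := key _ _ (w.smul_hl' _ _ _) (w'.smul_hl' _ _ _)
  ll_mul_left _ _ _ := key _ _ (w.ll_mul_left _ _ _) (w'.ll_mul_left _ _ _)
  ll_mul_right _ _ _ := key _ _ (w.ll_mul_right _ _ _) (w'.ll_mul_right _ _ _)
  hl_mul_left _ _ _ := key _ _ (w.hl_mul_left _ _ _) (w'.hl_mul_left _ _ _)
  hl_mul_right _ _ _ := key _ _ (w.hl_mul_right _ _ _) (w'.hl_mul_right _ _ _)
  hl'_mul_left _ _ _ := key _ _ (w.hl'_mul_left _ _ _) (w'.hl'_mul_left _ _ _)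
  hl'_mul_right _ _ _ := key _ _ (w.hl'_mul_right _ _ _) (w'.hl'_mul_right _ _ _)
  lhom_lhom _ _ _ _ := key _ _ (w.lhom_lhom _ _ _ _) (w'.lhom_lhom _ _ _ _)
  rhom_rhom _ _ _ _ := key _ _ (w.rhom_rhom _ _ _ _) (w'.rhom_rhom _ _ _ _)
  lhom_rhom _ _ _ _ := key _ _ (w.lhom_rhom _ _ _ _) (w'.lhom_rhom _ _ _ _)
  yangBaxter _ _ _ := key _ _ (w.yangBaxter _ _ _) (w'.yangBaxter _ _ _)
  ll_swap _ _ := key _ _ (w.ll_swap _ _) (w'.ll_swap _ _)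

variable (P : PeifferComplex G H L)

set_option maxHeartbeats 1000000 in
/-- The laws of a 3-crossed module hold in `L` for the boundaries of the liftings. -/
lemma PeifferComplex.lawful_boundary : P.boundary.Lawful P (MonoidHom.id L) where
  smul_lhom g c b a := by
    simp only [boundary, MonoidHom.id_apply, smul_mul', smul_inv', P.smul_smulH, P.smul_pf,
      P.dH_smul, smul_smul, inv_mul_cancel_right]
  smul_rhom g c b a := by
    simp only [boundary, MonoidHom.id_apply, smul_mul', smul_inv', P.smul_smulH, P.smul_pf,
      P.dH_smul, smul_smul, inv_mul_cancel_right]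
  smul_ll g l₂ l₁ := by
    simp only [boundary, MonoidHom.id_apply, smul_mul', smul_inv', P.smul_smulH, P.dL_smul]
  smulH_ll h l₂ l₁ := by
    simp only [boundary, MonoidHom.id_apply, smul_mul', smul_inv', P.dL_smulH, smul_smul,
      inv_mul_cancel_right]
  smul_hl g h l := by
    simp only [boundary, MonoidHom.id_apply, smul_mul', smul_inv', P.smul_smulH, P.smul_pf,
      P.dL_smul, map_inv]
  smul_hl' g h l := by
    simp only [boundary, MonoidHom.id_apply, smul_mul', smul_inv', P.smul_smulH, P.smul_pf,
      P.dL_smul, map_inv, P.dH_smul, smul_smul, inv_mul_cancel_right]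
  ll_mul_left l₃ l₂ l₁ := by
    simp only [boundary, MonoidHom.id_apply, map_mul, mul_smul]; group
  ll_mul_right l₃ l₂ l₁ := by
    simp only [boundary, MonoidHom.id_apply, smul_mul']; group
  hl_mul_left h₂ h₁ l := by
    simp only [boundary, MonoidHom.id_apply, mul_smul, smul_mul', smul_inv', map_inv, P.dH_dL,
      inv_one, one_smul]
    group
  hl_mul_right h l₂ l₁ := by
    simp only [boundary, MonoidHom.id_apply, smul_mul', map_inv, P.dH_dL,
      inv_one, one_smul, map_mul, mul_inv_rev]
    group
  hl'_mul_left h₂ h₁ l := by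
    simp only [boundary, MonoidHom.id_apply, mul_smul, smul_mul', smul_inv', map_inv, map_mul,
      P.dL_smul, mul_inv_rev]
    group
  hl'_mul_right h l₂ l₁ := by
    simp only [boundary, MonoidHom.id_apply, smul_mul', smul_inv', map_inv, map_mul,
      P.dL_smul, mul_inv_rev]
    group
  lhom_lhom h₄ h₃ h₂ h₁ := by
    simp only [boundary, MonoidHom.id_apply, mul_smul, smul_mul', smul_inv', map_mul, mul_assoc]
    group
  rhom_rhom h₄ h₃ h₂ h₁ := by
    simp only [boundary, MonoidHom.id_apply, mul_smul, smul_mul', smul_inv', map_mul, mul_assoc]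
    group
  lhom_rhom h₄ h₃ h₂ h₁ := by
    simp only [boundary, MonoidHom.id_apply, mul_smul, smul_mul', smul_inv', map_mul,
      P.dL_pf, inv_smul_smul]
    group
  yangBaxter h₃ h₂ h₁ := by
    have e (b a : H) : P.dL (P.pf b a)⁻¹ * (b * a) = P.dH b • a * b := by
      rw [map_inv, P.dL_pf, smul_inv']; group
    have e' (l : L) (g : G) (x : L) : (g • P.dL l) • (g • P.dL l⁻¹) • x = x := by
      rw [map_inv, smul_inv', smul_inv_smul]
    have e'' (l : L) (x : L) : P.dL l • P.dL l⁻¹ • x = x := by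
      rw [map_inv, smul_inv_smul]
    simp only [boundary, MonoidHom.id_apply, P.dL_smul, e, e', e'', map_mul, mul_smul]
    simp only [P.smul_pf]
    group
  ll_swap l l' := by
    simp only [boundary, MonoidHom.id_apply, smul_inv', map_inv, P.dH_dL, one_smul, inv_inv]
    group

end lawful
end ThreeCrossedModule

/-! ### Morphisms of liftings -/

namespace ThreeCrossedModule

section hom

variable {G H L M : Type*} [Group G] [Group H] [Group L] [Group M]
    [MulDistribMulAction G H] [MulDistribMulAction G L] [MulDistribMulAction H L]
    {G' H' L' M' : Type*} [Group G'] [Group H'] [Group L'] [Group M']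
    [MulDistribMulAction G' H'] [MulDistribMulAction G' L'] [MulDistribMulAction H' L']

/-- Morphisms of complexes with a Peiffer lifting. -/
structure PeifferComplex.IsHom (P : PeifferComplex G H L) (P' : PeifferComplex G' H' L')
    (φG : G →* G') (φH : H →* H') (φL : L →* L') : Prop where
  smul_H : ∀ (g : G) (h : H), φH (g • h) = φG g • φH h
  smul_L : ∀ (g : G) (l : L), φL (g • l) = φG g • φL l
  smulH_L : ∀ (h : H) (l : L), φL (h • l) = φH h • φL l
  dH : ∀ h : H, φG (P.dH h) = P'.dH (φH h)
  dL : ∀ l : L, φH (P.dL l) = P'.dL (φL l)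
  pf : ∀ h₂ h₁ : H, φL (P.pf h₂ h₁) = P'.pf (φH h₂) (φH h₁)

/-- Morphisms of complexes with a Peiffer lifting which preserve further liftings. -/
structure Liftings.IsHom (P : PeifferComplex G H L) (P' : PeifferComplex G' H' L')
    (o : Liftings G H L M) (o' : Liftings G' H' L' M')
    (φG : G →* G') (φH : H →* H') (φL : L →* L') (φM : M →* M') : Prop
    extends PeifferComplex.IsHom P P' φG φH φL where
  aG : ∀ (g : G) (m : M), φM (o.aG g m) = o'.aG (φG g) (φM m)
  aH : ∀ (h : H) (m : M), φM (o.aH h m) = o'.aH (φH h) (φM m)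
  aL : ∀ (l : L) (m : M), φM (o.aL l m) = o'.aL (φL l) (φM m)
  lhom : ∀ h₃ h₂ h₁ : H, φM (o.lhom h₃ h₂ h₁) = o'.lhom (φH h₃) (φH h₂) (φH h₁)
  rhom : ∀ h₃ h₂ h₁ : H, φM (o.rhom h₃ h₂ h₁) = o'.rhom (φH h₃) (φH h₂) (φH h₁)
  hl : ∀ (h : H) (l : L), φM (o.hl h l) = o'.hl (φH h) (φL l)
  hl' : ∀ (h : H) (l : L), φM (o.hl' h l) = o'.hl' (φH h) (φL l)
  ll : ∀ l₂ l₁ : L, φM (o.ll l₂ l₁) = o'.ll (φL l₂) (φL l₁)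

variable {P : PeifferComplex G H L} {P' : PeifferComplex G' H' L'}
    {o : Liftings G H L M} {o' : Liftings G' H' L' M'}
    {φG : G →* G'} {φH : H →* H'} {φL : L →* L'} {φM : M →* M'}

lemma PeifferComplex.IsHom.boundary (φ : P.IsHom P' φG φH φL) :
    Liftings.IsHom P P' P.boundary P'.boundary φG φH φL φL where
  toIsHom := φ
  aG := φ.smul_L
  aH := φ.smulH_L
  aL _ _ := by simp [PeifferComplex.boundary]
  lhom _ _ _ := by
    simp [PeifferComplex.boundary, φ.smulH_L, φ.smul_H, φ.dH, φ.pf]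
  rhom _ _ _ := by
    simp [PeifferComplex.boundary, φ.smulH_L, φ.smul_H, φ.dH, φ.pf]
  hl _ _ := by
    simp [PeifferComplex.boundary, φ.smulH_L, φ.dL, φ.pf]
  hl' _ _ := by
    simp [PeifferComplex.boundary, φ.smul_L, φ.smulH_L, φ.dH, φ.dL, φ.pf]
  ll _ _ := by
    simp [PeifferComplex.boundary, φ.smulH_L, φ.dL]

namespace Liftings.IsHom

variable (φ : Liftings.IsHom P P' o o' φG φH φL φM)
include φ

/-- Laws pull back along morphisms. -/
lemma lawful {N : Type*} [Group N] {f : M' →* N} (w : o'.Lawful P' f) :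
    o.Lawful P (f.comp φM) where
  smul_lhom _ _ _ _ := by
    simpa [φ.aG, φ.lhom, φ.smul_H] using w.smul_lhom _ _ _ _
  smul_rhom _ _ _ _ := by
    simpa [φ.aG, φ.rhom, φ.smul_H] using w.smul_rhom _ _ _ _
  smul_ll _ _ _ := by simpa [φ.aG, φ.ll, φ.smul_L] using w.smul_ll _ _ _
  smulH_ll _ _ _ := by simpa [φ.aH, φ.ll, φ.smulH_L] using w.smulH_ll _ _ _
  smul_hl _ _ _ := by simpa [φ.aG, φ.hl, φ.smul_H, φ.smul_L] using w.smul_hl _ _ _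
  smul_hl' _ _ _ := by simpa [φ.aG, φ.hl', φ.smul_H, φ.smul_L] using w.smul_hl' _ _ _
  ll_mul_left _ _ _ := by
    simpa [φ.aL, φ.ll, φ.smulH_L, φ.dL] using w.ll_mul_left (φL _) (φL _) (φL _)
  ll_mul_right _ _ _ := by
    simpa [φ.aL, φ.ll, φ.smulH_L, φ.dL] using w.ll_mul_right (φL _) (φL _) (φL _)
  hl_mul_left _ _ _ := by
    simpa [φ.aL, φ.aH, φ.hl, φ.rhom, φ.dL] using w.hl_mul_left (φH _) (φH _) (φL _)
  hl_mul_right _ _ _ := by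
    simpa [φ.aL, φ.hl, φ.ll, φ.lhom, φ.dL, φ.pf, φ.smulH_L]
      using w.hl_mul_right (φH _) (φL _) (φL _)
  hl'_mul_left _ _ _ := by
    simpa [φ.aL, φ.aH, φ.hl', φ.lhom, φ.dL, φ.dH, φ.smul_L, φ.smulH_L]
      using w.hl'_mul_left (φH _) (φH _) (φL _)
  hl'_mul_right _ _ _ := by
    simpa [φ.aL, φ.hl', φ.ll, φ.rhom, φ.dL, φ.dH, φ.pf, φ.smul_L, φ.smulH_L]
      using w.hl'_mul_right (φH _) (φL _) (φL _)
  lhom_lhom _ _ _ _ := by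
    simpa [φ.aL, φ.aH, φ.lhom, φ.pf, φ.dH, φ.smulH_L, φ.smul_H]
      using w.lhom_lhom (φH _) (φH _) (φH _) (φH _)
  rhom_rhom _ _ _ _ := by
    simpa [φ.aL, φ.aH, φ.rhom, φ.pf, φ.dH, φ.smul_H]
      using w.rhom_rhom (φH _) (φH _) (φH _) (φH _)
  lhom_rhom _ _ _ _ := by
    simpa [φ.aL, φ.aH, φ.lhom, φ.rhom, φ.ll, φ.pf, φ.dH, φ.smul_H, φ.smulH_L]
      using w.lhom_rhom (φH _) (φH _) (φH _) (φH _)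
  yangBaxter _ _ _ := by
    simpa [φ.aL, φ.lhom, φ.rhom, φ.hl, φ.hl', φ.ll, φ.pf, φ.dH, φ.dL, φ.smul_H, φ.smul_L,
      φ.smulH_L] using w.yangBaxter (φH _) (φH _) (φH _)
  ll_swap _ _ := by
    simpa [φ.aL, φ.hl, φ.hl', φ.ll, φ.dL, φ.smulH_L] using w.ll_swap (φL _) (φL _)

section five

variable {ι : Type*} (g : ι → ι → G) (h : ι → ι → ι → H) (l : ι → ι → ι → ι → L)
    (m : ι → ι → ι → ι → ι → M) (i j k p q x : ι)

lemma map_fiveLeft :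
    φM (fiveLeft P o g h l m i j k p q x) =
      fiveLeft P' o' (fun i j => φG (g i j)) (fun i j k => φH (h i j k))
        (fun i j k p => φL (l i j k p)) (fun i j k p q => φM (m i j k p q)) i j k p q x := by
  simp only [fiveLeft, fiveM1, fiveM2, fiveM3, fiveM4, fiveM5, fiveLA, fiveLB, fiveLC, fiveLD,
    fiveLE, fiveLF, map_mul, map_inv, φ.aG, φ.aH, φ.aL, φ.lhom, φ.ll, φ.pf, φ.smul_H, φ.smulH_L]

lemma map_fiveRight :
    φM (fiveRight P o g h l m i j k p q x) =
      fiveRight P' o' (fun i j => φG (g i j)) (fun i j k => φH (h i j k))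
        (fun i j k p => φL (l i j k p)) (fun i j k p q => φM (m i j k p q)) i j k p q x := by
  simp only [fiveRight, fiveM1', fiveM2', fiveM3', fiveM4', fiveM5', fiveM6', fiveM7', fiveP7,
    fiveM8', fiveM9', fiveM10', fiveM11', fiveM12', fiveM13', fiveZ, fiveLA, fiveLB, fiveLD,
    fiveLG, fiveLH, fiveLI, fiveLJ, fiveLL, fiveLM, fiveLN, map_mul, map_inv, φ.aH, φ.aL,
    φ.lhom, φ.rhom, φ.hl, φ.hl', φ.ll, φ.pf, φ.dL, φ.smul_H, φ.smul_L, φ.smulH_L]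

end five

end Liftings.IsHom

end hom

variable {G H L M : Type*} [Group G] [Group H] [Group L] [Group M]
  [MulDistribMulAction G H] [MulDistribMulAction G L] [MulDistribMulAction G M]
  [MulDistribMulAction H L] [MulDistribMulAction H M] [MulDistribMulAction L M]
  (T : ThreeCrossedModule G H L M)

/-- The compatibility of the actions of `G` and `H` on `L` follows from the equivariance of the
boundary of `hl`. -/
lemma smul_smulH (T : ThreeCrossedModule G H L M) (g : G) (h : H) (l : L) :
    g • h • l = (g • h) • g • l := by
  have h1 := T.dM_hl h l
  have h2 := congrArg (g • ·) h1
  have h3 := T.dM_hl (g • h) (g • l)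
  simp only [smul_mul', ← T.dM_smul, T.smul_hl, T.smul_pf, ← T.dL_smul, smul_inv'] at h2 h3
  rw [← h3] at h2
  exact mul_left_cancel h2

lemma smul_smulL (T : ThreeCrossedModule G H L M) (g : G) (l : L) (m : M) :
    g • l • m = (g • l) • g • m := by
  rw [T.smulL_eq, T.smulL_eq, smul_mul', T.smul_ll, ← smul_inv', T.dM_smul]

lemma smulH_smulL (T : ThreeCrossedModule G H L M) (h : H) (l : L) (m : M) :
    h • l • m = (h • l) • h • m := by
  rw [T.smulL_eq, T.smulL_eq, smul_mul', T.smulH_ll, ← smul_inv', T.dM_smulH]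

lemma smul_smulH_M (T : ThreeCrossedModule G H L M) (g : G) (h : H) (m : M) :
    g • h • m = (g • h) • g • m := by
  rw [T.smulH_eq, T.smulH_eq, smul_mul', T.smul_hl, ← smul_inv', T.dM_smul]

/-- The complex `L → H → G` of a 3-crossed module with its Peiffer lifting. -/
def peiffer : PeifferComplex G H L where
  dH := T.dH
  dL := T.dL
  pf := T.pf
  dH_dL := T.dH_dL
  dH_smul := T.dH_smul
  dL_smul := T.dL_smul
  dL_smulH := T.dL_smulH
  smul_smulH := T.smul_smulH
  smul_pf := T.smul_pf
  dL_pf := T.dL_pf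

/-- The actions on `M` and the liftings to `M` of a 3-crossed module. -/
def liftings : Liftings G H L M where
  aG g m := g • m
  aH h m := h • m
  aL l m := l • m
  lhom := T.lhom
  rhom := T.rhom
  hl := T.hl
  hl' := T.hl'
  ll := T.ll

lemma lawful : T.liftings.Lawful T.peiffer (MonoidHom.id M) where
  smul_lhom := T.smul_lhom
  smul_rhom := T.smul_rhom
  smul_ll := T.smul_ll
  smulH_ll := T.smulH_ll
  smul_hl := T.smul_hl
  smul_hl' := T.smul_hl'
  ll_mul_left := T.ll_mul_left
  ll_mul_right := T.ll_mul_right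
  hl_mul_left := T.hl_mul_left
  hl_mul_right := T.hl_mul_right
  hl'_mul_left := T.hl'_mul_left
  hl'_mul_right := T.hl'_mul_right
  lhom_lhom := T.lhom_lhom
  rhom_rhom := T.rhom_rhom
  lhom_rhom := T.lhom_rhom
  yangBaxter := T.yangBaxter
  ll_swap := T.ll_swap

/-- The liftings to `M` lift the boundary liftings. -/
lemma isHom_dM : Liftings.IsHom T.peiffer T.peiffer T.liftings T.peiffer.boundary
    (MonoidHom.id G) (MonoidHom.id H) (MonoidHom.id L) T.dM where
  smul_H _ _ := rfl
  smul_L _ _ := rfl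
  smulH_L _ _ := rfl
  dH _ := rfl
  dL _ := rfl
  pf _ _ := rfl
  aG := T.dM_smul
  aH := T.dM_smulH
  aL := T.dM_smulL
  lhom c b a := eq_mul_inv_of_mul_eq <| by
    rw [← mul_assoc]; exact (T.dM_lhom c b a).symm
  rhom c b a := eq_mul_inv_of_mul_eq <| by
    rw [← mul_assoc]; exact (T.dM_rhom c b a).symm
  hl h l := eq_mul_inv_of_mul_eq (T.dM_hl h l)
  hl' h l := eq_mul_inv_of_mul_eq (T.dM_hl' h l)
  ll l l' := eq_mul_inv_of_mul_eq (T.dM_ll l l')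

end ThreeCrossedModule

/-! ### Normalization and degenerate simplices -/

namespace ThreeCrossedModule

variable {G H L M : Type*} [Group G] [Group H] [Group L] [Group M]
  [MulDistribMulAction G H] [MulDistribMulAction G L] [MulDistribMulAction G M]
  [MulDistribMulAction H L] [MulDistribMulAction H M] [MulDistribMulAction L M]
  (T : ThreeCrossedModule G H L M)

lemma hl_one_right (h : H) : T.hl h 1 = 1 := by simpa using (T.smulH_eq h 1).symm

lemma hl'_one_right (h : H) : T.hl' h 1 = 1 := by simpa using (T.dH_smulM h 1).symm

lemma ll_one_left (l : L) : T.ll 1 l = 1 := by simpa using (T.smulL_eq l 1).symm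

lemma ll_one_right (l : L) : T.ll l 1 = 1 := by simpa using T.ll_mul_right l 1 1

lemma pf_one_left (h : H) : T.pf 1 h = 1 := by
  have e : T.lhom 1 1 h = 1 := by
    simpa [T.hl_one_right, T.ll_one_left] using (T.hl_mul_right h 1 1).symm
  simpa [e] using T.dM_lhom 1 1 h

lemma rhom_one_one (h : H) : T.rhom h 1 1 = 1 := by
  simpa [T.hl'_one_right, T.ll_one_left] using (T.hl'_mul_right h 1 1).symm

lemma pf_one_right (h : H) : T.pf h 1 = 1 := by
  simpa [T.rhom_one_one] using T.dM_rhom h 1 1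

lemma lhom_one_left (b a : H) : T.lhom 1 b a = 1 := by
  have e (h : H) : T.lhom 1 1 h = 1 := by
    simpa [T.hl_one_right, T.ll_one_left] using (T.hl_mul_right h 1 1).symm
  simpa [e] using (T.lhom_lhom 1 1 b a).symm

lemma lhom_one_mid (c a : H) : T.lhom c 1 a = 1 := by
  simpa [T.lhom_one_left, T.pf_one_left] using T.lhom_lhom c 1 1 a

lemma lhom_one_right (c b : H) : T.lhom c b 1 = 1 := by
  simpa [T.hl'_one_right] using (T.hl'_mul_left c b 1).symm

lemma rhom_one_left (b a : H) : T.rhom 1 b a = 1 := by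
  simpa [T.hl_one_right] using (T.hl_mul_left b a 1).symm

lemma rhom_one_mid (c a : H) : T.rhom c 1 a = 1 := by
  simpa [T.rhom_one_one, T.pf_one_right] using (T.rhom_rhom c 1 1 a).symm

lemma rhom_one_right (c b : H) : T.rhom c b 1 = 1 := by
  simpa [T.rhom_one_one] using T.rhom_rhom c b 1 1

lemma hl_one_left (l : L) : T.hl 1 l = 1 := by
  simpa [T.rhom_one_right] using T.hl_mul_left 1 1 l

lemma hl'_one_left (l : L) : T.hl' 1 l = 1 := by
  simpa [T.lhom_one_left] using T.hl'_mul_left 1 1 l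

/-- Normalization of colorings which are given as total functions. -/
structure Normalized {G H L M ι : Type*} [One G] [One H] [One L] [One M]
    (g : ι → ι → G) (h : ι → ι → ι → H) (l : ι → ι → ι → ι → L)
    (m : ι → ι → ι → ι → ι → M) : Prop where
  g_refl : ∀ i, g i i = 1
  h_left : ∀ i j, h i i j = 1
  h_right : ∀ i j, h i j j = 1
  l_left : ∀ i j k, l i i j k = 1
  l_mid : ∀ i j k, l i j j k = 1
  l_right : ∀ i j k, l i j k k = 1
  m_1 : ∀ i j k p, m i i j k p = 1
  m_2 : ∀ i j k p, m i j j k p = 1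
  m_3 : ∀ i j k p, m i j k k p = 1
  m_4 : ∀ i j k p, m i j k p p = 1

namespace Normalized

variable {ι : Type*} {g : ι → ι → G} {h : ι → ι → ι → H} {l : ι → ι → ι → ι → L}
  {m : ι → ι → ι → ι → ι → M} (n : Normalized g h l m)
include n

/-- The `5`-simplex identity holds for degenerate simplices. -/
lemma fiveLeft_eq_fiveRight {i j k p q x : ι}
    (hd : i = j ∨ j = k ∨ k = p ∨ p = q ∨ q = x) :
    fiveLeft T.peiffer T.liftings g h l m i j k p q x =
      fiveRight T.peiffer T.liftings g h l m i j k p q x := by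
  rcases hd with rfl | rfl | rfl | rfl | rfl <;>
    simp [fiveLeft, fiveRight, fiveM1', fiveM2', fiveM3', fiveM4', fiveM5', fiveM6', fiveM7',
      fiveP7, fiveM8', fiveM9', fiveM10', fiveM11', fiveM12', fiveM13', fiveZ, fiveLA, fiveLB,
      fiveLC, fiveLD, fiveLE, fiveLF, fiveLG, fiveLH, fiveLI, fiveLJ, fiveLL, fiveLM, fiveLN,
      fiveM1, fiveM2, fiveM3, fiveM4, fiveM5, peiffer, liftings,
      n.g_refl, n.h_left, n.h_right, n.l_left, n.l_mid, n.l_right,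
      n.m_1, n.m_2, n.m_3, n.m_4, T.pf_one_left, T.pf_one_right, T.lhom_one_left, T.lhom_one_mid,
      T.lhom_one_right, T.rhom_one_left, T.rhom_one_mid, T.rhom_one_right, T.hl_one_left,
      T.hl_one_right, T.hl'_one_left, T.hl'_one_right, T.ll_one_left, T.ll_one_right]

end Normalized

end ThreeCrossedModule

/-! ### Covers -/

namespace ThreeCrossedModule

variable {G H L M : Type*} [Group G] [Group H] [Group L] [Group M]
  [MulDistribMulAction G H] [MulDistribMulAction G L] [MulDistribMulAction G M]
  [MulDistribMulAction H L] [MulDistribMulAction H M] [MulDistribMulAction L M]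

section kernel

variable (T : ThreeCrossedModule G H L M)

/-- The kernel of `∂ : M → L` is central in `M`, since `∂ m` acts on `M` as conjugation by `m`. -/
instance : CommGroup T.dM.ker where
  mul_comm a b := Subtype.ext <| by
    have h := T.dM_smulM a.1 b.1
    rw [MonoidHom.mem_ker.mp a.2, one_smul] at h
    exact (eq_mul_inv_iff_mul_eq.mp h).symm

variable {T} in
lemma smulL_of_mem (l : L) {a : M} (ha : T.dM a = 1) : l • a = a := by
  rw [T.smulL_eq, map_inv, ha, inv_one, T.ll_one_left, mul_one]

variable {T} in
lemma smulH_of_mem (h : H) {a : M} (ha : T.dM a = 1) : h • a = a := by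
  rw [T.smulH_eq, map_inv, ha, inv_one, T.hl_one_right, mul_one]

variable {T} in
lemma dH_smul_of_mem (h : H) {a : M} (ha : T.dM a = 1) : T.dH h • a = a := by
  rw [T.dH_smulM, map_inv, ha, inv_one, T.hl'_one_right, mul_one, smulH_of_mem h ha]

/-- The action of `G` on the kernel of `∂ : M → L`. -/
instance : MulDistribMulAction G T.dM.ker where
  smul g a := ⟨g • a.1, by
    rw [MonoidHom.mem_ker, T.dM_smul, MonoidHom.mem_ker.mp a.2, smul_one]⟩
  one_smul a := Subtype.ext (one_smul G a.1)
  mul_smul g h a := Subtype.ext (mul_smul g h a.1)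
  smul_mul g a b := Subtype.ext (smul_mul' g a.1 b.1)
  smul_one g := Subtype.ext (smul_one g)

/-- Multiplication by elements of the (central) kernel of `∂ : M → L`. -/
def mulKer : M × T.dM.ker →* M :=
  MonoidHom.noncommCoprod (MonoidHom.id M) T.dM.ker.subtype fun m a => by
    have h := T.dM_smulM a.1 m
    rw [MonoidHom.mem_ker.mp a.2, one_smul] at h
    exact (eq_mul_inv_iff_mul_eq.mp h)

@[simp] lemma mulKer_apply (x : M × T.dM.ker) : T.mulKer x = x.1 * x.2 := rfl

end kernel

/-- A cover `N → F → Γ` of `L → H → G` in which `M` embeds as the kernel of `N → F`, compatibly with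
all actions, and for which `N → F → Γ` is exact.  As the boundary liftings of the cover lie in the
kernel of `N → F`, they can be regarded as liftings with values in `M`, which satisfy all laws by
`PeifferComplex.lawful_boundary`. -/
structure Cover (T : ThreeCrossedModule G H L M) (Γ F N : Type*) [Group Γ] [Group F] [Group N]
    [MulDistribMulAction Γ F] [MulDistribMulAction Γ N] [MulDistribMulAction F N] where
  P : PeifferComplex Γ F N
  φG : Γ →* G
  φH : F →* H
  φL : N →* L
  isHom : P.IsHom T.peiffer φG φH φL
  surjective_φG : Function.Surjective φG
  surjective_φH : Function.Surjective φH
  surjective_φL : Function.Surjective φL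
  /-- the inclusion of `M` -/
  ι : M →* N
  injective_ι : Function.Injective ι
  dL_ι : ∀ m, P.dL (ι m) = 1
  exists_ι : ∀ n, P.dL n = 1 → ∃ m, ι m = n
  φL_ι : ∀ m, φL (ι m) = T.dM m
  exists_dL : ∀ f, P.dH f = 1 → ∃ n, P.dL n = f
  smul_ι : ∀ γ m, γ • ι m = ι (φG γ • m)
  smulH_ι : ∀ f m, f • ι m = ι (φH f • m)
  conj_ι : ∀ n m, n * ι m * n⁻¹ = ι (φL n • m)
  pf_one_left : ∀ f, P.pf 1 f = 1
  pf_one_right : ∀ f, P.pf f 1 = 1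

namespace Cover

variable {T : ThreeCrossedModule G H L M} {Γ F N : Type*} [Group Γ] [Group F] [Group N]
    [MulDistribMulAction Γ F] [MulDistribMulAction Γ N] [MulDistribMulAction F N]
    (C : T.Cover Γ F N)

lemma ι_invFun {x : N} (h : C.P.dL x = 1) : C.ι (Function.invFun C.ι x) = x :=
  Function.invFun_eq (C.exists_ι x h)

/-- The liftings of the cover with values in `M`: the boundary liftings of the cover lie in
`M ⊆ N`. -/
noncomputable def base : Liftings Γ F N M where
  aG γ m := C.φG γ • m
  aH f m := C.φH f • m
  aL n m := C.φL n • m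
  lhom c b a := Function.invFun C.ι (C.P.boundary.lhom c b a)
  rhom c b a := Function.invFun C.ι (C.P.boundary.rhom c b a)
  hl c l := Function.invFun C.ι (C.P.boundary.hl c l)
  hl' c l := Function.invFun C.ι (C.P.boundary.hl' c l)
  ll l k := Function.invFun C.ι (C.P.boundary.ll l k)

lemma dL_boundary_lhom (P : PeifferComplex Γ F N) (c b a : F) :
    P.dL (P.boundary.lhom c b a) = 1 := by
  simp only [PeifferComplex.boundary, map_mul, map_inv, P.dL_pf, P.dL_smulH, smul_inv', mul_smul]
  group

lemma dL_boundary_rhom (P : PeifferComplex Γ F N) (c b a : F) :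
    P.dL (P.boundary.rhom c b a) = 1 := by
  simp only [PeifferComplex.boundary, map_mul, map_inv, P.dL_pf, P.dL_smulH, smul_inv', smul_mul']
  group

lemma dL_boundary_hl (P : PeifferComplex Γ F N) (c : F) (l : N) :
    P.dL (P.boundary.hl c l) = 1 := by
  simp only [PeifferComplex.boundary, map_mul, map_inv, P.dL_pf, P.dL_smulH, smul_inv', P.dH_dL,
    inv_one, one_smul]
  group

lemma dL_boundary_hl' (P : PeifferComplex Γ F N) (c : F) (l : N) :
    P.dL (P.boundary.hl' c l) = 1 := by
  simp only [PeifferComplex.boundary, map_mul, map_inv, P.dL_pf, P.dL_smulH, smul_inv', P.dL_smul]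
  group

lemma dL_boundary_ll (P : PeifferComplex Γ F N) (l k : N) :
    P.dL (P.boundary.ll l k) = 1 := by
  simp only [PeifferComplex.boundary, map_mul, map_inv, P.dL_smulH]
  group

lemma isHom_ι : Liftings.IsHom C.P C.P C.base C.P.boundary
    (MonoidHom.id Γ) (MonoidHom.id F) (MonoidHom.id N) C.ι where
  smul_H _ _ := rfl
  smul_L _ _ := rfl
  smulH_L _ _ := rfl
  dH _ := rfl
  dL _ := rfl
  pf _ _ := rfl
  aG γ m := (C.smul_ι γ m).symm
  aH f m := (C.smulH_ι f m).symm
  aL n m := (C.conj_ι n m).symm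
  lhom _ _ _ := C.ι_invFun (dL_boundary_lhom _ _ _ _)
  rhom _ _ _ := C.ι_invFun (dL_boundary_rhom _ _ _ _)
  hl _ _ := C.ι_invFun (dL_boundary_hl _ _ _)
  hl' _ _ := C.ι_invFun (dL_boundary_hl' _ _ _)
  ll _ _ := C.ι_invFun (dL_boundary_ll _ _ _)

/-- The liftings of `T` and those of the cover have the same boundary in `L`. -/
lemma isHom_base : Liftings.IsHom C.P T.peiffer C.base T.peiffer.boundary
    C.φG C.φH C.φL T.dM where
  toIsHom := C.isHom
  aG _ _ := T.dM_smul _ _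
  aH _ _ := T.dM_smulH _ _
  aL _ _ := T.dM_smulL _ _
  lhom c b a := by rw [← C.φL_ι, C.isHom_ι.lhom]; exact C.isHom.boundary.lhom _ _ _
  rhom c b a := by rw [← C.φL_ι, C.isHom_ι.rhom]; exact C.isHom.boundary.rhom _ _ _
  hl c b := by rw [← C.φL_ι, C.isHom_ι.hl]; exact C.isHom.boundary.hl _ _
  hl' c b := by rw [← C.φL_ι, C.isHom_ι.hl']; exact C.isHom.boundary.hl' _ _
  ll c b := by rw [← C.φL_ι, C.isHom_ι.ll]; exact C.isHom.boundary.ll _ _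

/-- The quotient of two elements of `M` with the same boundary. -/
def diff (x y : M) (h : T.dM x = T.dM y) : T.dM.ker :=
  ⟨x⁻¹ * y, by rw [MonoidHom.mem_ker, map_mul, map_inv, h, inv_mul_cancel]⟩

/-- The liftings of `T` evaluated on the cover, decomposed into those of the cover and their
deviation from them. -/
noncomputable def split : Liftings Γ F N (M × T.dM.ker) where
  aG γ x := (C.φG γ • x.1, C.φG γ • x.2)
  aH f x := (C.φH f • x.1, x.2)
  aL n x := (C.φL n • x.1, x.2)
  lhom c b a := (C.base.lhom c b a, diff (C.base.lhom c b a) (T.lhom (C.φH c) (C.φH b) (C.φH a))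
    ((C.isHom_base.lhom _ _ _).trans (T.isHom_dM.lhom _ _ _).symm))
  rhom c b a := (C.base.rhom c b a, diff (C.base.rhom c b a) (T.rhom (C.φH c) (C.φH b) (C.φH a))
    ((C.isHom_base.rhom _ _ _).trans (T.isHom_dM.rhom _ _ _).symm))
  hl c l := (C.base.hl c l, diff (C.base.hl c l) (T.hl (C.φH c) (C.φL l))
    ((C.isHom_base.hl _ _).trans (T.isHom_dM.hl _ _).symm))
  hl' c l := (C.base.hl' c l, diff (C.base.hl' c l) (T.hl' (C.φH c) (C.φL l))
    ((C.isHom_base.hl' _ _).trans (T.isHom_dM.hl' _ _).symm))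
  ll l k := (C.base.ll l k, diff (C.base.ll l k) (T.ll (C.φL l) (C.φL k))
    ((C.isHom_base.ll _ _).trans (T.isHom_dM.ll _ _).symm))

/-- Multiplying the two components of `split` gives back the liftings of `T`. -/
lemma isHom_mulKer : Liftings.IsHom C.P T.peiffer C.split T.liftings
    C.φG C.φH C.φL T.mulKer where
  toIsHom := C.isHom
  aG _ _ := (smul_mul' _ _ _).symm
  aH h x := by
    rw [mulKer_apply, mulKer_apply]
    exact (congrArg _ (smulH_of_mem _ x.2.2).symm).trans (smul_mul' _ _ _).symm
  aL l x := by
    rw [mulKer_apply, mulKer_apply]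
    exact (congrArg _ (smulL_of_mem _ x.2.2).symm).trans (smul_mul' _ _ _).symm
  lhom _ _ _ := mul_inv_cancel_left _ _
  rhom _ _ _ := mul_inv_cancel_left _ _
  hl _ _ := mul_inv_cancel_left _ _
  hl' _ _ := mul_inv_cancel_left _ _
  ll _ _ := mul_inv_cancel_left _ _

lemma isHom_fst : Liftings.IsHom C.P C.P C.split C.P.boundary
    (MonoidHom.id Γ) (MonoidHom.id F) (MonoidHom.id N) (C.ι.comp (MonoidHom.fst _ _)) where
  toIsHom := C.isHom_ι.toIsHom
  aG _ _ := C.isHom_ι.aG _ _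
  aH _ _ := C.isHom_ι.aH _ _
  aL _ _ := C.isHom_ι.aL _ _
  lhom _ _ _ := C.isHom_ι.lhom _ _ _
  rhom _ _ _ := C.isHom_ι.rhom _ _ _
  hl _ _ := C.isHom_ι.hl _ _
  hl' _ _ := C.isHom_ι.hl' _ _
  ll _ _ := C.isHom_ι.ll _ _

/-- The second component of `split` is determined by the values in the cover and in `T`. -/
lemma eq_snd (x y : M × T.dM.ker) (h₁ : C.ι x.1 = C.ι y.1) (h₂ : T.mulKer x = T.mulKer y) :
    x.2 = y.2 := by
  rw [mulKer_apply, mulKer_apply, C.injective_ι h₁] at h₂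
  exact Subtype.ext (mul_left_cancel h₂)

/-- The deviations satisfy the laws of a 3-crossed module, since the liftings of the cover and those
of `T` do. -/
lemma lawful_snd : C.split.Lawful C.P (MonoidHom.snd M T.dM.ker) :=
  (C.isHom_fst.lawful C.P.lawful_boundary).of_forall C.eq_snd (C.isHom_mulKer.lawful T.lawful)

end Cover
end ThreeCrossedModule

/-! ### The deviation of a 3-crossed module from its cover -/

namespace ThreeCrossedModule

variable {G H L M : Type*} [Group G] [Group H] [Group L] [Group M]
  [MulDistribMulAction G H] [MulDistribMulAction G L] [MulDistribMulAction G M]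
  [MulDistribMulAction H L] [MulDistribMulAction H M] [MulDistribMulAction L M]

namespace Cover

variable {T : ThreeCrossedModule G H L M} {Γ F N : Type*} [Group Γ] [Group F] [Group N]
    [MulDistribMulAction Γ F] [MulDistribMulAction Γ N] [MulDistribMulAction F N]
    (C : T.Cover Γ F N)

/-- The kernel of `∂ : M → L` in additive notation. It is a type of its own for each cover because
it carries the action of `Γ`. -/
def Coeff (_ : T.Cover Γ F N) : Type _ := Additive T.dM.ker

/-- The group of coefficients is abelian. -/
instance : AddCommGroup C.Coeff := inferInstanceAs (AddCommGroup (Additive T.dM.ker))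

/-- The comparison of the multiplicative and additive notation. -/
def toCoeff (a : T.dM.ker) : C.Coeff := Additive.ofMul a

lemma toCoeff_mul (a b : T.dM.ker) : C.toCoeff (a * b) = C.toCoeff a + C.toCoeff b := rfl
lemma toCoeff_inv (a : T.dM.ker) : C.toCoeff a⁻¹ = -C.toCoeff a := rfl
lemma toCoeff_injective : Function.Injective C.toCoeff := fun _ _ h => h

/-- The action of `Γ` through its image in `G`. -/
instance : DistribMulAction Γ C.Coeff where
  smul γ a := C.toCoeff (C.φG γ • Additive.toMul a)
  one_smul a := congrArg C.toCoeff ((congrArg (· • a.toMul) (map_one C.φG)).trans (one_smul G _))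
  mul_smul γ γ' a := congrArg C.toCoeff
    ((congrArg (· • a.toMul) (map_mul C.φG γ γ')).trans (mul_smul _ _ _))
  smul_zero _ := congrArg C.toCoeff (smul_one _)
  smul_add _ a b := congrArg C.toCoeff (smul_mul' _ a.toMul b.toMul)

lemma smul_toCoeff (γ : Γ) (a : T.dM.ker) : γ • C.toCoeff a = C.toCoeff (C.φG γ • a) := rfl

lemma dH_smul_toCoeff (f : F) (a : C.Coeff) : C.P.dH f • a = a := by
  refine congrArg C.toCoeff (Subtype.ext ?_)
  rw [C.isHom.dH]
  exact dH_smul_of_mem (T := T) _ a.toMul.2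

/-- A lift of an element of the kernel of `F → Γ`. -/
noncomputable def lift (f : F) : N := Function.invFun C.P.dL f

lemma dL_lift {f : F} (h : C.P.dH f = 1) : C.P.dL (C.lift f) = f :=
  Function.invFun_eq (C.exists_dL f h)

lemma base_hl_one (c : F) (m : M) : C.base.hl c (C.ι m) = m * (C.φH c • m)⁻¹ := by
  apply C.injective_ι
  rw [C.isHom_ι.hl]
  simp [PeifferComplex.boundary, C.dL_ι, C.pf_one_left, C.smulH_ι]

lemma base_hl'_one (c : F) (m : M) :
    C.base.hl' c (C.ι m) = C.φH c • m * (C.φG (C.P.dH c) • m)⁻¹ := by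
  apply C.injective_ι
  rw [C.isHom_ι.hl']
  simp [PeifferComplex.boundary, C.dL_ι, C.pf_one_right, C.smulH_ι, C.smul_ι]

lemma base_ll_one_left (l : N) (m : M) : C.base.ll (C.ι m) l = m * (C.φL l • m)⁻¹ := by
  apply C.injective_ι
  rw [C.isHom_ι.ll]
  simp [PeifferComplex.boundary, C.dL_ι, mul_assoc, ← C.conj_ι]

lemma base_ll_one_right (l : N) (m : M) :
    C.base.ll l (C.ι m) = C.φL l • m * (C.φH (C.P.dL l) • m)⁻¹ := by
  apply C.injective_ι
  rw [C.isHom_ι.ll]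
  simp [PeifferComplex.boundary, C.smulH_ι, ← C.conj_ι]

lemma split_hl_one (c : F) (m : M) : (C.split.hl c (C.ι m)).2 = 1 := by
  refine Subtype.ext (inv_mul_eq_one.mpr ?_)
  have := T.smulH_eq (C.φH c) m⁻¹
  rw [inv_inv, eq_inv_mul_iff_mul_eq] at this
  rw [C.base_hl_one, C.φL_ι, ← this, smul_inv']

lemma split_hl'_one (c : F) (m : M) : (C.split.hl' c (C.ι m)).2 = 1 := by
  refine Subtype.ext (inv_mul_eq_one.mpr ?_)
  have := T.dH_smulM (C.φH c) m⁻¹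
  rw [inv_inv, ← inv_mul_eq_iff_eq_mul] at this
  rw [C.base_hl'_one, C.φL_ι, ← this, smul_inv', smul_inv', inv_inv, C.isHom.dH]
  rfl

lemma split_ll_one_left (l : N) (m : M) : (C.split.ll (C.ι m) l).2 = 1 := by
  refine Subtype.ext (inv_mul_eq_one.mpr ?_)
  have := T.smulL_eq (C.φL l) m⁻¹
  rw [inv_inv, eq_inv_mul_iff_mul_eq] at this
  rw [C.base_ll_one_left, C.φL_ι, ← this, smul_inv']

lemma split_ll_one_right (l : N) (m : M) : (C.split.ll l (C.ι m)).2 = 1 := by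
  refine Subtype.ext (inv_mul_eq_one.mpr ?_)
  have e1 := T.smulL_eq (C.φL l) m⁻¹
  have e2 := T.smulH_eq (T.dL (C.φL l)) m⁻¹
  have e3 := T.ll_dM_mul (C.φL l) m
  rw [inv_inv, ← inv_mul_eq_iff_eq_mul] at e1 e2
  rw [← e1, ← e2] at e3
  rw [C.base_ll_one_right, C.φL_ι, C.isHom.dL, ← mul_right_inj (m⁻¹⁻¹ * C.φL l • m⁻¹), e3]
  simp [smul_inv', mul_assoc, peiffer]

lemma split_lhom_one_mid (c a : F) : (C.split.lhom c 1 a).2 = 1 := by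
  refine Subtype.ext (inv_mul_eq_one.mpr (C.injective_ι ?_))
  rw [C.isHom_ι.lhom]
  simp [PeifferComplex.boundary, C.pf_one_left, T.lhom_one_mid]

lemma split_rhom_one_right (c b : F) : (C.split.rhom c b 1).2 = 1 := by
  refine Subtype.ext (inv_mul_eq_one.mpr (C.injective_ι ?_))
  rw [C.isHom_ι.rhom]
  simp [PeifferComplex.boundary, C.pf_one_right, T.rhom_one_right]

lemma exists_ι_mul {n n' : N} (h : C.P.dL n = C.P.dL n') : ∃ m, n = C.ι m * n' := by
  obtain ⟨m, hm⟩ := C.exists_ι (n * n'⁻¹) (by simp [h])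
  exact ⟨m, by simp [hm]⟩

@[simp] lemma snd_split_aG (γ : Γ) (x : M × T.dM.ker) : (C.split.aG γ x).2 = C.φG γ • x.2 := rfl
@[simp] lemma snd_split_aH (f : F) (x : M × T.dM.ker) : (C.split.aH f x).2 = x.2 := rfl
@[simp] lemma snd_split_aL (n : N) (x : M × T.dM.ker) : (C.split.aL n x).2 = x.2 := rfl

/-- The deviation of `hl` does not change if its argument is multiplied by an element of `M`, so
that it only depends on the image in `F`. -/
lemma split_hl_congr (c : F) {n n' : N} (h : C.P.dL n = C.P.dL n') :
    (C.split.hl c n).2 = (C.split.hl c n').2 := by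
  obtain ⟨m, rfl⟩ := C.exists_ι_mul h
  have := C.lawful_snd.hl_mul_right c (C.ι m) n'
  simpa [C.dL_ι, C.pf_one_left, C.split_hl_one, C.split_lhom_one_mid,
    show (C.split.ll n'⁻¹ 1).2 = 1 by simpa using C.split_ll_one_right n'⁻¹ 1] using this

lemma split_hl'_congr (c : F) {n n' : N} (h : C.P.dL n = C.P.dL n') :
    (C.split.hl' c n).2 = (C.split.hl' c n').2 := by
  obtain ⟨m, rfl⟩ := C.exists_ι_mul h
  have := C.lawful_snd.hl'_mul_right c (C.ι m) n'
  simpa [C.dL_ι, C.pf_one_right, C.split_hl'_one, C.split_rhom_one_right,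
    show ∀ x, (C.split.ll x 1).2 = 1 from fun x => by simpa using C.split_ll_one_right x 1]
    using this

lemma split_ll_congr {n n' k k' : N} (h : C.P.dL n = C.P.dL n') (h' : C.P.dL k = C.P.dL k') :
    (C.split.ll n k).2 = (C.split.ll n' k').2 := by
  obtain ⟨m, rfl⟩ := C.exists_ι_mul h
  obtain ⟨m', rfl⟩ := C.exists_ι_mul h'
  have e1 := C.lawful_snd.ll_mul_left (C.ι m) n' (C.ι m' * k')
  have e2 := C.lawful_snd.ll_mul_right n' (C.ι m') k'
  simp only [MonoidHom.coe_snd, Prod.snd_mul, snd_split_aL, C.split_ll_one_left,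
    C.split_ll_one_right, mul_one, one_mul] at e1 e2
  rw [e1, e2]

/-- The deviation of `hl` on the kernel of `F → Γ`. -/
noncomputable def linHl (c l : F) : C.Coeff := C.toCoeff (C.split.hl c (C.lift l)).2

/-- The deviation of `hl'` on the kernel of `F → Γ`. -/
noncomputable def linHl' (c l : F) : C.Coeff := C.toCoeff (C.split.hl' c (C.lift l)).2

/-- The deviation of `ll` on the kernel of `F → Γ`. -/
noncomputable def linLl (l k : F) : C.Coeff := C.toCoeff (C.split.ll (C.lift l) (C.lift k)).2

lemma linHl_dL (c : F) (n : N) : C.linHl c (C.P.dL n) = C.toCoeff (C.split.hl c n).2 :=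
  congrArg C.toCoeff (C.split_hl_congr c (C.dL_lift (C.P.dH_dL n)))

lemma linHl'_dL (c : F) (n : N) : C.linHl' c (C.P.dL n) = C.toCoeff (C.split.hl' c n).2 :=
  congrArg C.toCoeff (C.split_hl'_congr c (C.dL_lift (C.P.dH_dL n)))

lemma linLl_dL (n k : N) : C.linLl (C.P.dL n) (C.P.dL k) = C.toCoeff (C.split.ll n k).2 :=
  congrArg C.toCoeff (C.split_ll_congr (C.dL_lift (C.P.dH_dL n)) (C.dL_lift (C.P.dH_dL k)))

lemma linLl_mul_right (l k₂ k₁ : F) (hl : C.P.dH l = 1) (h₂ : C.P.dH k₂ = 1)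
    (h₁ : C.P.dH k₁ = 1) : C.linLl l (k₂ * k₁) = C.linLl l k₂ + C.linLl l k₁ := by
  obtain ⟨n, rfl⟩ := C.exists_dL l hl
  obtain ⟨n₂, rfl⟩ := C.exists_dL k₂ h₂
  obtain ⟨n₁, rfl⟩ := C.exists_dL k₁ h₁
  simpa [← map_mul, linLl_dL, ← toCoeff_mul] using
    congrArg C.toCoeff (C.lawful_snd.ll_mul_right n n₂ n₁)

lemma linLl_conj_right (l f k : F) (hl : C.P.dH l = 1) (hf : C.P.dH f = 1)
    (hk : C.P.dH k = 1) : C.linLl l (f * k * f⁻¹) = C.linLl l k := by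
  have h := C.linLl_mul_right l (f * k * f⁻¹) f hl (by simp [hk]) hf
  rw [inv_mul_cancel_right, C.linLl_mul_right l f k hl hf hk, add_comm] at h
  exact (add_right_cancel h).symm

lemma dL_pf' (c b : F) : C.P.dL (C.P.pf c b) = c * b * c⁻¹ * (C.P.dH c • b)⁻¹ := by
  rw [C.P.dL_pf, smul_inv']

/-- The deviation of the liftings of `T` from the liftings of the cover.  The functions `hl`, `hl'`
and `ll` on the kernel of `F → Γ` are well defined by `split_hl_congr`, `split_hl'_congr` and
`split_ll_congr`. -/
noncomputable def linear : LinearLiftings Γ F C.Coeff where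
  d := C.P.dH
  d_smul := C.P.dH_smul
  d_smul_A := C.dH_smul_toCoeff
  lhom c b a := C.toCoeff (C.split.lhom c b a).2
  rhom c b a := C.toCoeff (C.split.rhom c b a).2
  hl := C.linHl
  hl' := C.linHl'
  ll := C.linLl
  smul_lhom γ c b a := congrArg C.toCoeff (C.lawful_snd.smul_lhom γ c b a)
  smul_rhom γ c b a := congrArg C.toCoeff (C.lawful_snd.smul_rhom γ c b a)
  smul_hl γ c l hl := by
    obtain ⟨n, rfl⟩ := C.exists_dL l hl
    rw [← C.P.dL_smul, linHl_dL, linHl_dL]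
    exact congrArg C.toCoeff (C.lawful_snd.smul_hl γ c n)
  smul_hl' γ c l hl := by
    obtain ⟨n, rfl⟩ := C.exists_dL l hl
    rw [← C.P.dL_smul, linHl'_dL, linHl'_dL]
    exact congrArg C.toCoeff (C.lawful_snd.smul_hl' γ c n)
  smul_ll γ l k hl hk := by
    obtain ⟨n, rfl⟩ := C.exists_dL l hl
    obtain ⟨n', rfl⟩ := C.exists_dL k hk
    rw [← C.P.dL_smul, ← C.P.dL_smul, linLl_dL, linLl_dL]
    exact congrArg C.toCoeff (C.lawful_snd.smul_ll γ n n')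
  ll_conj f l k hl hk := by
    obtain ⟨n, rfl⟩ := C.exists_dL l hl
    obtain ⟨n', rfl⟩ := C.exists_dL k hk
    rw [← C.P.dL_smulH, ← C.P.dL_smulH, linLl_dL, linLl_dL]
    exact (congrArg C.toCoeff (C.lawful_snd.smulH_ll f n n')).symm
  ll_mul_left l₂ l₁ k h₂ h₁ hk := by
    rw [← C.linLl_conj_right l₂ l₁ k h₂ h₁ hk]
    obtain ⟨n, rfl⟩ := C.exists_dL k hk
    obtain ⟨n₂, rfl⟩ := C.exists_dL l₂ h₂
    obtain ⟨n₁, rfl⟩ := C.exists_dL l₁ h₁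
    rw [← C.P.dL_smulH, ← map_mul, linLl_dL, linLl_dL, linLl_dL, add_comm]
    exact congrArg C.toCoeff (C.lawful_snd.ll_mul_left n₂ n₁ n)
  ll_mul_right := C.linLl_mul_right
  hl_mul_left c b l hl := by
    obtain ⟨n, rfl⟩ := C.exists_dL l hl
    rw [← map_inv, linHl_dL, linHl_dL, linHl_dL]
    exact congrArg C.toCoeff (C.lawful_snd.hl_mul_left c b n)
  hl_mul_right c l₂ l₁ h₂ h₁ := by
    obtain ⟨n₂, rfl⟩ := C.exists_dL l₂ h₂
    obtain ⟨n₁, rfl⟩ := C.exists_dL l₁ h₁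
    have e : (C.P.dL n₂)⁻¹ * c * C.P.dL n₂ * c⁻¹ = C.P.dL (C.P.pf (C.P.dL n₂⁻¹) c) := by
      rw [C.dL_pf', C.P.dH_dL, one_smul, map_inv, inv_inv]
    rw [e, ← map_inv, ← map_inv, ← map_mul, linHl_dL, linHl_dL, linHl_dL, linLl_dL,
      sub_eq_add_neg]
    exact congrArg C.toCoeff (C.lawful_snd.hl_mul_right c n₂ n₁)
  hl'_mul_left c b l hl := by
    obtain ⟨n, rfl⟩ := C.exists_dL l hl
    rw [← map_inv, ← C.P.dL_smul, linHl'_dL, linHl'_dL, linHl'_dL]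
    exact congrArg C.toCoeff (C.lawful_snd.hl'_mul_left c b n)
  hl'_mul_right c l₂ l₁ h₂ h₁ := by
    obtain ⟨n₂, rfl⟩ := C.exists_dL l₂ h₂
    obtain ⟨n₁, rfl⟩ := C.exists_dL l₁ h₁
    rw [← map_inv, ← map_inv, ← map_mul, ← C.dL_pf', ← C.P.dL_smul, linHl'_dL, linHl'_dL,
      linHl'_dL, linLl_dL, sub_eq_add_neg]
    exact congrArg C.toCoeff (C.lawful_snd.hl'_mul_right c n₂ n₁)
  lhom_lhom e c b a := congrArg C.toCoeff (C.lawful_snd.lhom_lhom e c b a)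
  rhom_rhom e c b a := congrArg C.toCoeff (C.lawful_snd.rhom_rhom e c b a)
  lhom_rhom e c b a := by
    rw [← mul_smul, ← map_mul]
    have e2 : e * C.P.dH c • b * e⁻¹ * (C.P.dH (e * c) • b)⁻¹ =
      C.P.dL (C.P.pf e (C.P.dH c • b)) := by rw [C.dL_pf', map_mul, mul_smul]
    rw [e2, ← C.dL_pf', ← C.P.dL_smulH, linLl_dL]
    exact congrArg C.toCoeff (C.lawful_snd.lhom_rhom e c b a)
  yangBaxter c b a p q hp hq := by
    -- the whiskerings in the arguments of `ll` are removed by additivity in the first argument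
    have key (x y : N) : C.toCoeff (C.split.ll x (C.P.dL x⁻¹ • y)).2 =
        -C.toCoeff (C.split.ll x⁻¹ y).2 := by
      have h := congrArg C.toCoeff (C.lawful_snd.ll_mul_left x x⁻¹ y)
      have h1 := C.split_ll_one_left y 1
      rw [map_one] at h1
      rw [mul_inv_cancel] at h
      simp only [MonoidHom.coe_snd, Prod.snd_mul, snd_split_aL, h1, toCoeff_mul] at h
      exact eq_neg_of_add_eq_zero_right h.symm
    have h := congrArg C.toCoeff (C.lawful_snd.yangBaxter c b a)
    rw [← C.dL_pf'] at hp hq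
    rw [smul_inv' (C.P.dH c)] at h
    subst hp hq
    simp only [MonoidHom.coe_snd, Prod.snd_mul, Prod.snd_inv, snd_split_aL, toCoeff_mul,
      toCoeff_inv, key] at h
    rw [← C.dL_pf', ← C.dL_pf', ← map_inv, ← map_inv, ← C.P.dL_smul, linLl_dL, linLl_dL,
      linHl_dL, linHl'_dL, smul_inv']
    linear_combination (norm := abel) h
  ll_swap l k hl hk := by
    obtain ⟨n, rfl⟩ := C.exists_dL l hl
    obtain ⟨n', rfl⟩ := C.exists_dL k hk
    rw [← map_inv, ← map_inv, linHl_dL, linHl'_dL, linLl_dL, linLl_dL, sub_eq_add_neg]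
    exact congrArg C.toCoeff (C.lawful_snd.ll_swap n n')

end Cover
end ThreeCrossedModule

/-! ### The deviation of the 5-simplex identity -/

namespace ThreeCrossedModule

variable {G H L M : Type*} [Group G] [Group H] [Group L] [Group M]
  [MulDistribMulAction G H] [MulDistribMulAction G L] [MulDistribMulAction G M]
  [MulDistribMulAction H L] [MulDistribMulAction H M] [MulDistribMulAction L M]

namespace Cover

variable {T : ThreeCrossedModule G H L M} {Γ F N : Type*} [Group Γ] [Group F] [Group N]
    [MulDistribMulAction Γ F] [MulDistribMulAction Γ N] [MulDistribMulAction F N]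
    (C : T.Cover Γ F N)

lemma linear_d (f : F) : C.linear.d f = C.P.dH f := rfl
lemma linear_P (c b : F) : C.linear.P c b = C.P.dL (C.P.pf c b) := (C.dL_pf' c b).symm
lemma linear_lhom (c b a : F) :
    C.linear.lhom c b a = C.toCoeff (C.split.lhom c b a).2 := rfl
lemma linear_rhom (c b a : F) :
    C.linear.rhom c b a = C.toCoeff (C.split.rhom c b a).2 := rfl
lemma linear_hl (c : F) (n : N) :
    C.linear.hl c (C.P.dL n) = C.toCoeff (C.split.hl c n).2 := C.linHl_dL c n
lemma linear_hl' (c : F) (n : N) :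
    C.linear.hl' c (C.P.dL n) = C.toCoeff (C.split.hl' c n).2 := C.linHl'_dL c n
lemma linear_ll (l k : N) :
    C.linear.ll (C.P.dL l) (C.P.dL k) = C.toCoeff (C.split.ll l k).2 := C.linLl_dL l k

variable {C} {g : ℕ → ℕ → Γ} {h : ℕ → ℕ → ℕ → F} {l : ℕ → ℕ → ℕ → ℕ → N}
    {m : ℕ → ℕ → ℕ → ℕ → ℕ → M × T.dM.ker}

/-- The deviation from the 5-simplex identity is the abelian expression `omega`, minus the
alternating sum of the `4`-cells. -/
lemma toCoeff_five {w : ℕ → ℕ → ℕ → ℕ → ℕ → N} (c : C.P.Coherent 6 g h l w) {i j k p q x : ℕ}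
    (hij : i < j) (hjk : j < k) (hkp : k < p) (hpq : p < q) (hqx : q < x) (hx : x ≤ 6) :
    C.toCoeff (fiveLeft C.P C.split g h l m i j k p q x).2 -
        C.toCoeff (fiveRight C.P C.split g h l m i j k p q x).2 =
      C.linear.omega g h (fun i j k p => C.P.dL (l i j k p)) i j k p q x -
        (C.toCoeff (m j k p q x).2 - C.toCoeff (m i k p q x).2 + C.toCoeff (m i j p q x).2 -
          C.toCoeff (m i j k q x).2 + C.toCoeff (m i j k p x).2 -
          g q x • C.toCoeff (m i j k p q).2) := by
  have e1 : h k p x * h p q x * (h k q x * g q x • h k p q)⁻¹ = C.P.dL (l k p q x) := by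
    rw [← c.h_mul k p q x hkp hpq hqx hx, mul_assoc _ _ (g q x • _), mul_inv_cancel_right]
  have e2 : (g q x * g p q) • h i j p * (g q x * g p q) • h j k p *
      ((g q x * g p q) • h i k p * (g q x * g p q * g k p) • h i j k)⁻¹ =
      C.P.dL ((g q x * g p q) • l i j k p) := by
    rw [← smul_mul', ← c.h_mul i j k p hij hjk hkp (by lia), mul_smul (g q x * g p q) (g k p),
      ← smul_mul', ← smul_inv', ← smul_mul', mul_assoc _ _ (g k p • _), mul_inv_cancel_right,
      C.P.dL_smul]
  have e3 : C.P.dH (h k q x * g q x • h k p q) • (g q x * g p q * g k p) • h i j k =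
      g k x • h i j k := by
    rw [mul_smul, mul_smul, map_mul, mul_smul, c.dH_smul_smul' hkp hpq (by lia),
      c.dH_smul_smul (by lia) hqx hx]
  have e4 : C.P.dH (h p q x) • (g q x * g p q) • l i j k p = g p x • l i j k p := by
    rw [mul_smul, c.dH_smul_smul hpq hqx hx]
  have e5 : (g q x * g p q) • C.P.dL (l i j k p) = C.P.dL ((g q x * g p q) • l i j k p) :=
    (C.P.dL_smul _ _).symm
  have e6 : (g q x * g p q) • (h i k p * g k p • h i j k) =
      (g q x * g p q) • h i k p * (g q x * g p q * g k p) • h i j k := by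
    rw [smul_mul', smul_smul]
  simp only [LinearLiftings.omega, LinearLiftings.omegaLL, LinearLiftings.QL, LinearLiftings.QR,
    LinearLiftings.NL, LinearLiftings.NR, linear_d, linear_P, e1, e2, e3,
    ← C.P.dL_smulH, ← C.P.dL_smul, e4, ← map_inv C.P.dL, linear_ll, linear_hl, linear_hl',
    linear_lhom, linear_rhom]
  simp only [fiveLeft, fiveRight, fiveM1', fiveM2', fiveM3', fiveM4', fiveM5', fiveM6', fiveM7',
    fiveP7, fiveM8', fiveM9', fiveM10', fiveM11', fiveM12', fiveM13', fiveZ, fiveM1, fiveM2,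
    fiveM3, fiveM4, fiveM5, Prod.snd_mul, Prod.snd_inv, snd_split_aG, snd_split_aH, snd_split_aL,
    toCoeff_mul, toCoeff_inv, smul_toCoeff, e5, e6]
  have e7 (x y : N) : C.toCoeff (C.split.ll x y⁻¹).2 = -C.toCoeff (C.split.ll x y).2 := by
    rw [← linear_ll, ← linear_ll, map_inv]
    exact C.linear.ll_inv_right (C.P.dH_dL _) (C.P.dH_dL _)
  simp only [smul_inv', e7]
  abel

end Cover
end ThreeCrossedModule

/-! ### Lifting a 6-simplex to a cover -/

namespace ThreeCrossedModule

variable {G H L M : Type*} [Group G] [Group H] [Group L] [Group M]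
  [MulDistribMulAction G H] [MulDistribMulAction G L] [MulDistribMulAction G M]
  [MulDistribMulAction H L] [MulDistribMulAction H M] [MulDistribMulAction L M]

section

/-- The deviation of a tetrahedron of edges and triangles from commutativity. -/
def tetra (g : ℕ → ℕ → G) (h : ℕ → ℕ → ℕ → H) (i j k p : ℕ) : H :=
  h i j p * h j k p * (h i k p * g k p • h i j k)⁻¹

/-- The relation between the tetrahedra of a `4`-simplex. -/
lemma PeifferComplex.tetra_mul (P : PeifferComplex G H L) (g : ℕ → ℕ → G) (h : ℕ → ℕ → ℕ → H)
    (i j k p q : ℕ) (hg : g k q = P.dH (h k p q) * g p q * g k p) :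
    h i j q * tetra g h j k p q * (h i j q)⁻¹ * tetra g h i j p q *
        (h i p q * g p q • tetra g h i j k p * (h i p q)⁻¹) =
      tetra g h i j k q *
        (h i k q * P.dL (P.pf (h k p q) ((g p q * g k p) • h i j k))⁻¹ * (h i k q)⁻¹) *
        tetra g h i k p q := by
  have e : P.dH (h k p q) • g p q • g k p • h i j k = g k q • h i j k := by
    rw [hg, mul_smul, mul_smul]
  simp only [tetra, map_inv, P.dL_pf, smul_mul', smul_inv', mul_smul, e]
  group

variable {P : PeifferComplex G H L} {g : ℕ → ℕ → G} {h : ℕ → ℕ → ℕ → H}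
  {l : ℕ → ℕ → ℕ → ℕ → L}

lemma PeifferComplex.dL_eq_tetra {i j k p : ℕ}
    (e : P.dL (l i j k p) * h i k p * g k p • h i j k = h i j p * h j k p) :
    P.dL (l i j k p) = tetra g h i j k p := by
  rw [tetra, ← e, mul_assoc (P.dL _), mul_inv_cancel_right]

/-- The value of the `4`-cell forced by the tetrahedra. -/
def PeifferComplex.pentatope (P : PeifferComplex G H L) (g : ℕ → ℕ → G) (h : ℕ → ℕ → ℕ → H)
    (l : ℕ → ℕ → ℕ → ℕ → L) (i j k p q : ℕ) : L :=
  l i j k q * h i k q • (P.pf (h k p q) ((g p q * g k p) • h i j k))⁻¹ * l i k p q *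
    (h i j q • l j k p q * l i j p q * h i p q • g p q • l i j k p)⁻¹

lemma PeifferComplex.dL_pentatope {i j k p q : ℕ} (hg : g k q = P.dH (h k p q) * g p q * g k p)
    (h₁ : P.dL (l j k p q) = tetra g h j k p q) (h₂ : P.dL (l i j p q) = tetra g h i j p q)
    (h₃ : P.dL (l i j k p) = tetra g h i j k p) (h₄ : P.dL (l i j k q) = tetra g h i j k q)
    (h₅ : P.dL (l i k p q) = tetra g h i k p q) : P.dL (P.pentatope g h l i j k p q) = 1 := by
  rw [pentatope, map_mul, map_inv, mul_inv_eq_one]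
  simp only [map_mul, P.dL_smulH, P.dL_smul, h₁, h₂, h₃, h₄, h₅]
  exact (P.tetra_mul g h i j k p q hg).symm

end

namespace Cover

variable {T : ThreeCrossedModule G H L M} {Γ F N : Type*} [Group Γ] [Group F] [Group N]
    [MulDistribMulAction Γ F] [MulDistribMulAction Γ N] [MulDistribMulAction F N]
    (C : T.Cover Γ F N)

/-- A coloring of a `6`-simplex which satisfies the cocycle conditions lifts to the cover, with its
`4`-cells decomposed into those forced by the tetrahedra and elements of the kernel of
`∂ : M → L`. -/
theorem exists_lift {g : ℕ → ℕ → G} {h : ℕ → ℕ → ℕ → H} {l : ℕ → ℕ → ℕ → ℕ → L}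
    {m : ℕ → ℕ → ℕ → ℕ → ℕ → M}
    (c : T.peiffer.Coherent 6 g h l (fun i j k p q => T.dM (m i j k p q))) :
    ∃ (g' : ℕ → ℕ → Γ) (h' : ℕ → ℕ → ℕ → F) (l' : ℕ → ℕ → ℕ → ℕ → N)
      (m' : ℕ → ℕ → ℕ → ℕ → ℕ → M × T.dM.ker),
      C.P.Coherent 6 g' h' l' (fun i j k p q => C.ι (m' i j k p q).1) ∧
      (∀ i j, i < j → j ≤ 6 → C.φG (g' i j) = g i j) ∧
      (∀ i j k, i < j → j < k → k ≤ 6 → C.φH (h' i j k) = h i j k) ∧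
      (∀ i j k p, i < j → j < k → k < p → p ≤ 6 → C.φL (l' i j k p) = l i j k p) ∧
      (∀ i j k p q, i < j → j < k → k < p → p < q → q ≤ 6 →
        T.mulKer (m' i j k p q) = m i j k p q) := by
  classical
  have sG := Function.surjInv_eq C.surjective_φG
  have sH := Function.surjInv_eq C.surjective_φH
  have sL := Function.surjInv_eq C.surjective_φL
  -- the edges, triangles and tetrahedra with last vertex `6` are lifted arbitrarily
  obtain ⟨p, hp6, hp⟩ : ∃ p : ℕ → Γ, p 6 = 1 ∧ ∀ i, i < 6 → C.φG (p i) = g i 6 :=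
    ⟨fun i => if i = 6 then 1 else Function.surjInv C.surjective_φG (g i 6), by simp,
      fun i hi => by simp [hi.ne, sG]⟩
  obtain ⟨q, hq6, hq⟩ : ∃ q : ℕ → ℕ → F, (∀ i, q i 6 = 1) ∧
      ∀ i j, j < 6 → C.φH (q i j) = h i j 6 :=
    ⟨fun i j => if j = 6 then 1 else Function.surjInv C.surjective_φH (h i j 6), by simp,
      fun i j hi => by simp [hi.ne, sH]⟩
  obtain ⟨n, hn6, hn⟩ : ∃ n : ℕ → ℕ → ℕ → N, (∀ i j, n i j 6 = 1) ∧
      ∀ i j k, k < 6 → C.φL (n i j k) = l i j k 6 :=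
    ⟨fun i j k => if k = 6 then 1 else Function.surjInv C.surjective_φL (l i j k 6), by simp,
      fun i j k hi => by simp [hi.ne, sL]⟩
  -- the other edges, triangles and tetrahedra are determined by the cocycle conditions
  let g' : ℕ → ℕ → Γ := fun i j => (p j)⁻¹ * (C.P.dH (q i j))⁻¹ * p i
  let w : ℕ → ℕ → ℕ → F := fun i j k => (q i k)⁻¹ * (C.P.dL (n i j k))⁻¹ * q i j * q j k
  let h' : ℕ → ℕ → ℕ → F := fun i j k => (p k)⁻¹ • w i j k
  let l' : ℕ → ℕ → ℕ → ℕ → N := fun i j k r => if r = 6 then n i j k else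
    (p r)⁻¹ • (q i r)⁻¹ • ((C.ι (m i j k r 6) * q i j • n j k r * n i j r)⁻¹ *
      (n i j k * q i k • (C.P.pf (q k r) ((p r * g' k r) • h' i j k))⁻¹ * n i k r))
  have g6 (i : ℕ) : g' i 6 = p i := by simp [g', hp6, hq6]
  have h6 (i j : ℕ) : h' i j 6 = q i j := by simp [h', w, hp6, hq6, hn6]
  have l6 (i j k : ℕ) : l' i j k 6 = n i j k := if_pos rfl
  have hg (i j k : ℕ) : g' i k = C.P.dH (h' i j k) * g' j k * g' i j := by
    simp only [g', h', w, C.P.dH_smul, map_mul, map_inv, C.P.dH_dL]; group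
  have φg (i j : ℕ) (hij : i < j) (hj : j ≤ 6) : C.φG (g' i j) = g i j := by
    obtain rfl | hj := hj.eq_or_lt
    · rw [g6, hp i hij]
    · have e := c.g_mul i j 6 hij hj le_rfl
      simp only [g', map_mul, map_inv, C.isHom.dH, hp _ hj, hp _ (hij.trans hj), hq i j hj, e]
      group
  have φh (i j k : ℕ) (hij : i < j) (hjk : j < k) (hk : k ≤ 6) :
      C.φH (h' i j k) = h i j k := by
    obtain rfl | hk := hk.eq_or_lt
    · rw [h6, hq i j hjk]
    · have e := c.h_mul i j k 6 hij hjk hk le_rfl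
      simp only [h', w, C.isHom.smul_H, map_mul, map_inv, C.isHom.dL, hp _ hk, hq _ _ hk,
        hq i j (hjk.trans hk), hn _ _ _ hk]
      rw [inv_smul_eq_iff, mul_assoc _ (h i j 6), ← e]
      group
  have hy (i j k r : ℕ) : (p r * g' k r) • h' i j k = (C.P.dH (q k r))⁻¹ • w i j k := by
    simp only [g', h', smul_smul]; congr 1; group
  have hl (i j k r : ℕ) (hr : r ≤ 6) : C.P.dL (l' i j k r) = tetra g' h' i j k r := by
    obtain rfl | hr := hr.eq_or_lt
    · simp only [l6, tetra, h6, g6, h', smul_inv_smul, w]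
      group
    · have e1 : g' k r • h' i j k = (p r)⁻¹ • (C.P.dH (q k r))⁻¹ • w i j k :=
        eq_inv_smul_iff.mpr ((mul_smul _ _ _).symm.trans (hy i j k r))
      simp only [l', if_neg hr.ne, tetra, e1, C.P.dL_smul, C.P.dL_smulH, map_mul, map_inv, hy,
        C.P.dL_pf, smul_inv', smul_inv_smul, C.dL_ι]
      simp only [h', ← smul_mul', ← smul_inv', w]
      congr 1
      group
  have φl (i j k r : ℕ) (hij : i < j) (hjk : j < k) (hkr : k < r) (hr : r ≤ 6) :
      C.φL (l' i j k r) = l i j k r := by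
    obtain rfl | hr := hr.eq_or_lt
    · rw [l6, hn i j k hkr]
    · have e := c.l_mul i j k r 6 hij hjk hkr hr le_rfl
      simp only [l', if_neg hr.ne, C.isHom.smul_L, C.isHom.smulH_L, map_mul, map_inv, C.isHom.pf,
        C.isHom.smul_H, hp r hr, hq _ _ hr, φg k r hkr hr.le, φh i j k hij hjk (hkr.trans hr).le,
        hn _ _ _ hr, hq i j (by lia), hq i k (by lia), hn i j k (by lia), C.φL_ι]
      rw [inv_smul_eq_iff, inv_smul_eq_iff, inv_mul_eq_iff_eq_mul]
      exact e.symm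
  clear_value l' h' w g'
  -- the 4-cells are those of the cover, up to the kernel of `∂ : M → L`
  let x : ℕ → ℕ → ℕ → ℕ → ℕ → M := fun i j k r s =>
    Function.invFun C.ι (C.P.pentatope g' h' l' i j k r s)
  have hx (i j k r s : ℕ) (hr : r ≤ 6) (hs : s ≤ 6) :
      C.ι (x i j k r s) = C.P.pentatope g' h' l' i j k r s :=
    C.ι_invFun (PeifferComplex.dL_pentatope (hg _ _ _) (hl _ _ _ _ hs) (hl _ _ _ _ hs)
      (hl _ _ _ _ hr) (hl _ _ _ _ hs) (hl _ _ _ _ hs))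
  clear_value x
  have φx (i j k r s : ℕ) (hij : i < j) (hjk : j < k) (hkr : k < r) (hrs : r < s)
      (hs : s ≤ 6) : T.dM (x i j k r s) = T.dM (m i j k r s) := by
    rw [← C.φL_ι, hx _ _ _ _ _ (by lia) hs, c.m_eq hij hjk hkr hrs hs]
    rw [PeifferComplex.pentatope]
    simp only [map_mul, map_inv, C.isHom.smul_L, C.isHom.smulH_L, C.isHom.pf, C.isHom.smul_H]
    rw [φl i j k s, φl i k r s, φl j k r s, φl i j r s, φl i j k r, φh i k s, φh k r s, φh i j k,
      φh i j s, φh i r s, φg r s, φg k r]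
    all_goals lia
  refine ⟨g', h', l', fun i j k r s => (x i j k r s,
    if hm : T.dM (x i j k r s) = T.dM (m i j k r s) then diff _ _ hm else 1), ⟨?_, ?_, ?_⟩, φg, φh,
    φl, ?_⟩
  · exact fun i j k _ _ _ => hg i j k
  · intro i j k r _ _ _ hr
    rw [hl i j k r hr, tetra, mul_assoc, inv_mul_cancel_right]
  · intro i j k r s hij hjk hkr hrs hs
    rw [hx _ _ _ _ _ (by lia) hs, PeifferComplex.pentatope]
    group
  · intro i j k r s hij hjk hkr hrs hs
    dsimp only
    rw [mulKer_apply, dif_pos (φx i j k r s hij hjk hkr hrs hs)]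
    exact mul_inv_cancel_left _ _

end Cover
end ThreeCrossedModule

/-! ### The last face of a 6-simplex -/

namespace ThreeCrossedModule

section

variable {G H L M : Type*} [Group G] [Group H] [Group L] [Group M]
    [MulDistribMulAction G H] [MulDistribMulAction G L] [MulDistribMulAction H L]
    (P : PeifferComplex G H L) (o : Liftings G H L M) {n : ℕ}
    {g g' : ℕ → ℕ → G} {h h' : ℕ → ℕ → ℕ → H} {l l' : ℕ → ℕ → ℕ → ℕ → L}
    {m m' : ℕ → ℕ → ℕ → ℕ → ℕ → M}

/-- The two sides of the `5`-simplex identity only depend on the faces of the simplex. -/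
lemma five_congr (hg : ∀ i j, i < j → j ≤ n → g i j = g' i j)
    (hh : ∀ i j k, i < j → j < k → k ≤ n → h i j k = h' i j k)
    (hl : ∀ i j k p, i < j → j < k → k < p → p ≤ n → l i j k p = l' i j k p)
    {i j k p q x : ℕ}
    (hm : ∀ a b c d e, i ≤ a → a < b → b < c → c < d → d < e → e ≤ x →
      m a b c d e = m' a b c d e)
    (hij : i < j) (hjk : j < k) (hkp : k < p) (hpq : p < q) (hqx : q < x) (hx : x ≤ n) :
    fiveLeft P o g h l m i j k p q x = fiveLeft P o g' h' l' m' i j k p q x ∧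
      fiveRight P o g h l m i j k p q x = fiveRight P o g' h' l' m' i j k p q x := by
  constructor
  · simp only [fiveLeft, fiveM1, fiveM2, fiveM3, fiveM4, fiveM5, fiveLA, fiveLB, fiveLC, fiveLD,
      fiveLE, fiveLF]
    simp (disch := lia) only [hg, hh, hl, hm]
  · simp only [fiveRight, fiveM1', fiveM2', fiveM3', fiveM4', fiveM5', fiveM6', fiveM7', fiveP7,
      fiveM8', fiveM9', fiveM10', fiveM11', fiveM12', fiveM13', fiveZ, fiveLA, fiveLB, fiveLD,
      fiveLG, fiveLH, fiveLI, fiveLJ, fiveLL, fiveLM, fiveLN]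
    simp (disch := lia) only [hg, hh, hl, hm]

end

variable {G H L M : Type*} [Group G] [Group H] [Group L] [Group M]
  [MulDistribMulAction G H] [MulDistribMulAction G L] [MulDistribMulAction G M]
  [MulDistribMulAction H L] [MulDistribMulAction H M] [MulDistribMulAction L M]

namespace Cover

variable {T : ThreeCrossedModule G H L M} {Γ F N : Type*} [Group Γ] [Group F] [Group N]
    [MulDistribMulAction Γ F] [MulDistribMulAction Γ N] [MulDistribMulAction F N]
    (C : T.Cover Γ F N)

/-- The deviation from the 5-simplex identity, an element of the kernel of `∂ : M → L`. -/
noncomputable def dev (g : ℕ → ℕ → Γ) (h : ℕ → ℕ → ℕ → F) (l : ℕ → ℕ → ℕ → ℕ → N)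
    (m : ℕ → ℕ → ℕ → ℕ → ℕ → M × T.dM.ker) (i j k p q x : ℕ) : C.Coeff :=
  C.toCoeff (fiveLeft C.P C.split g h l m i j k p q x).2 -
    C.toCoeff (fiveRight C.P C.split g h l m i j k p q x).2

/-- In the cover the 5-simplex identity holds automatically, so that it holds in `T` if and only if
the deviation vanishes. -/
lemma five_iff_dev {g : ℕ → ℕ → Γ} {h : ℕ → ℕ → ℕ → F} {l : ℕ → ℕ → ℕ → ℕ → N}
    {m : ℕ → ℕ → ℕ → ℕ → ℕ → M × T.dM.ker}
    (c : C.P.Coherent 6 g h l (fun i j k p q => C.ι (m i j k p q).1)) {i j k p q x : ℕ}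
    (hij : i < j) (hjk : j < k) (hkp : k < p) (hpq : p < q) (hqx : q < x) (hx : x ≤ 6) :
    T.mulKer (fiveLeft C.P C.split g h l m i j k p q x) =
        T.mulKer (fiveRight C.P C.split g h l m i j k p q x) ↔
      C.dev g h l m i j k p q x = 0 := by
  have e : C.ι (fiveLeft C.P C.split g h l m i j k p q x).1 =
      C.ι (fiveRight C.P C.split g h l m i j k p q x).1 :=
    (C.isHom_fst.map_fiveLeft g h l m i j k p q x).trans <|
      (c.fiveLeft_eq_fiveRight hij hjk hkp hpq hqx hx).trans
        (C.isHom_fst.map_fiveRight g h l m i j k p q x).symm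
  rw [dev, sub_eq_zero, C.toCoeff_injective.eq_iff]
  refine ⟨C.eq_snd _ _ e, fun h2 => ?_⟩
  rw [mulKer_apply, mulKer_apply, h2, C.injective_ι e]

/-- The deviations on the seven faces of a `6`-simplex add up to zero: the `4`-cells cancel in
pairs, and the rest is `LinearLiftings.Coherent.omega_eq_zero`. -/
lemma dev_sum {g : ℕ → ℕ → Γ} {h : ℕ → ℕ → ℕ → F} {l : ℕ → ℕ → ℕ → ℕ → N}
    {m : ℕ → ℕ → ℕ → ℕ → ℕ → M × T.dM.ker}
    (c : C.P.Coherent 6 g h l (fun i j k p q => C.ι (m i j k p q).1)) :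
    C.dev g h l m 1 2 3 4 5 6 - C.dev g h l m 0 2 3 4 5 6 + C.dev g h l m 0 1 3 4 5 6
      - C.dev g h l m 0 1 2 4 5 6 + C.dev g h l m 0 1 2 3 5 6 - C.dev g h l m 0 1 2 3 4 6
      + g 5 6 • C.dev g h l m 0 1 2 3 4 5 = 0 := by
  have cl : C.linear.Coherent g h (fun i j k p => C.P.dL (l i j k p)) := ⟨c.g_mul, c.h_mul⟩
  have e := cl.omega_eq_zero
  have e1 : g 4 6 • C.toCoeff (m 0 1 2 3 4).2 = g 5 6 • g 4 5 • C.toCoeff (m 0 1 2 3 4).2 := by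
    rw [c.g_mul 4 5 6 (by simp) (by simp) le_rfl, mul_smul, mul_smul, dH_smul_toCoeff]
  simp only [dev]
  rw [toCoeff_five c, toCoeff_five c, toCoeff_five c, toCoeff_five c, toCoeff_five c,
    toCoeff_five c, toCoeff_five c]
  · simp only [smul_sub, smul_add, e1]
    rw [← e]
    abel
  all_goals simp

/-- If the 5-simplex identity holds for all faces of a `6`-simplex which contain the vertex `r`,
then it holds for the face opposite to `r`. -/
theorem five_of_horn (C : T.Cover Γ F N) {g : ℕ → ℕ → G} {h : ℕ → ℕ → ℕ → H} {l : ℕ → ℕ → ℕ → ℕ → L}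
    {m : ℕ → ℕ → ℕ → ℕ → ℕ → M}
    (c : T.peiffer.Coherent 6 g h l (fun i j k p q => T.dM (m i j k p q))) {r : ℕ}
    (hr6 : r ≤ 6)
    (hr : ∀ i j k p q x, i < j → j < k → k < p → p < q → q < x → x ≤ 6 →
      (r = i ∨ r = j ∨ r = k ∨ r = p ∨ r = q ∨ r = x) →
      fiveLeft T.peiffer T.liftings g h l m i j k p q x =
        fiveRight T.peiffer T.liftings g h l m i j k p q x)
    {i j k p q x : ℕ} (hij : i < j) (hjk : j < k) (hkp : k < p) (hpq : p < q) (hqx : q < x)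
    (hx : x ≤ 6) :
    fiveLeft T.peiffer T.liftings g h l m i j k p q x =
      fiveRight T.peiffer T.liftings g h l m i j k p q x := by
  by_cases hmem : r = i ∨ r = j ∨ r = k ∨ r = p ∨ r = q ∨ r = x
  · exact hr i j k p q x hij hjk hkp hpq hqx hx hmem
  obtain ⟨g', h', l', m', c', eg, eh, el, em⟩ := C.exists_lift c
  have key (i j k p q x : ℕ) (hij : i < j) (hjk : j < k) (hkp : k < p) (hpq : p < q)
      (hqx : q < x) (hx : x ≤ 6) : fiveLeft T.peiffer T.liftings g h l m i j k p q x =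
        fiveRight T.peiffer T.liftings g h l m i j k p q x ↔
      C.dev g' h' l' m' i j k p q x = 0 := by
    rw [← C.five_iff_dev c' hij hjk hkp hpq hqx hx, C.isHom_mulKer.map_fiveLeft,
      C.isHom_mulKer.map_fiveRight]
    have e := five_congr T.peiffer T.liftings eg eh el (i := i) (j := j) (k := k) (p := p)
      (q := q) (x := x) (m := fun i j k p q => T.mulKer (m' i j k p q)) (m' := m)
      (fun a b c d e _ h1 h2 h3 h4 h5 => em a b c d e h1 h2 h3 h4 (h5.trans hx))
      hij hjk hkp hpq hqx hx
    rw [← e.1, ← e.2]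
  have hsum := C.dev_sum c'
  have h0 (i j k p q x : ℕ) (hij : i < j) (hjk : j < k) (hkp : k < p) (hpq : p < q)
      (hqx : q < x) (hx : x ≤ 6) (hm : r = i ∨ r = j ∨ r = k ∨ r = p ∨ r = q ∨ r = x) :
      C.dev g' h' l' m' i j k p q x = 0 :=
    (key i j k p q x hij hjk hkp hpq hqx hx).mp (hr i j k p q x hij hjk hkp hpq hqx hx hm)
  rw [key i j k p q x hij hjk hkp hpq hqx hx]
  -- the remaining face is the one opposite to `r`
  push Not at hmem
  obtain rfl : i = if r ≤ 0 then 1 else 0 := by split_ifs <;> lia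
  obtain rfl : j = if r ≤ 1 then 2 else 1 := by split_ifs <;> lia
  obtain rfl : k = if r ≤ 2 then 3 else 2 := by split_ifs <;> lia
  obtain rfl : p = if r ≤ 3 then 4 else 3 := by split_ifs <;> lia
  obtain rfl : q = if r ≤ 4 then 5 else 4 := by split_ifs <;> lia
  obtain rfl : x = if r ≤ 5 then 6 else 5 := by split_ifs <;> lia
  clear hij hjk hkp hpq hqx hx hmem
  interval_cases r <;> simpa [h0, smul_eq_zero_iff_eq] using hsum

end Cover
end ThreeCrossedModule

/-! ### 2-crossed modules -/

namespace ThreeCrossedModule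

section strict

variable {G H Q : Type*} [Group G] [Group H] [Group Q]
  [MulDistribMulAction G H] [MulDistribMulAction G Q] [MulDistribMulAction H Q]

/-- The axioms of a 2-crossed module, beyond those of a complex with a Peiffer lifting. -/
structure PeifferComplex.IsTwoCrossed (P : PeifferComplex G H Q) : Prop where
  dL_smul' : ∀ l l' : Q, P.dL l • l' = l * l' * l⁻¹
  pf_mul_left : ∀ h₃ h₂ h₁ : H, P.pf (h₃ * h₂) h₁ = h₃ • P.pf h₂ h₁ * P.pf h₃ (P.dH h₂ • h₁)
  pf_mul_right : ∀ h₃ h₂ h₁ : H, P.pf h₃ (h₂ * h₁) = P.pf h₃ h₂ * (P.dH h₃ • h₂) • P.pf h₃ h₁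
  smul_eq : ∀ (h : H) (l : Q), h • l = l * P.pf (P.dL l⁻¹) h
  dH_smul_eq : ∀ (h : H) (l : Q), P.dH h • l = h • l * P.pf h (P.dL l⁻¹)

variable (G H) in
/-- The semidirect product `H ⋊ G`. -/
abbrev Base := SemidirectProduct H G (MulDistribMulAction.toMulAut G H)

variable (H Q) in
/-- The semidirect product `Q ⋊ H`. -/
abbrev Total := SemidirectProduct Q H (MulDistribMulAction.toMulAut H Q)

namespace PeifferComplex.IsTwoCrossed

variable {P : PeifferComplex G H Q} (w : P.IsTwoCrossed)

lemma pf_one_left (w : P.IsTwoCrossed) (h : H) : P.pf 1 h = 1 := by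
  have := w.pf_mul_left 1 1 h
  simpa using this

lemma pf_one_right (w : P.IsTwoCrossed) (h : H) : P.pf h 1 = 1 := by
  have := w.pf_mul_right h 1 1
  simpa using this

lemma pf_mul_smul (w : P.IsTwoCrossed) (h y : H) (l : Q) :
    P.pf h y * (P.dH h • y) • h • l = h • y • l * P.pf h y := by
  have := w.dL_smul' (P.pf h y) ((P.dH h • y) • h • l)
  rw [P.dL_pf] at this
  rw [← mul_inv_eq_iff_eq_mul, ← this, ← mul_smul, ← mul_smul, ← mul_smul]
  congr 1
  rw [smul_inv']; group

/-- The action of `H ⋊ G` on `Q ⋊ H` in which `H` acts through the Peiffer lifting. -/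
abbrev action : MulDistribMulAction (Base G H) (Total H Q) where
  smul e k := ⟨e.left • e.right • k.left * P.pf e.left (e.right • k.right),
    P.dH e.left • e.right • k.right⟩
  one_smul k := SemidirectProduct.ext
    (show (1 : H) • (1 : G) • k.left * P.pf 1 ((1 : G) • k.right) = k.left by
      rw [w.pf_one_left, one_smul, one_smul, mul_one])
    (show P.dH 1 • (1 : G) • k.right = k.right by rw [map_one, one_smul, one_smul])
  mul_smul a b k := SemidirectProduct.ext
    (show (a.left * a.right • b.left) • (a.right * b.right) • k.left *
        P.pf (a.left * a.right • b.left) ((a.right * b.right) • k.right) =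
      a.left • a.right • (b.left • b.right • k.left * P.pf b.left (b.right • k.right)) *
        P.pf a.left (a.right • P.dH b.left • b.right • k.right) by
      rw [w.pf_mul_left, P.dH_smul, smul_mul', smul_mul', P.smul_smulH, P.smul_pf]
      simp only [mul_smul, inv_smul_smul, mul_assoc])
    (show P.dH (a.left * a.right • b.left) • (a.right * b.right) • k.right =
        P.dH a.left • a.right • P.dH b.left • b.right • k.right by
      rw [map_mul, P.dH_smul]
      simp only [mul_smul, inv_smul_smul])
  smul_one e := SemidirectProduct.ext
    (show e.left • e.right • (1 : Q) * P.pf e.left (e.right • (1 : H)) = 1 by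
      rw [smul_one, smul_one, smul_one, w.pf_one_right, one_mul])
    (show P.dH e.left • e.right • (1 : H) = 1 by rw [smul_one, smul_one])
  smul_mul e a b := SemidirectProduct.ext
    (show e.left • e.right • (a.left * a.right • b.left) *
        P.pf e.left (e.right • (a.right * b.right)) =
      (e.left • e.right • a.left * P.pf e.left (e.right • a.right)) *
        (P.dH e.left • e.right • a.right) •
          (e.left • e.right • b.left * P.pf e.left (e.right • b.right)) by
      rw [smul_mul' e.right, smul_mul' e.left, smul_mul' e.right, w.pf_mul_right, smul_mul',
        mul_assoc, mul_assoc, ← mul_assoc (P.pf _ _) (_ • _ • _ • _), w.pf_mul_smul, P.smul_smulH]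
      simp only [mul_assoc])
    (show P.dH e.left • e.right • (a.right * b.right) =
      (P.dH e.left • e.right • a.right) * (P.dH e.left • e.right • b.right) by
      rw [smul_mul', smul_mul'])

variable (P) in
/-- The boundary `Q ⋊ H → H ⋊ G`. -/
def boundary : Total H Q →* Base G H :=
  SemidirectProduct.inl.comp (SemidirectProduct.lift P.dL (MonoidHom.id H) fun h =>
    MonoidHom.ext fun l => P.dL_smulH h l)

variable (P) in
/-- The projection `H ⋊ G → G`. -/
def toG : Base G H →* G :=
  SemidirectProduct.lift P.dH (MonoidHom.id G) fun g => MonoidHom.ext fun h => P.dH_smul g h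

lemma boundary_apply (k : Total H Q) :
    boundary P k = SemidirectProduct.inl (P.dL k.left * k.right) := rfl

lemma toG_apply (e : Base G H) : toG P e = P.dH e.left * e.right := rfl

lemma toG_boundary (k : Total H Q) : toG P (boundary P k) = P.dH k.right := by
  simp [boundary_apply, toG_apply, P.dH_dL]

lemma right_smul (e : Base G H) (k : Total H Q) : letI := w.action
    (e • k).right = toG P e • k.right := by
  rw [toG_apply, mul_smul]; rfl

lemma boundary_smul (e : Base G H) (k : Total H Q) : letI := w.action
    boundary P (e • k) = e * boundary P k * e⁻¹ := by
  let := w.action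
  have h : P.dL (e.left • e.right • k.left * P.pf e.left (e.right • k.right)) *
      P.dH e.left • e.right • k.right =
      e.left * e.right • (P.dL k.left * k.right) * e.left⁻¹ := by
    rw [map_mul, P.dL_pf, P.dL_smulH, P.dL_smul, smul_mul', smul_inv']
    group
  refine (congrArg SemidirectProduct.inl h).trans ?_
  rw [boundary_apply]
  ext <;> simp [mul_assoc]

/-- The kernel of the boundary is identified with `Q`, by `k ↦ k.left⁻¹`. -/
lemma right_of_boundary {k : Total H Q} (h : boundary P k = 1) : k.right = P.dL k.left⁻¹ := by
  have := congrArg SemidirectProduct.left h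
  rw [boundary_apply, SemidirectProduct.left_inl] at this
  rw [map_inv]
  exact eq_inv_of_mul_eq_one_right this

lemma left_mul (w : P.IsTwoCrossed) {a b : Total H Q} (ha : boundary P a = 1) :
    (a * b).left = b.left * a.left := by
  change a.left * a.right • b.left = _
  rw [right_of_boundary ha, w.dL_smul']
  group

lemma left_smul {k : Total H Q} (h : boundary P k = 1) (e : Base G H) : letI := w.action
    (e • k).left = toG P e • k.left := by
  let := w.action
  change e.left • e.right • k.left * P.pf e.left (e.right • k.right) = _
  rw [toG_apply, mul_smul, right_of_boundary h, w.dH_smul_eq, ← P.dL_smul, smul_inv']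

lemma left_conj (w : P.IsTwoCrossed) {k : Total H Q} (h : boundary P k = 1) (y : Total H Q) :
    (y * k * y⁻¹).left = y.right • k.left := by
  change y.left * y.right • k.left * (y.right * k.right) • y.right⁻¹ • y.left⁻¹ = _
  rw [← mul_smul, right_of_boundary h, ← P.dL_smulH, w.dL_smul', smul_inv']
  group

lemma pf_dL (w : P.IsTwoCrossed) (l : Q) (h : H) : P.pf (P.dL l) h = l * h • l⁻¹ := by
  rw [w.smul_eq, inv_inv, mul_inv_cancel_left]

/-- The Peiffer commutators of `Q ⋊ H → H ⋊ G` are given by the Peiffer lifting; this explains the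
choice of the action. -/
lemma left_peiffer (a b : Total H Q) : letI := w.action
    (a * b * a⁻¹ * (boundary P a • b)⁻¹).left = (P.pf a.right b.right)⁻¹ := by
  let := w.action
  let y : Total H Q := ⟨(P.pf a.right b.right)⁻¹, P.dL (P.pf a.right b.right)⟩
  have hd : P.dH (P.dL a.left * a.right) = P.dH a.right := by rw [map_mul, P.dH_dL, one_mul]
  have h₁ : (boundary P a • b).left = a.left * a.right • b.left * P.pf a.right b.right *
      (P.dH a.right • b.right) • a.left⁻¹ := by
    change (P.dL a.left * a.right) • (1 : G) • b.left *
      P.pf (P.dL a.left * a.right) ((1 : G) • b.right) = _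
    rw [one_smul, one_smul, mul_smul, w.pf_mul_left, w.dL_smul', w.dL_smul', w.pf_dL]
    group
  have h₂ : (boundary P a • b).right = P.dH a.right • b.right := by
    change P.dH (P.dL a.left * a.right) • (1 : G) • b.right = _
    rw [hd, one_smul]
  have h : a * b * a⁻¹ * (boundary P a • b)⁻¹ = y := by
    rw [mul_inv_eq_iff_eq_mul, mul_inv_eq_iff_eq_mul]
    refine SemidirectProduct.ext ?_ ?_
    · change a.left * a.right • b.left =
        ((P.pf a.right b.right)⁻¹ * P.dL (P.pf a.right b.right) • (boundary P a • b).left) *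
          (P.dL (P.pf a.right b.right) * (boundary P a • b).right) • a.left
      rw [h₁, h₂, mul_smul, w.dL_smul', w.dL_smul', smul_inv']
      group
    · change a.right * b.right = P.dL (P.pf a.right b.right) * (boundary P a • b).right * a.right
      rw [h₂, P.dL_pf, smul_inv']
      group
  rw [h]

end PeifferComplex.IsTwoCrossed
end strict
end ThreeCrossedModule

/-! ### Resolutions of 2-crossed modules by free groups -/

section free

/-- A homomorphism from a free group lifts along any homomorphism whose range contains its image. -/
lemma IsFreeGroup.exists_comp_eq {A B C : Type*} [Group A] [IsFreeGroup A] [Group B] [Group C]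
    (p : B →* C) (f : A →* C) (h : ∀ a, ∃ b, p b = f a) : ∃ t : A →* B, ∀ a, p (t a) = f a := by
  choose b hb using h
  refine ⟨IsFreeGroup.lift fun x => b (IsFreeGroup.of x), fun a => DFunLike.congr_fun
    (IsFreeGroup.ext_hom fun x => ?_ :
      p.comp (IsFreeGroup.lift fun x => b (IsFreeGroup.of x)) = f) a⟩
  rw [MonoidHom.comp_apply, IsFreeGroup.lift_of, hb]

namespace FreeGroup

/-- The left translation action of a group `Γ` on the free group on `Γ × X`. -/
instance translation {Γ X : Type*} [Group Γ] : MulDistribMulAction Γ (FreeGroup (Γ × X)) where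
  smul γ f := map (fun a => (γ * a.1, a.2)) f
  one_smul f := by
    change map _ f = f
    simp
  mul_smul γ δ f := by
    change map _ f = map _ (map _ f)
    rw [map.comp]
    congr 2
    funext a
    simp [mul_assoc]
  smul_mul γ := map_mul _
  smul_one γ := map_one _

lemma smul_def {Γ X : Type*} [Group Γ] (γ : Γ) (f : FreeGroup (Γ × X)) :
    γ • f = map (fun a => (γ * a.1, a.2)) f := rfl

@[simp] lemma smul_of {Γ X : Type*} [Group Γ] (γ : Γ) (a : Γ × X) :
    γ • of a = of (γ * a.1, a.2) := map.of

open Classical in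
/-- The group component of the first letter of a reduced word in `Γ × X`. -/
noncomputable def first {Γ X : Type*} [Group Γ] (f : FreeGroup (Γ × X)) : Γ :=
  (f.toWord.head?.map fun a => a.1.1).getD 1

/-- The group `Γ` acts freely on nontrivial words, with `first` as an equivariant map to `Γ`. -/
lemma first_smul {Γ X : Type*} [Group Γ] (γ : Γ) {f : FreeGroup (Γ × X)} (hf : f ≠ 1) :
    (γ • f).first = γ * f.first := by
  classical
  have h : (γ • f).toWord = f.toWord.map fun a => ((γ * a.1.1, a.1.2), a.2) := by
    conv_lhs => rw [smul_def, ← mk_toWord (x := f), map.mk, toWord_mk]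
    refine IsReduced.reduce_eq ?_
    rw [IsReduced, List.isChain_map]
    refine (isReduced_toWord (x := f)).imp fun a b hab h => hab ?_
    simpa [Prod.ext_iff] using h
  have hf' : f.toWord ≠ [] := fun h => hf (toWord_eq_nil_iff.mp h)
  obtain ⟨a, u, hu⟩ := List.exists_cons_of_ne_nil hf'
  rw [first, first, h, hu]
  simp

end FreeGroup
end free

namespace ThreeCrossedModule
namespace PeifferComplex

variable {G H Q L : Type*} [Group G] [Group H] [Group Q] [Group L]
  [MulDistribMulAction G H] [MulDistribMulAction G Q] [MulDistribMulAction H Q]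

/-- A precrossed module `d : F → Γ` over `∂ : H → G`, with a homomorphism from its kernel to `Q`
under which the Peiffer commutators correspond to the Peiffer lifting. -/
structure Resolution (P : PeifferComplex G H Q) (Γ F : Type*) [Group Γ] [Group F]
    [MulDistribMulAction Γ F] where
  d : F →* Γ
  φG : Γ →* G
  φH : F →* H
  s : d.ker →* Q
  surjective_φG : Function.Surjective φG
  surjective_φH : Function.Surjective φH
  surjective_s : Function.Surjective s
  d_smul : ∀ (γ : Γ) (f : F), d (γ • f) = γ * d f * γ⁻¹
  φH_smul : ∀ (γ : Γ) (f : F), φH (γ • f) = φG γ • φH f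
  φG_d : ∀ f : F, φG (d f) = P.dH (φH f)
  dL_s : ∀ a : d.ker, P.dL (s a) = φH a
  s_smul : ∀ (γ : Γ) (a b : d.ker), (b : F) = γ • (a : F) → s b = φG γ • s a
  s_conj : ∀ (f : F) (a b : d.ker), (b : F) = f * a * f⁻¹ → s b = φH f • s a
  s_pf : ∀ (f₂ f₁ : F) (a : d.ker), (a : F) = f₂ * f₁ * f₂⁻¹ * d f₂ • f₁⁻¹ →
    s a = P.pf (φH f₂) (φH f₁)

namespace IsTwoCrossed

variable {P : PeifferComplex G H Q} (w : P.IsTwoCrossed) (π : L →* Q)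

variable (G H) in
/-- The free group on the disjoint union of the factors of `H ⋊ G`. -/
abbrev Gens := FreeGroup (G ⊕ H)

variable (G H) in
/-- The evident map from the free group to the semidirect product. -/
def θ : Gens G H →* Base G H :=
  FreeGroup.lift (Sum.elim SemidirectProduct.inr SemidirectProduct.inl)

/-- The values of `ρ` on the free generators.  The generator given by `l` goes to the element of the
kernel of the boundary which corresponds to `π l`. -/
def κ (P : PeifferComplex G H Q) (π : L →* Q) : H ⊕ L → Total H Q :=
  Sum.elim SemidirectProduct.inr fun l => ⟨(π l)⁻¹, P.dL (π l)⟩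

/-- The equivariant map from the free `Γ`-group on `H ⊕ L` to `Q ⋊ H` given by `κ`. -/
def ρ : FreeGroup (Gens G H × (H ⊕ L)) →* Total H Q :=
  letI := w.action
  FreeGroup.lift fun a => θ G H a.1 • κ P π a.2

variable (G H L) in
/-- The boundary of the free precrossed module on `H ⊕ L → Γ`. -/
def d : FreeGroup (Gens G H × (H ⊕ L)) →* Gens G H :=
  FreeGroup.lift fun a =>
    a.1 * (Sum.elim (fun h => FreeGroup.of (Sum.inr h)) (fun _ => 1) a.2) * a.1⁻¹

omit [Group G] [Group H] [Group L] [MulDistribMulAction G H] in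
lemma d_smul (γ : Gens G H) (f : FreeGroup (Gens G H × (H ⊕ L))) :
    d G H L (γ • f) = γ * d G H L f * γ⁻¹ := by
  induction f using FreeGroup.induction_on with
  | C1 => simp
  | of a => simp [d, mul_assoc]
  | inv_of a h => rw [smul_inv', map_inv, h, map_inv]; group
  | mul x y hx hy => rw [smul_mul', map_mul, hx, hy, map_mul]; group

lemma ρ_smul (γ : Gens G H) (f : FreeGroup (Gens G H × (H ⊕ L))) : letI := w.action
    w.ρ π (γ • f) = θ G H γ • w.ρ π f := by
  let := w.action
  induction f using FreeGroup.induction_on with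
  | C1 => rw [smul_one, map_one, smul_one]
  | of a =>
    rw [FreeGroup.smul_of, ρ, FreeGroup.lift_apply_of, FreeGroup.lift_apply_of, map_mul, mul_smul]
  | inv_of a h => rw [smul_inv', map_inv, h, map_inv, smul_inv']
  | mul x y hx hy => rw [smul_mul', map_mul, hx, hy, map_mul, smul_mul']

lemma θ_d (f : FreeGroup (Gens G H × (H ⊕ L))) : θ G H (d G H L f) = boundary P (w.ρ π f) := by
  refine DFunLike.congr_fun (f := (θ G H).comp (d G H L)) (g := (boundary P).comp (w.ρ π))
    (FreeGroup.ext_hom _ _ fun a => ?_) f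
  rw [MonoidHom.comp_apply, MonoidHom.comp_apply, d, ρ, FreeGroup.lift_apply_of,
    FreeGroup.lift_apply_of, w.boundary_smul]
  obtain ⟨γ, h | l⟩ := a
  · simp [κ, boundary_apply, θ]
  · simp [κ, boundary_apply]

lemma boundary_ρ {f : FreeGroup (Gens G H × (H ⊕ L))} (hf : d G H L f = 1) :
    boundary P (w.ρ π f) = 1 := by
  rw [← θ_d, hf, map_one]

/-- The resolution of a 2-crossed module by free groups: the free precrossed module, mapped to
`Q ⋊ H → H ⋊ G`. -/
def resolution (hπ : Function.Surjective π) :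
    P.Resolution (Gens G H) (FreeGroup (Gens G H × (H ⊕ L))) where
  d := d G H L
  φG := (toG P).comp (θ G H)
  φH := SemidirectProduct.rightHom.comp (w.ρ π)
  s := MonoidHom.mk' (fun a => (w.ρ π a).left⁻¹) fun a b => by
    rw [Subgroup.coe_mul, map_mul, w.left_mul (w.boundary_ρ π a.2), mul_inv_rev]
  surjective_φG g := ⟨FreeGroup.of (Sum.inl g), by simp [θ, toG_apply]⟩
  surjective_φH h := ⟨FreeGroup.of (1, Sum.inl h), by
    simp [ρ, κ]⟩
  surjective_s l := by
    obtain ⟨l, rfl⟩ := hπ l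
    refine ⟨⟨FreeGroup.of (1, Sum.inr l), by simp [d]⟩, ?_⟩
    simp [ρ, κ]
  d_smul := d_smul
  φH_smul γ f := by
    rw [MonoidHom.comp_apply, w.ρ_smul]
    exact w.right_smul _ _
  φG_d f := by
    rw [MonoidHom.comp_apply, w.θ_d π, toG_boundary]
    rfl
  dL_s a := (right_of_boundary (w.boundary_ρ π a.2)).symm
  s_smul γ a b h := by
    change (w.ρ π b).left⁻¹ = _ • (w.ρ π a).left⁻¹
    rw [h, w.ρ_smul, w.left_smul (w.boundary_ρ π a.2), smul_inv']
    rfl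
  s_conj f a b h := by
    change (w.ρ π b).left⁻¹ = _ • (w.ρ π a).left⁻¹
    rw [h, map_mul, map_mul, map_inv, w.left_conj (w.boundary_ρ π a.2), smul_inv']
    rfl
  s_pf f₂ f₁ a h := by
    change (w.ρ π a).left⁻¹ = _
    let := w.action
    have := w.left_peiffer (w.ρ π f₂) (w.ρ π f₁)
    rw [h, map_mul, map_mul, map_mul, map_inv, w.ρ_smul, map_inv, w.θ_d π, smul_inv', this,
      inv_inv]
    rfl

end IsTwoCrossed
end PeifferComplex
end ThreeCrossedModule

/-! ### The 2-crossed truncation, and extensions of groups over `L` by `M` -/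

namespace ThreeCrossedModule

variable {G H L M : Type*} [Group G] [Group H] [Group L] [Group M]
  [MulDistribMulAction G H] [MulDistribMulAction G L] [MulDistribMulAction G M]
  [MulDistribMulAction H L] [MulDistribMulAction H M] [MulDistribMulAction L M]
  (T : ThreeCrossedModule G H L M)

/-- The image of `M` in `L` is normal. -/
instance : T.dM.range.Normal where
  conj_mem := by
    rintro _ ⟨m, rfl⟩ l
    exact ⟨l • m, T.dM_smulL l m⟩

/-- The cokernel of `∂ : M → L`. -/
abbrev Coker : Type _ := L ⧸ T.dM.range

/-- An action on `L` which preserves the image of `M` descends to the cokernel. -/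
abbrev cokerAction {A : Type*} [Group A] [MulDistribMulAction A L]
    (h : ∀ (a : A) (m : M), a • T.dM m ∈ T.dM.range) : MulDistribMulAction A T.Coker where
  smul a := QuotientGroup.map _ _ (MulDistribMulAction.toMonoidHom L a) <| by
    rintro _ ⟨m, rfl⟩
    exact h a m
  one_smul x := by
    obtain ⟨l, rfl⟩ := QuotientGroup.mk_surjective x
    exact congrArg _ (one_smul A l)
  mul_smul a b x := by
    obtain ⟨l, rfl⟩ := QuotientGroup.mk_surjective x
    exact congrArg _ (mul_smul a b l)
  smul_mul a := map_mul _
  smul_one a := map_one _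

/-- The induced action of `G` on the cokernel. -/
instance : MulDistribMulAction G T.Coker := T.cokerAction fun g m => ⟨g • m, T.dM_smul g m⟩

/-- The induced action of `H` on the cokernel. -/
instance : MulDistribMulAction H T.Coker := T.cokerAction fun h m => ⟨h • m, T.dM_smulH h m⟩

/-- The complex `coker (M → L) → H → G` with the induced Peiffer lifting. -/
def truncation : PeifferComplex G H T.Coker where
  dH := T.dH
  dL := QuotientGroup.lift _ T.dL <| by
    rintro _ ⟨m, rfl⟩
    exact T.dL_dM m
  pf b a := T.pf b a
  dH_dL x := by
    obtain ⟨l, rfl⟩ := QuotientGroup.mk_surjective x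
    exact T.dH_dL l
  dH_smul := T.dH_smul
  dL_smul g x := by
    obtain ⟨l, rfl⟩ := QuotientGroup.mk_surjective x
    exact T.dL_smul g l
  dL_smulH h x := by
    obtain ⟨l, rfl⟩ := QuotientGroup.mk_surjective x
    exact T.dL_smulH h l
  smul_smulH g h x := by
    obtain ⟨l, rfl⟩ := QuotientGroup.mk_surjective x
    exact congrArg _ (T.smul_smulH g h l)
  smul_pf g b a := congrArg _ (T.smul_pf g b a)
  dL_pf := T.dL_pf

lemma dM_coe (m : M) : (T.dM m : T.Coker) = 1 := (QuotientGroup.eq_one_iff _).mpr ⟨m, rfl⟩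

/-- Modulo the image of `M`, the liftings with values in `M` disappear. -/
lemma truncation_isTwoCrossed : T.truncation.IsTwoCrossed where
  dL_smul' x y := by
    obtain ⟨l, rfl⟩ := QuotientGroup.mk_surjective x
    obtain ⟨l', rfl⟩ := QuotientGroup.mk_surjective y
    have := congrArg (QuotientGroup.mk : L → T.Coker) (T.dM_ll l l')
    simp only [QuotientGroup.mk_mul, T.dM_coe, one_mul] at this
    exact this
  pf_mul_left c b a := by
    have := congrArg (QuotientGroup.mk : L → T.Coker) (T.dM_lhom c b a)
    simp only [QuotientGroup.mk_mul, T.dM_coe, one_mul] at this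
    exact this
  pf_mul_right c b a := by
    have := congrArg (QuotientGroup.mk : L → T.Coker) (T.dM_rhom c b a)
    simp only [QuotientGroup.mk_mul, T.dM_coe, one_mul] at this
    exact this
  smul_eq h x := by
    obtain ⟨l, rfl⟩ := QuotientGroup.mk_surjective x
    have := congrArg (QuotientGroup.mk : L → T.Coker) (T.dM_hl h l)
    simp only [QuotientGroup.mk_mul, T.dM_coe, one_mul] at this
    exact this
  dH_smul_eq h x := by
    obtain ⟨l, rfl⟩ := QuotientGroup.mk_surjective x
    have := congrArg (QuotientGroup.mk : L → T.Coker) (T.dM_hl' h l)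
    simp only [QuotientGroup.mk_mul, T.dM_coe, one_mul] at this
    exact this

/-- The action of `M` by a homomorphism to `L`. -/
abbrev autOf {Λ : Type*} [Group Λ] (s : Λ →* L) : Λ →* MulAut M :=
  (MulDistribMulAction.toMulAut L M).comp s

section extension

variable {Λ : Type*} [Group Λ] (s : Λ →* L)

/-- The homomorphism `M ⋊ Λ → L` given by `∂` and `s`. -/
def extensionHom : SemidirectProduct M Λ (autOf s) →* L :=
  SemidirectProduct.lift T.dM s fun a => MonoidHom.ext fun m => T.dM_smulL (s a) m

lemma extensionHom_inl (m : M) : T.extensionHom s (SemidirectProduct.inl m) = T.dM m :=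
  SemidirectProduct.lift_inl _ _ _ _

lemma extensionHom_inr (a : Λ) : T.extensionHom s (SemidirectProduct.inr a) = s a :=
  SemidirectProduct.lift_inr _ _ _ _

lemma extension_conj (n : SemidirectProduct M Λ (autOf s)) (m : M) :
    n * SemidirectProduct.inl m * n⁻¹ = SemidirectProduct.inl (T.extensionHom s n • m) := by
  obtain ⟨m', a, rfl⟩ : ∃ m' a, SemidirectProduct.inl m' * SemidirectProduct.inr a = n :=
    ⟨_, _, SemidirectProduct.inl_left_mul_inr_right n⟩
  have h := SemidirectProduct.inl_aut (φ := autOf (M := M) s) a m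
  rw [map_mul, extensionHom_inl, extensionHom_inr, mul_smul, T.dM_smulM, map_mul, map_mul, map_inv,
    mul_inv_rev, ← map_inv SemidirectProduct.inr]
  change SemidirectProduct.inl (s a • m) = _ at h
  rw [h]
  group

/-- Automorphisms of `M`, `L` and a free group `Λ` which are compatible modulo the image of `M`
extend to `M ⋊ Λ`: a lift of `α` is chosen on free generators. -/
lemma exists_extension_aut [IsFreeGroup Λ] (aM : M ≃* M) (aL : L ≃* L) (α : Λ ≃* Λ)
    (hM : ∀ m, aL (T.dM m) = T.dM (aM m)) (hL : ∀ (l : L) (m : M), aM (l • m) = aL l • aM m)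
    (hs : ∀ a, (aL (s a) : T.Coker) = s (α a)) :
    ∃ Φ : MulAut (SemidirectProduct M Λ (autOf s)),
      (∀ m, Φ (SemidirectProduct.inl m) = SemidirectProduct.inl (aM m)) ∧
      (∀ n, (Φ n).right = α n.right) ∧
      ∀ n, T.extensionHom s (Φ n) = aL (T.extensionHom s n) := by
  obtain ⟨t, ht⟩ := IsFreeGroup.exists_comp_eq
    ((T.extensionHom s).prod SemidirectProduct.rightHom)
    ((aL.toMonoidHom.comp s).prod α.toMonoidHom) fun a => by
      obtain ⟨m, hm⟩ := QuotientGroup.eq.mp (hs a).symm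
      refine ⟨SemidirectProduct.inr (α a) * SemidirectProduct.inl m, Prod.ext ?_ ?_⟩
      · simp [extensionHom_inl, extensionHom_inr, hm]
      · simp
  have ht₁ : ∀ a, T.extensionHom s (t a) = aL (s a) := fun a => congrArg Prod.fst (ht a)
  have ht₂ : ∀ a, (t a).right = α a := fun a => congrArg Prod.snd (ht a)
  let Φ : SemidirectProduct M Λ (autOf s) →* SemidirectProduct M Λ (autOf s) :=
    SemidirectProduct.lift (SemidirectProduct.inl.comp aM.toMonoidHom) t fun a =>
      MonoidHom.ext fun m => by
        change SemidirectProduct.inl (aM (s a • m)) =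
          t a * SemidirectProduct.inl (aM m) * (t a)⁻¹
        rw [T.extension_conj, hL, ht₁]
  have h₁ : ∀ m, Φ (SemidirectProduct.inl m) = SemidirectProduct.inl (aM m) := fun m =>
    SemidirectProduct.lift_inl _ _ _ _
  have h₂ : ∀ a, Φ (SemidirectProduct.inr a) = t a := fun a => SemidirectProduct.lift_inr _ _ _ _
  have h₃ : ∀ n, (Φ n).right = α n.right := fun n => by
    conv_lhs => rw [← SemidirectProduct.inl_left_mul_inr_right n, map_mul, h₁, h₂]
    simp [ht₂]
  have h₄ : ∀ n, T.extensionHom s (Φ n) = aL (T.extensionHom s n) := fun n => by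
    rw [← SemidirectProduct.inl_left_mul_inr_right n]
    simp only [map_mul, h₁, h₂, extensionHom_inl, extensionHom_inr, ht₁, hM]
  have of_right : ∀ n : SemidirectProduct M Λ (autOf s), n.right = 1 →
      SemidirectProduct.inl n.left = n := fun n hn =>
    SemidirectProduct.ext rfl hn.symm
  refine ⟨MulEquiv.ofBijective Φ ⟨(injective_iff_map_eq_one Φ).mpr fun n hn => ?_, fun n => ?_⟩,
    h₁, h₃, h₄⟩
  · have hr : n.right = 1 := by
      have := h₃ n
      rwa [hn, SemidirectProduct.one_right, eq_comm, map_eq_one_iff _ α.injective] at this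
    rw [← of_right n hr, h₁, ← map_one SemidirectProduct.inl, SemidirectProduct.inl_inj,
      map_eq_one_iff _ aM.injective] at hn
    rw [← of_right n hr, hn, map_one]
  · refine ⟨SemidirectProduct.inl (aM.symm (n * (t (α.symm n.right))⁻¹).left) *
      SemidirectProduct.inr (α.symm n.right), ?_⟩
    rw [map_mul, h₁, h₂, MulEquiv.apply_symm_apply, of_right, inv_mul_cancel_right]
    simp [ht₂]

end extension
end ThreeCrossedModule

/-! ### Actions on the extension -/

namespace ThreeCrossedModule

variable {G H L M : Type*} [Group G] [Group H] [Group L] [Group M]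
  [MulDistribMulAction G H] [MulDistribMulAction G L] [MulDistribMulAction G M]
  [MulDistribMulAction H L] [MulDistribMulAction H M] [MulDistribMulAction L M]
  (T : ThreeCrossedModule G H L M)

section compat

variable {Λ : Type*} [Group Λ] (s : Λ →* L)

/-- An automorphism of the extension `M ⋊ Λ` which restricts to `aM`, induces `α` on the quotient
and lies over the automorphism `aL` of `L`. -/
structure ExtensionCompat (aM : MulAut M) (aL : MulAut L) (α : MulAut Λ)
    (Φ : MulAut (SemidirectProduct M Λ (autOf s))) : Prop where
  inl : ∀ m, Φ (SemidirectProduct.inl m) = SemidirectProduct.inl (aM m)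
  right : ∀ n, (Φ n).right = α n.right
  hom : ∀ n, T.extensionHom s (Φ n) = aL (T.extensionHom s n)

namespace ExtensionCompat

variable {T s} {aM aM' : MulAut M} {aL aL' : MulAut L} {α α' : MulAut Λ}
  {Φ Φ' : MulAut (SemidirectProduct M Λ (autOf s))}

lemma one : T.ExtensionCompat s 1 1 1 1 := ⟨fun _ => rfl, fun _ => rfl, fun _ => rfl⟩

lemma mul (h : T.ExtensionCompat s aM aL α Φ) (h' : T.ExtensionCompat s aM' aL' α' Φ') :
    T.ExtensionCompat s (aM * aM') (aL * aL') (α * α') (Φ * Φ') where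
  inl m := by rw [MulAut.mul_apply, h'.inl, h.inl]; rfl
  right n := by rw [MulAut.mul_apply, h.right, h'.right]; rfl
  hom n := by rw [MulAut.mul_apply, h.hom, h'.hom]; rfl

lemma inv (h : T.ExtensionCompat s aM aL α Φ) :
    T.ExtensionCompat s aM⁻¹ aL⁻¹ α⁻¹ Φ⁻¹ where
  inl m := by
    apply Φ.injective
    rw [MulAut.apply_inv_self, h.inl, MulAut.apply_inv_self]
  right n := by
    apply α.injective
    rw [MulAut.apply_inv_self, ← h.right, MulAut.apply_inv_self]
  hom n := by
    apply aL.injective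
    rw [MulAut.apply_inv_self, ← h.hom, MulAut.apply_inv_self]

lemma freeGroup {S : Type*} {aM : FreeGroup S →* MulAut M} {aL : FreeGroup S →* MulAut L}
    {α : FreeGroup S →* MulAut Λ}
    {Φ : FreeGroup S →* MulAut (SemidirectProduct M Λ (autOf s))}
    (h : ∀ x, T.ExtensionCompat s (aM (.of x)) (aL (.of x)) (α (.of x)) (Φ (.of x)))
    (y : FreeGroup S) : T.ExtensionCompat s (aM y) (aL y) (α y) (Φ y) := by
  induction y using FreeGroup.induction_on with
  | C1 => simpa only [map_one] using one
  | of x => exact h x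
  | inv_of x hx => simpa only [map_inv] using hx.inv
  | mul x y hx hy => simpa only [map_mul] using hx.mul hy

end ExtensionCompat
end compat

section cover

variable {T} {Γ F : Type*} [Group Γ] [Group F] [MulDistribMulAction Γ F]
  (R : T.truncation.Resolution Γ F)

/-- The action of `Γ` on the kernel of `d : F → Γ`. -/
instance : MulDistribMulAction Γ R.d.ker where
  smul γ a := ⟨γ • a, by rw [MonoidHom.mem_ker, R.d_smul, MonoidHom.mem_ker.mp a.2]; group⟩
  one_smul a := Subtype.ext (one_smul Γ (a : F))
  mul_smul γ δ a := Subtype.ext (mul_smul γ δ (a : F))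
  smul_mul γ a b := Subtype.ext (smul_mul' γ (a : F) (b : F))
  smul_one γ := Subtype.ext (smul_one γ)

/-- The data of a cover over a resolution whose kernel is extended by `M`. -/
structure ActionData (s : R.d.ker →* L) where
  /-- the action of `Γ` -/
  aG : Γ →* MulAut (SemidirectProduct M R.d.ker (autOf s))
  /-- the action of `F` -/
  aH : F →* MulAut (SemidirectProduct M R.d.ker (autOf s))
  compat_aG : ∀ γ : Γ, T.ExtensionCompat s (MulDistribMulAction.toMulAut G M (R.φG γ))
    (MulDistribMulAction.toMulAut G L (R.φG γ)) (MulDistribMulAction.toMulAut Γ R.d.ker γ) (aG γ)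
  compat_aH : ∀ f : F, T.ExtensionCompat s (MulDistribMulAction.toMulAut H M (R.φH f))
    (MulDistribMulAction.toMulAut H L (R.φH f)) (MulAut.conjNormal f) (aH f)
  aH_smul : ∀ (γ : Γ) (f : F), aH (γ • f) = aG γ * aH f * (aG γ)⁻¹

/-- Actions exist over a resolution by free groups: the automorphisms of the extension are chosen
for the free generators of `Γ` and, equivariantly, for those of `F`. -/
lemma nonempty_actionData {S X : Type*}
    (R : T.truncation.Resolution (FreeGroup S) (FreeGroup (FreeGroup S × X)))
    (s : R.d.ker →* L) (hs : ∀ a, (s a : T.Coker) = R.s a) : Nonempty (ActionData R s) := by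
  have hΦ (c : S) := T.exists_extension_aut s
    (MulDistribMulAction.toMulAut G M (R.φG (.of c)))
    (MulDistribMulAction.toMulAut G L (R.φG (.of c)))
    (MulDistribMulAction.toMulAut (FreeGroup S) R.d.ker (.of c))
    (fun m => (T.dM_smul _ m).symm) (fun l m => T.smul_smulL _ l m)
    (fun a => by
      change R.φG (.of c) • (s a : T.Coker) = _
      rw [hs, hs]
      exact (R.s_smul _ _ _ rfl).symm)
  choose Φ hΦ using hΦ
  have hΨ (x : X) := T.exists_extension_aut s
    (MulDistribMulAction.toMulAut H M (R.φH (.of (1, x))))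
    (MulDistribMulAction.toMulAut H L (R.φH (.of (1, x))))
    (MulAut.conjNormal (.of (1, x)))
    (fun m => (T.dM_smulH _ m).symm) (fun l m => T.smulH_smulL _ l m)
    (fun a => by
      change R.φH (.of (1, x)) • (s a : T.Coker) = _
      rw [hs, hs]
      exact (R.s_conj _ _ _ rfl).symm)
  choose Ψ hΨ using hΨ
  let aG := FreeGroup.lift Φ
  have compat_aG := fun γ => ExtensionCompat.freeGroup (T := T) (s := s)
    (aM := (MulDistribMulAction.toMulAut G M).comp R.φG)
    (aL := (MulDistribMulAction.toMulAut G L).comp R.φG)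
    (α := MulDistribMulAction.toMulAut (FreeGroup S) R.d.ker) (Φ := aG)
    (fun c => by
      simp only [aG, FreeGroup.lift_apply_of]
      exact ⟨(hΦ c).1, (hΦ c).2.1, (hΦ c).2.2⟩) γ
  let aH := FreeGroup.lift fun a : FreeGroup S × X => aG a.1 * Ψ a.2 * (aG a.1)⁻¹
  refine ⟨⟨aG, aH, compat_aG, fun f => ExtensionCompat.freeGroup (T := T) (s := s)
    (aM := (MulDistribMulAction.toMulAut H M).comp R.φH)
    (aL := (MulDistribMulAction.toMulAut H L).comp R.φH)
    (α := MulAut.conjNormal) (Φ := aH) (fun a => ?_) f, fun γ f => ?_⟩⟩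
  · obtain ⟨γ, x⟩ := a
    have h := ((compat_aG γ).mul ⟨(hΨ x).1, (hΨ x).2.1, (hΨ x).2.2⟩).mul (compat_aG γ).inv
    have hof : (.of (γ, x) : FreeGroup (FreeGroup S × X)) = γ • .of (1, x) := by simp
    simp only [aH, FreeGroup.lift_apply_of]
    convert h using 1
    · ext m
      rw [MonoidHom.comp_apply, hof, R.φH_smul]
      have := T.smul_smulH_M (R.φG γ) (R.φH (.of (1, x))) ((R.φG γ)⁻¹ • m)
      rw [smul_inv_smul] at this
      exact this.symm
    · ext m
      rw [MonoidHom.comp_apply, hof, R.φH_smul]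
      have := T.smul_smulH (R.φG γ) (R.φH (.of (1, x))) ((R.φG γ)⁻¹ • m)
      rw [smul_inv_smul] at this
      exact this.symm
    · ext a
      rw [hof]
      change γ • FreeGroup.of (1, x) * (a : FreeGroup (FreeGroup S × X)) * (γ • .of (1, x))⁻¹ =
        γ • (.of (1, x) * γ⁻¹ • (a : FreeGroup (FreeGroup S × X)) * (.of (1, x))⁻¹)
      rw [smul_mul', smul_mul', smul_inv_smul, smul_inv']
  · induction f using FreeGroup.induction_on with
    | C1 => simp
    | of a => simp [aH, mul_assoc]
    | inv_of a h => rw [smul_inv', map_inv, h, map_inv]; group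
    | mul x y hx hy => rw [smul_mul', map_mul, hx, hy, map_mul]; group

end cover
end ThreeCrossedModule

/-! ### Existence of covers -/

namespace ThreeCrossedModule

variable {G H L M : Type*} [Group G] [Group H] [Group L] [Group M]
  [MulDistribMulAction G H] [MulDistribMulAction G L] [MulDistribMulAction G M]
  [MulDistribMulAction H L] [MulDistribMulAction H M] [MulDistribMulAction L M]
  {T : ThreeCrossedModule G H L M}

section pf

variable {Γ F : Type*} [Group Γ] [Group F] [MulDistribMulAction Γ F]
  (R : T.truncation.Resolution Γ F) {s : R.d.ker →* L}

lemma dL_extensionHom (hs : ∀ a, (s a : T.Coker) = R.s a)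
    (n : SemidirectProduct M R.d.ker (autOf s)) :
    T.dL (T.extensionHom s n) = R.φH n.right := by
  rw [← SemidirectProduct.inl_left_mul_inr_right n, map_mul, extensionHom_inl, extensionHom_inr,
    map_mul, T.dL_dM, one_mul]
  simp only [SemidirectProduct.mul_right, SemidirectProduct.right_inl, SemidirectProduct.right_inr,
    one_mul]
  rw [← R.dL_s, ← hs]
  rfl

/-- The Peiffer commutator of two elements of `F`. -/
def peifferComm (f₂ f₁ : F) : R.d.ker :=
  ⟨f₂ * f₁ * f₂⁻¹ * R.d f₂ • f₁⁻¹, by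
    rw [MonoidHom.mem_ker]
    simp only [map_mul, map_inv, R.d_smul]
    group⟩

/-- Elements of the extension over given elements of `L` and of the kernel of `d`. -/
lemma exists_extension_eq (hs : ∀ a, (s a : T.Coker) = R.s a) (x : L) (a : R.d.ker)
    (h : (x : T.Coker) = R.s a) :
    ∃ n : SemidirectProduct M R.d.ker (autOf s), n.right = a ∧ T.extensionHom s n = x := by
  obtain ⟨m, hm⟩ := QuotientGroup.eq.mp ((hs a).trans h.symm)
  exact ⟨SemidirectProduct.inr a * SemidirectProduct.inl m, by simp, by
    rw [map_mul, extensionHom_inl, extensionHom_inr, hm, mul_inv_cancel_left]⟩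

/-- The Peiffer lifting of `T` lifts equivariantly to the extension, since `Γ` acts freely on
nontrivial elements of `F`. -/
lemma exists_pf {X : Type*} {R : T.truncation.Resolution Γ (FreeGroup (Γ × X))}
    {s : R.d.ker →* L} (hs : ∀ a, (s a : T.Coker) = R.s a) (D : ActionData R s) :
    ∃ pf : FreeGroup (Γ × X) → FreeGroup (Γ × X) → SemidirectProduct M R.d.ker (autOf s),
      (∀ f₂ f₁, (pf f₂ f₁).right = peifferComm R f₂ f₁) ∧
      (∀ f₂ f₁, T.extensionHom s (pf f₂ f₁) = T.pf (R.φH f₂) (R.φH f₁)) ∧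
      (∀ γ f₂ f₁, D.aG γ (pf f₂ f₁) = pf (γ • f₂) (γ • f₁)) ∧
      (∀ f, pf 1 f = 1) ∧ ∀ f, pf f 1 = 1 := by
  classical
  choose p hp₁ hp₂ using fun f₂ f₁ => exists_extension_eq R hs (T.pf (R.φH f₂) (R.φH f₁))
    (peifferComm R f₂ f₁) (R.s_pf _ _ _ rfl).symm
  -- an arbitrary choice is made on words with first group component `1`, and translated by `Γ`
  let pf (f₂ f₁ : FreeGroup (Γ × X)) : SemidirectProduct M R.d.ker (autOf s) :=
    if f₂ = 1 ∨ f₁ = 1 then 1 else D.aG f₂.first (p (f₂.first⁻¹ • f₂) (f₂.first⁻¹ • f₁))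
  have comm_smul (γ : Γ) (f₂ f₁ : FreeGroup (Γ × X)) :
      peifferComm R (γ • f₂) (γ • f₁) = γ • peifferComm R f₂ f₁ := by
    apply Subtype.ext
    change γ • f₂ * γ • f₁ * (γ • f₂)⁻¹ * R.d (γ • f₂) • (γ • f₁)⁻¹ =
      γ • (f₂ * f₁ * f₂⁻¹ * R.d f₂ • f₁⁻¹)
    rw [R.d_smul]
    simp only [smul_mul', smul_inv', mul_smul, inv_smul_smul]
  refine ⟨pf, fun f₂ f₁ => ?_, fun f₂ f₁ => ?_, fun γ f₂ f₁ => ?_, fun f => if_pos (.inl rfl),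
    fun f => if_pos (.inr rfl)⟩
  · by_cases h : f₂ = 1 ∨ f₁ = 1
    · simp only [pf, if_pos h]
      apply Subtype.ext
      rcases h with rfl | rfl <;> simp [peifferComm]
    · simp only [pf, if_neg h]
      rw [(D.compat_aG _).right, hp₁, comm_smul]
      exact smul_inv_smul f₂.first (peifferComm R f₂ f₁)
  · by_cases h : f₂ = 1 ∨ f₁ = 1
    · simp only [pf, if_pos h, map_one]
      rcases h with rfl | rfl
      · rw [map_one, T.pf_one_left]
      · rw [map_one, T.pf_one_right]
    · simp only [pf, if_neg h]
      rw [(D.compat_aG _).hom, hp₂]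
      change R.φG _ • T.pf _ _ = _
      rw [T.smul_pf, ← R.φH_smul, ← R.φH_smul, smul_inv_smul, smul_inv_smul]
  · by_cases h : f₂ = 1 ∨ f₁ = 1
    · have h' : γ • f₂ = 1 ∨ γ • f₁ = 1 := h.imp (fun h => by rw [h, smul_one])
        (fun h => by rw [h, smul_one])
      simp only [pf, if_pos h, if_pos h', map_one]
    · have h' : ¬ (γ • f₂ = 1 ∨ γ • f₁ = 1) := fun h' => h <|
        h'.imp (fun h => by rw [← inv_smul_smul γ f₂, h, smul_one])
          fun h => by rw [← inv_smul_smul γ f₁, h, smul_one]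
      simp only [pf, if_neg h, if_neg h']
      rw [FreeGroup.first_smul γ fun hf => h (.inl hf), map_mul, MulAut.mul_apply]
      simp only [mul_inv_rev, mul_smul, inv_smul_smul]

end pf

/-- Every 3-crossed module has a cover.  Here `F → Γ` is a resolution of the 2-crossed truncation by
free groups, and `N` is the semidirect product of `M` with the kernel of `F → Γ`, which is free as a
subgroup of a free group. -/
theorem exists_cover {G : Type u₁} {H : Type u₂} {L : Type u₃} {M : Type u₄}
    [Group G] [Group H] [Group L] [Group M]
    [MulDistribMulAction G H] [MulDistribMulAction G L] [MulDistribMulAction G M]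
    [MulDistribMulAction H L] [MulDistribMulAction H M] [MulDistribMulAction L M]
    (T : ThreeCrossedModule G H L M) :
    ∃ (Γ : Type (max u₁ u₂)) (F : Type (max u₁ u₂ u₃)) (N : Type (max u₁ u₂ u₃ u₄))
      (_ : Group Γ) (_ : Group F) (_ : Group N)
      (_ : MulDistribMulAction Γ F) (_ : MulDistribMulAction Γ N) (_ : MulDistribMulAction F N),
      Nonempty (T.Cover Γ F N) := by
  let R := T.truncation_isTwoCrossed.resolution (QuotientGroup.mk' T.dM.range)
    (QuotientGroup.mk'_surjective _)
  obtain ⟨s, hs⟩ := IsFreeGroup.exists_comp_eq (QuotientGroup.mk' T.dM.range) R.s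
    fun a => QuotientGroup.mk'_surjective _ _
  obtain ⟨D⟩ := nonempty_actionData R s hs
  obtain ⟨pf, pf_right, pf_hom, smul_pf, pf_one_left, pf_one_right⟩ := exists_pf hs D
  let := MulDistribMulAction.compHom (SemidirectProduct M R.d.ker (autOf s)) D.aG
  let := MulDistribMulAction.compHom (SemidirectProduct M R.d.ker (autOf s)) D.aH
  let P : PeifferComplex _ _ (SemidirectProduct M R.d.ker (autOf s)) :=
    { dH := R.d
      dL := R.d.ker.subtype.comp SemidirectProduct.rightHom
      pf := pf
      dH_dL := fun n => n.right.2
      dH_smul := R.d_smul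
      dL_smul := fun γ n => congrArg Subtype.val ((D.compat_aG γ).right n)
      dL_smulH := fun f n => congrArg Subtype.val ((D.compat_aH f).right n)
      smul_smulH := fun γ f n => by
        change D.aG γ (D.aH f n) = D.aH (γ • f) (D.aG γ n)
        rw [D.aH_smul, MulAut.mul_apply, MulAut.mul_apply, MulAut.inv_apply_self]
      smul_pf := smul_pf
      dL_pf := fun f₂ f₁ => congrArg Subtype.val (pf_right f₂ f₁) }
  refine ⟨_, _, SemidirectProduct M R.d.ker (autOf s), inferInstance, inferInstance, inferInstance,
    inferInstance, inferInstance, inferInstance, ⟨{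
      P := P
      φG := R.φG
      φH := R.φH
      φL := T.extensionHom s
      isHom := ?_
      surjective_φG := R.surjective_φG
      surjective_φH := R.surjective_φH
      surjective_φL := fun x => ?_
      ι := SemidirectProduct.inl
      injective_ι := SemidirectProduct.inl_injective
      dL_ι := fun m => rfl
      exists_ι := fun n hn => ⟨n.left, SemidirectProduct.ext rfl (Subtype.ext hn).symm⟩
      φL_ι := T.extensionHom_inl s
      exists_dL := fun f hf => ⟨SemidirectProduct.inr ⟨f, hf⟩, rfl⟩
      smul_ι := fun γ m => (D.compat_aG γ).inl m
      smulH_ι := fun f m => (D.compat_aH f).inl m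
      conj_ι := T.extension_conj s
      pf_one_left := pf_one_left
      pf_one_right := pf_one_right }⟩⟩
  · exact ⟨R.φH_smul, fun γ n => (D.compat_aG γ).hom n, fun f n => (D.compat_aH f).hom n, R.φG_d,
      fun n => (dL_extensionHom R hs n).symm, pf_hom⟩
  · obtain ⟨a, ha⟩ := R.surjective_s (x : T.Coker)
    obtain ⟨n, -, hn⟩ := exists_extension_eq R hs x a ha.symm
    exact ⟨n, hn⟩

end ThreeCrossedModule

/-! ### Filling horns of dimension two, three, four, six and higher -/

namespace ThreeCrossedModule

variable {G H L M : Type*} [Group G] [Group H] [Group L] [Group M]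
  [MulDistribMulAction G H] [MulDistribMulAction G L] [MulDistribMulAction G M]
  [MulDistribMulAction H L] [MulDistribMulAction H M] [MulDistribMulAction L M]
  (T : ThreeCrossedModule G H L M)

/-- Normalized colorings of an `N`-simplex, given by total functions, satisfying the cocycle
conditions.  It suffices to impose these for strictly increasing sequences of vertices. -/
structure Filled (N : ℕ) (g : ℕ → ℕ → G) (h : ℕ → ℕ → ℕ → H) (l : ℕ → ℕ → ℕ → ℕ → L)
    (m : ℕ → ℕ → ℕ → ℕ → ℕ → M) : Prop extends Normalized g h l m where
  coherent : T.peiffer.Coherent N g h l fun i j k p q => T.dM (m i j k p q)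
  five : ∀ i j k p q x, i < j → j < k → k < p → p < q → q < x → x ≤ N →
    fiveLeft T.peiffer T.liftings g h l m i j k p q x =
      fiveRight T.peiffer T.liftings g h l m i j k p q x

/-- Normalized colorings satisfying the cocycle conditions for the vertices of each face of an
`N`-simplex, except for the face opposite to `r`.  In each condition, `d` is a vertex other than `r`
such that the simplex lies in the face opposite to `d`. -/
structure HornFilled (N r : ℕ) (g : ℕ → ℕ → G) (h : ℕ → ℕ → ℕ → H)
    (l : ℕ → ℕ → ℕ → ℕ → L) (m : ℕ → ℕ → ℕ → ℕ → ℕ → M) : Prop extends Normalized g h l m where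
  g_mul : ∀ d i j k, d ≤ N → d ≠ r → d ≠ i → d ≠ j → d ≠ k → i < j → j < k → k ≤ N →
    g i k = T.dH (h i j k) * g j k * g i j
  h_mul : ∀ d i j k p, d ≤ N → d ≠ r → d ≠ i → d ≠ j → d ≠ k → d ≠ p →
    i < j → j < k → k < p → p ≤ N →
    T.dL (l i j k p) * h i k p * g k p • h i j k = h i j p * h j k p
  l_mul : ∀ d i j k p q, d ≤ N → d ≠ r → d ≠ i → d ≠ j → d ≠ k → d ≠ p → d ≠ q →
    i < j → j < k → k < p → p < q → q ≤ N →
    T.dM (m i j k p q) * h i j q • l j k p q * l i j p q * h i p q • g p q • l i j k p =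
      l i j k q * h i k q • (T.pf (h k p q) ((g p q * g k p) • h i j k))⁻¹ * l i k p q
  five : ∀ d i j k p q x, d ≤ N → d ≠ r → d ≠ i → d ≠ j → d ≠ k → d ≠ p → d ≠ q → d ≠ x →
    i < j → j < k → k < p → p < q → q < x → x ≤ N →
    fiveLeft T.peiffer T.liftings g h l m i j k p q x =
      fiveRight T.peiffer T.liftings g h l m i j k p q x

/-- Two colorings agree on the horn with vertex `r`. -/
structure AgreeOnHorn {G H L M : Type*} (N r : ℕ) (g g' : ℕ → ℕ → G) (h h' : ℕ → ℕ → ℕ → H)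
    (l l' : ℕ → ℕ → ℕ → ℕ → L) (m m' : ℕ → ℕ → ℕ → ℕ → ℕ → M) : Prop where
  g_eq : ∀ d i j, d ≤ N → d ≠ r → d ≠ i → d ≠ j → g' i j = g i j
  h_eq : ∀ d i j k, d ≤ N → d ≠ r → d ≠ i → d ≠ j → d ≠ k → h' i j k = h i j k
  l_eq : ∀ d i j k p, d ≤ N → d ≠ r → d ≠ i → d ≠ j → d ≠ k → d ≠ p → l' i j k p = l i j k p
  m_eq : ∀ d i j k p q, d ≤ N → d ≠ r → d ≠ i → d ≠ j → d ≠ k → d ≠ p → d ≠ q →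
    m' i j k p q = m i j k p q

/-- Fewer than `N` vertices of an `N`-simplex lie in a face which is not opposite to `r`. -/
lemma exists_avoid {N r : ℕ} (s : Finset ℕ) (hs : s.card < N) : ∃ d, d ≤ N ∧ d ≠ r ∧ d ∉ s := by
  have : (insert r s).card < (Finset.range (N + 1)).card := by
    rw [Finset.card_range]
    exact (Finset.card_insert_le _ _).trans_lt (by lia)
  obtain ⟨d, hd, hd'⟩ := Finset.exists_mem_notMem_of_card_lt_card this
  rw [Finset.mem_insert, not_or] at hd'
  exact ⟨d, Nat.lt_succ_iff.mp (Finset.mem_range.mp hd), hd'.1, hd'.2⟩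

variable {T} {N r : ℕ} {g : ℕ → ℕ → G} {h : ℕ → ℕ → ℕ → H} {l : ℕ → ℕ → ℕ → ℕ → L}
  {m : ℕ → ℕ → ℕ → ℕ → ℕ → M}

lemma AgreeOnHorn.refl {G H L M : Type*} {N r : ℕ} {g : ℕ → ℕ → G} {h : ℕ → ℕ → ℕ → H}
    {l : ℕ → ℕ → ℕ → ℕ → L} {m : ℕ → ℕ → ℕ → ℕ → ℕ → M} :
    AgreeOnHorn N r g g h h l l m m :=
  ⟨fun _ _ _ _ _ _ _ => rfl, fun _ _ _ _ _ _ _ _ _ => rfl, fun _ _ _ _ _ _ _ _ _ _ _ => rfl,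
    fun _ _ _ _ _ _ _ _ _ _ _ _ _ => rfl⟩

namespace HornFilled

lemma g_mul_of_le (c : T.HornFilled N r g h l m) (hN : 4 ≤ N) {i j k : ℕ} (hij : i < j)
    (hjk : j < k) (hk : k ≤ N) : g i k = T.dH (h i j k) * g j k * g i j := by
  obtain ⟨d, h₁, h₂, h₃⟩ := exists_avoid (r := r) {i, j, k} (Finset.card_le_three.trans_lt hN)
  simp only [Finset.mem_insert, Finset.mem_singleton, not_or] at h₃
  exact c.g_mul d i j k h₁ h₂ h₃.1 h₃.2.1 h₃.2.2 hij hjk hk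

lemma h_mul_of_le (c : T.HornFilled N r g h l m) (hN : 5 ≤ N) {i j k p : ℕ} (hij : i < j)
    (hjk : j < k) (hkp : k < p) (hp : p ≤ N) :
    T.dL (l i j k p) * h i k p * g k p • h i j k = h i j p * h j k p := by
  obtain ⟨d, h₁, h₂, h₃⟩ := exists_avoid (r := r) {i, j, k, p} (Finset.card_le_four.trans_lt hN)
  simp only [Finset.mem_insert, Finset.mem_singleton, not_or] at h₃
  exact c.h_mul d i j k p h₁ h₂ h₃.1 h₃.2.1 h₃.2.2.1 h₃.2.2.2 hij hjk hkp hp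

lemma coherent_of_le (c : T.HornFilled N r g h l m) (hN : 6 ≤ N) :
    T.peiffer.Coherent N g h l fun i j k p q => T.dM (m i j k p q) where
  g_mul _ _ _ := c.g_mul_of_le (by lia)
  h_mul _ _ _ _ := c.h_mul_of_le (by lia)
  l_mul i j k p q hij hjk hkp hpq hq := by
    obtain ⟨d, h₁, h₂, h₃⟩ := exists_avoid (r := r) {i, j, k, p, q}
      (Finset.card_le_five.trans_lt hN)
    simp only [Finset.mem_insert, Finset.mem_singleton, not_or] at h₃
    exact c.l_mul d i j k p q h₁ h₂ h₃.1 h₃.2.1 h₃.2.2.1 h₃.2.2.2.1 h₃.2.2.2.2 hij hjk hkp hpq hq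

/-- The cocycle conditions concern at most six vertices. -/
lemma filled_of_seven_le (c : T.HornFilled N r g h l m) (hN : 7 ≤ N) : T.Filled N g h l m where
  toNormalized := c.toNormalized
  coherent := c.coherent_of_le (by lia)
  five i j k p q x hij hjk hkp hpq hqx hx := by
    obtain ⟨d, h₁, h₂, h₃⟩ := exists_avoid (r := r) {i, j, k, p, q, x}
      (Finset.card_le_six.trans_lt hN)
    simp only [Finset.mem_insert, Finset.mem_singleton, not_or] at h₃
    exact c.five d i j k p q x h₁ h₂ h₃.1 h₃.2.1 h₃.2.2.1 h₃.2.2.2.1 h₃.2.2.2.2.1 h₃.2.2.2.2.2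
      hij hjk hkp hpq hqx hx

/-- In a horn in a `6`-simplex, only the `5`-simplex identity of the missing face has to be
shown. -/
lemma filled_six (c : T.HornFilled 6 r g h l m) (hr : r ≤ 6) : T.Filled 6 g h l m where
  toNormalized := c.toNormalized
  coherent := c.coherent_of_le le_rfl
  five i j k p q x hij hjk hkp hpq hqx hx := by
    obtain ⟨Γ, F, N, _, _, _, _, _, _, ⟨C⟩⟩ := T.exists_cover
    -- a face which contains `r` is opposite to a vertex other than `r`
    refine C.five_of_horn (c.coherent_of_le le_rfl) hr
      (fun i j k p q x hij hjk hkp hpq hqx hx hmem => ?_) hij hjk hkp hpq hqx hx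
    have hcard : ({i, j, k, p, q, x} : Finset ℕ).card < 7 := Finset.card_le_six.trans_lt (by lia)
    obtain ⟨d, hd, hd'⟩ := Finset.exists_mem_notMem_of_card_lt_card
      (hcard.trans_eq (Finset.card_range 7).symm)
    simp only [Finset.mem_insert, Finset.mem_singleton, not_or] at hd'
    exact c.five d i j k p q x (Nat.lt_succ_iff.mp (Finset.mem_range.mp hd)) (by lia)
      hd'.1 hd'.2.1 hd'.2.2.1 hd'.2.2.2.1 hd'.2.2.2.2.1 hd'.2.2.2.2.2 hij hjk hkp hpq hqx hx

/-- Filling a horn in a triangle. -/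
lemma exists_filled_two (c : T.HornFilled 2 1 g h l m) :
    ∃ g', T.Filled 2 g' h l m ∧ AgreeOnHorn 2 1 g g' h h l l m m := by
  let g' (i j : ℕ) := if i = 0 ∧ j = 2 then T.dH (h 0 1 2) * g 1 2 * g 0 1 else g i j
  refine ⟨g', ⟨⟨fun i => ?_, c.h_left, c.h_right, c.l_left, c.l_mid, c.l_right, c.m_1, c.m_2,
    c.m_3, c.m_4⟩, ⟨fun i j k hij hjk hk => ?_, by lia, by lia⟩, by lia⟩,
    { AgreeOnHorn.refl (N := 2) (r := 1) (g := g) (h := h) (l := l) (m := m) with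
      g_eq := fun d i j _ _ _ _ => if_neg (by lia) }⟩
  · simp only [g']
    rw [if_neg (by lia), c.g_refl]
  · obtain ⟨rfl, rfl, rfl⟩ : i = 0 ∧ j = 1 ∧ k = 2 := by lia
    simp [g', peiffer]

/-- Filling a horn in a tetrahedron: the condition on the tetrahedron determines the missing
triangle. -/
lemma exists_filled_three (c : T.HornFilled 3 r g h l m) (h₀ : 0 < r) (h₃ : r < 3) :
    ∃ h', T.Filled 3 g h' l m ∧ AgreeOnHorn 3 r g g h h' l l m m := by
  -- `0 a 3` is the missing triangle, and `x` is its value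
  obtain ⟨a, x, ha, har, hx, hxg⟩ : ∃ a x, (a = 1 ∨ a = 2) ∧ a ≠ r ∧
      (∀ h' : ℕ → ℕ → ℕ → H, h' 0 1 2 = h 0 1 2 → h' 1 2 3 = h 1 2 3 →
        h' 0 r 3 = h 0 r 3 → h' 0 a 3 = x →
        T.dL (l 0 1 2 3) * h' 0 2 3 * g 2 3 • h' 0 1 2 = h' 0 1 3 * h' 1 2 3) ∧
      g 0 3 = T.dH x * g a 3 * g 0 a := by
    have e₁ := c.g_mul 3 0 1 2 (by lia) (by lia) (by lia) (by lia) (by lia) (by lia) (by lia)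
      (by lia)
    have e₂ := c.g_mul 0 1 2 3 (by lia) (by lia) (by lia) (by lia) (by lia) (by lia) (by lia)
      (by lia)
    obtain rfl | rfl : r = 1 ∨ r = 2 := by lia
    · refine ⟨2, (T.dL (l 0 1 2 3))⁻¹ * (h 0 1 3 * h 1 2 3) * (g 2 3 • h 0 1 2)⁻¹, by lia, by lia,
        fun h' h₁ h₂ h₃ h₄ => by rw [h₁, h₂, h₃, h₄]; group, ?_⟩
      rw [c.g_mul 2 0 1 3 (by lia) (by lia) (by lia) (by lia) (by lia) (by lia) (by lia) (by lia),
        e₁, e₂]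
      simp only [map_mul, map_inv, T.dH_smul, T.dH_dL]
      group
    · refine ⟨1, T.dL (l 0 1 2 3) * h 0 2 3 * g 2 3 • h 0 1 2 * (h 1 2 3)⁻¹, by lia, by lia,
        fun h' h₁ h₂ h₃ h₄ => by rw [h₁, h₂, h₃, h₄]; group, ?_⟩
      rw [c.g_mul 1 0 2 3 (by lia) (by lia) (by lia) (by lia) (by lia) (by lia) (by lia) (by lia),
        e₁, e₂]
      simp only [map_mul, map_inv, T.dH_smul, T.dH_dL]
      group
  let h' (i j k : ℕ) := if i = 0 ∧ j = a ∧ k = 3 then x else h i j k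
  have hn (i j k : ℕ) (hi : ¬ (i = 0 ∧ j = a ∧ k = 3)) : h' i j k = h i j k := if_neg hi
  refine ⟨h', ⟨⟨c.g_refl, fun i j => ?_, fun i j => ?_, c.l_left, c.l_mid, c.l_right, c.m_1, c.m_2,
    c.m_3, c.m_4⟩, ⟨fun i j k hij hjk hk => ?_, fun i j k p hij hjk hkp hp => ?_, by lia⟩, by lia⟩,
    { AgreeOnHorn.refl (N := 3) (r := r) (g := g) (h := h) (l := l) (m := m) with
      h_eq := fun d i j k _ _ _ _ _ => hn _ _ _ (by lia) }⟩
  · rw [hn _ _ _ (by lia), c.h_left]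
  · rw [hn _ _ _ (by lia), c.h_right]
  · by_cases e : i = 0 ∧ j = a ∧ k = 3
    · simp only [h', if_pos e]
      obtain ⟨rfl, rfl, rfl⟩ := e
      exact hxg
    · rw [hn _ _ _ e]
      exact c.g_mul (6 - (i + j + k)) i j k (by lia) (by lia) (by lia) (by lia) (by lia) hij hjk hk
  · obtain ⟨rfl, rfl, rfl, rfl⟩ : i = 0 ∧ j = 1 ∧ k = 2 ∧ p = 3 := by lia
    exact hx h' (hn _ _ _ (by lia)) (hn _ _ _ (by lia)) (hn _ _ _ (by lia)) (if_pos (by lia))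

/-- Filling a horn in a `4`-simplex: the condition on the `4`-simplex determines the missing
tetrahedron, and the relation between the tetrahedra implies the condition on the latter. -/
lemma exists_filled_four (c : T.HornFilled 4 r g h l m) (h₀ : 0 < r) (h₄ : r < 4) :
    ∃ l', T.Filled 4 g h l' m ∧ AgreeOnHorn 4 r g g h h l l' m m := by
  have hb (i j k p : ℕ) (hij : i < j) (hjk : j < k) (hkp : k < p) (hp : p ≤ 4)
      (hr : r = i ∨ r = j ∨ r = k ∨ r = p) :
      T.peiffer.dL (l i j k p) = tetra g h i j k p :=
    PeifferComplex.dL_eq_tetra <| c.h_mul (10 - (i + j + k + p)) i j k p (by lia) (by lia) (by lia)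
      (by lia) (by lia) (by lia) hij hjk hkp hp
  have ht := T.peiffer.tetra_mul g h 0 1 2 3 4 (c.g_mul_of_le le_rfl (by lia) (by lia) le_rfl)
  have hM : ∀ y, T.peiffer.dL (T.dM y) = 1 := T.dL_dM
  -- `0 a b 4` is the missing tetrahedron, and `x` is its value
  obtain ⟨a, b, x, hab, ha, hb', har, hbr, hx, hxt⟩ : ∃ a b x, a < b ∧ (a = 1 ∨ a = 2) ∧
      (b = 2 ∨ b = 3) ∧ a ≠ r ∧ b ≠ r ∧
      (∀ l' : ℕ → ℕ → ℕ → ℕ → L, (∀ i j k p, i < j → j < k → k < p → p ≤ 4 →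
        (r = i ∨ r = j ∨ r = k ∨ r = p) → l' i j k p = l i j k p) → l' 0 a b 4 = x →
        T.dM (m 0 1 2 3 4) * h 0 1 4 • l' 1 2 3 4 * l' 0 1 3 4 * h 0 3 4 • g 3 4 • l' 0 1 2 3 =
          l' 0 1 2 4 * h 0 2 4 • (T.pf (h 2 3 4) ((g 3 4 * g 2 3) • h 0 1 2))⁻¹ * l' 0 2 3 4) ∧
      T.peiffer.dL x = tetra g h 0 a b 4 := by
    have t₁ := hb 1 2 3 4 (by lia) (by lia) (by lia) (by lia)
    have t₂ := hb 0 2 3 4 (by lia) (by lia) (by lia) (by lia)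
    have t₃ := hb 0 1 3 4 (by lia) (by lia) (by lia) (by lia)
    have t₄ := hb 0 1 2 4 (by lia) (by lia) (by lia) (by lia)
    have t₅ := hb 0 1 2 3 (by lia) (by lia) (by lia) (by lia)
    simp only [map_inv] at ht
    obtain rfl | rfl | rfl : r = 1 ∨ r = 2 ∨ r = 3 := by lia
    · refine ⟨2, 3,
        (l 0 1 2 4 * h 0 2 4 • (T.peiffer.pf (h 2 3 4) ((g 3 4 * g 2 3) • h 0 1 2))⁻¹)⁻¹ *
        (T.dM (m 0 1 2 3 4) * h 0 1 4 • l 1 2 3 4 * l 0 1 3 4 * h 0 3 4 • g 3 4 • l 0 1 2 3),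
        by lia, by lia, by lia, by lia, by lia, fun l' hl' hx => ?_, ?_⟩
      · rw [hl' 1 2 3 4, hl' 0 1 3 4, hl' 0 1 2 3, hl' 0 1 2 4, hx]
        · exact (mul_inv_cancel_left _ _).symm
        all_goals lia
      · simp only [map_mul, map_inv, T.peiffer.dL_smulH, T.peiffer.dL_smul, hM, t₁ (by lia),
          t₃ (by lia), t₄ (by lia), t₅ (by lia)]
        rw [one_mul, ht]
        group
    · refine ⟨1, 3, (T.dM (m 0 1 2 3 4) * h 0 1 4 • l 1 2 3 4)⁻¹ * (l 0 1 2 4 *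
        h 0 2 4 • (T.peiffer.pf (h 2 3 4) ((g 3 4 * g 2 3) • h 0 1 2))⁻¹ * l 0 2 3 4) *
        (h 0 3 4 • g 3 4 • l 0 1 2 3)⁻¹,
        by lia, by lia, by lia, by lia, by lia, fun l' hl' hx => ?_, ?_⟩
      · rw [hl' 1 2 3 4, hl' 0 2 3 4, hl' 0 1 2 3, hl' 0 1 2 4, hx]
        · rw [mul_assoc, inv_mul_cancel_right, mul_inv_cancel_left]
          rfl
        all_goals lia
      · simp only [map_mul, map_inv, T.peiffer.dL_smulH, T.peiffer.dL_smul, hM, t₁ (by lia),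
          t₂ (by lia), t₄ (by lia), t₅ (by lia)]
        rw [one_mul, ← ht]
        group
    · refine ⟨1, 2, (T.dM (m 0 1 2 3 4) * h 0 1 4 • l 1 2 3 4 * l 0 1 3 4 *
        h 0 3 4 • g 3 4 • l 0 1 2 3) *
        (h 0 2 4 • (T.peiffer.pf (h 2 3 4) ((g 3 4 * g 2 3) • h 0 1 2))⁻¹ * l 0 2 3 4)⁻¹,
        by lia, by lia, by lia, by lia, by lia, fun l' hl' hx => ?_, ?_⟩
      · rw [hl' 1 2 3 4, hl' 0 2 3 4, hl' 0 1 2 3, hl' 0 1 3 4, hx, mul_assoc _ (_ • _) (l 0 2 3 4)]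
        · exact (inv_mul_cancel_right _ _).symm
        all_goals lia
      · simp only [map_mul, map_inv, T.peiffer.dL_smulH, T.peiffer.dL_smul, hM, t₁ (by lia),
          t₂ (by lia), t₃ (by lia), t₅ (by lia)]
        rw [one_mul, ht]
        group
  let l' (i j k p : ℕ) := if i = 0 ∧ j = a ∧ k = b ∧ p = 4 then x else l i j k p
  have hn (i j k p : ℕ) (hi : ¬ (i = 0 ∧ j = a ∧ k = b ∧ p = 4)) :
      l' i j k p = l i j k p := if_neg hi
  refine ⟨l', ⟨⟨c.g_refl, c.h_left, c.h_right, fun i j k => ?_, fun i j k => ?_, fun i j k => ?_,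
    c.m_1, c.m_2, c.m_3, c.m_4⟩, ⟨fun i j k hij hjk hk => ?_, fun i j k p hij hjk hkp hp => ?_,
    fun i j k p q hij hjk hkp hpq hq => ?_⟩, by lia⟩,
    { AgreeOnHorn.refl (N := 4) (r := r) (g := g) (h := h) (l := l) (m := m) with
      l_eq := fun d i j k p _ _ _ _ _ _ => hn _ _ _ _ (by lia) }⟩
  · rw [hn _ _ _ _ (by lia), c.l_left]
  · rw [hn _ _ _ _ (by lia), c.l_mid]
  · rw [hn _ _ _ _ (by lia), c.l_right]
  · exact c.g_mul_of_le le_rfl hij hjk hk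
  · by_cases e : i = 0 ∧ j = a ∧ k = b ∧ p = 4
    · simp only [l', if_pos e]
      obtain ⟨rfl, rfl, rfl, rfl⟩ := e
      rw [hxt, tetra, mul_assoc, inv_mul_cancel_right]
    · rw [hn _ _ _ _ e]
      exact c.h_mul (10 - (i + j + k + p)) i j k p (by lia) (by lia) (by lia) (by lia) (by lia)
        (by lia) hij hjk hkp hp
  · obtain ⟨rfl, rfl, rfl, rfl, rfl⟩ : i = 0 ∧ j = 1 ∧ k = 2 ∧ p = 3 ∧ q = 4 := by lia
    exact hx l' (fun _ _ _ _ _ _ _ _ _ => hn _ _ _ _ (by lia)) (if_pos (by lia))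

end HornFilled

end ThreeCrossedModule

/-! ### Filling horns of dimension five -/

namespace ThreeCrossedModule

section

variable {G H L M : Type*} [Group G] [Group H] [Group L] [Group M]
    [MulDistribMulAction G H] [MulDistribMulAction G L] [MulDistribMulAction H L]
    (P : PeifferComplex G H L) (o : Liftings G H L M)
    (g : ℕ → ℕ → G) (h : ℕ → ℕ → ℕ → H) (l : ℕ → ℕ → ℕ → ℕ → L)
    (m : ℕ → ℕ → ℕ → ℕ → ℕ → M)

/-- The 5-simplex identity can be solved uniquely for the `4`-cell of each inner face: this cell
occurs exactly once in it, up to an inverse and whiskering. -/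
lemma exists_five_iff (hL : ∀ x, Function.Bijective (o.aL x)) {r a b c d e : ℕ} (h₀ : 0 < r)
    (h₅ : r < 5) (hab : a < b) (hbc : b < c) (hcd : c < d) (hde : d < e) (he : e ≤ 5)
    (ha : r ≠ a) (hb : r ≠ b) (hc : r ≠ c) (hd : r ≠ d) (he' : r ≠ e) :
    ∃ z, ∀ m' : ℕ → ℕ → ℕ → ℕ → ℕ → M,
      (∀ i j k p q, i < j → j < k → k < p → p < q → q ≤ 5 →
        (r = i ∨ r = j ∨ r = k ∨ r = p ∨ r = q) → m' i j k p q = m i j k p q) →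
      (fiveLeft P o g h l m' 0 1 2 3 4 5 = fiveRight P o g h l m' 0 1 2 3 4 5 ↔
        m' a b c d e = z) := by
  have key {f : M → M} (hf : Function.Bijective f) (x y : M) :
      ∃ z, ∀ t, x = y * f t ↔ t = z := by
    obtain ⟨z, hz⟩ := hf.2 (y⁻¹ * x)
    refine ⟨z, fun t => ?_⟩
    rw [← hf.1.eq_iff (a := t), hz, eq_inv_mul_iff_mul_eq, eq_comm]
  suffices h : ∃ (f : M → M) (_ : Function.Bijective f) (x y : M),
      ∀ m' : ℕ → ℕ → ℕ → ℕ → ℕ → M,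
      (∀ i j k p q, i < j → j < k → k < p → p < q → q ≤ 5 →
        (r = i ∨ r = j ∨ r = k ∨ r = p ∨ r = q) → m' i j k p q = m i j k p q) →
      (fiveLeft P o g h l m' 0 1 2 3 4 5 = fiveRight P o g h l m' 0 1 2 3 4 5 ↔
        x = y * f (m' a b c d e)) by
    obtain ⟨f, hf, x, y, h⟩ := h
    obtain ⟨z, hz⟩ := key hf x y
    exact ⟨z, fun m' hm' => (h m' hm').trans (hz _)⟩
  obtain rfl | rfl | rfl | rfl : r = 1 ∨ r = 2 ∨ r = 3 ∨ r = 4 := by lia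
  · obtain ⟨rfl, rfl, rfl, rfl, rfl⟩ : a = 0 ∧ b = 2 ∧ c = 3 ∧ d = 4 ∧ e = 5 := by lia
    refine ⟨fun t => o.aL (fiveLD l 0 1 2 5 * fiveLN P g h 0 1 2 3 4 5) t⁻¹,
      (hL _).comp (Equiv.inv M).bijective, ?_⟩
    -- the two sides of the equation are found by unification, after the rewriting below
    apply Exists.intro
    apply Exists.intro
    intro m' hm'
    rw [fiveLeft, fiveRight]
    iterate 11 rw [← mul_inv_eq_iff_eq_mul]
    simp only [fiveM1, fiveM2, fiveM2', fiveM3', fiveM8', fiveM12']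
    rw [hm' 0 1 2 3 4, hm' 0 1 2 3 5, hm' 0 1 2 4 5, hm' 0 1 3 4 5, hm' 1 2 3 4 5]
    all_goals lia
  · obtain ⟨rfl, rfl, rfl, rfl, rfl⟩ : a = 0 ∧ b = 1 ∧ c = 3 ∧ d = 4 ∧ e = 5 := by lia
    refine ⟨fun t => o.aL (fiveLG h l 0 1 2 3 5 * fiveLH P g h 0 1 2 3 4 5) t, hL _, ?_⟩
    apply Exists.intro
    apply Exists.intro
    intro m' hm'
    rw [fiveLeft, fiveRight]
    iterate 2 rw [← mul_inv_eq_iff_eq_mul]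
    simp only [fiveM1, fiveM2, fiveM2', fiveM3', fiveM8', fiveM12']
    rw [hm' 0 1 2 3 4, hm' 0 1 2 3 5, hm' 0 1 2 4 5, hm' 0 2 3 4 5, hm' 1 2 3 4 5]
    all_goals lia
  · obtain ⟨rfl, rfl, rfl, rfl, rfl⟩ : a = 0 ∧ b = 1 ∧ c = 2 ∧ d = 4 ∧ e = 5 := by lia
    refine ⟨fun t => o.aL (fiveLA h l 0 1 2 3 4 5) t, hL _, ?_⟩
    apply Exists.intro
    apply Exists.intro
    intro m' hm'
    rw [fiveLeft, fiveRight, eq_comm]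
    iterate 1 rw [← mul_inv_eq_iff_eq_mul]
    simp only [fiveM1, fiveM2, fiveM2', fiveM3', fiveM8', fiveM12']
    rw [hm' 0 1 2 3 4, hm' 0 1 2 3 5, hm' 0 1 3 4 5, hm' 0 2 3 4 5, hm' 1 2 3 4 5]
    all_goals lia
  · obtain ⟨rfl, rfl, rfl, rfl, rfl⟩ : a = 0 ∧ b = 1 ∧ c = 2 ∧ d = 3 ∧ e = 5 := by lia
    refine ⟨id, Function.bijective_id, ?_⟩
    apply Exists.intro
    apply Exists.intro
    intro m' hm'
    rw [fiveLeft, fiveRight]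
    iterate 7 rw [← mul_inv_eq_iff_eq_mul]
    simp only [fiveM1, fiveM2, fiveM2', fiveM3', fiveM8', fiveM12', id]
    rw [hm' 0 1 2 3 4, hm' 0 1 2 4 5, hm' 0 1 3 4 5, hm' 0 2 3 4 5, hm' 1 2 3 4 5]
    all_goals lia

end

variable {G H L M : Type*} [Group G] [Group H] [Group L] [Group M]
  [MulDistribMulAction G H] [MulDistribMulAction G L] [MulDistribMulAction G M]
  [MulDistribMulAction H L] [MulDistribMulAction H M] [MulDistribMulAction L M]
  {T : ThreeCrossedModule G H L M} {r : ℕ} {g : ℕ → ℕ → G} {h : ℕ → ℕ → ℕ → H}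
  {l : ℕ → ℕ → ℕ → ℕ → L} {m : ℕ → ℕ → ℕ → ℕ → ℕ → M}

/-- Filling a horn in a `5`-simplex: the `5`-simplex identity determines the missing `4`-cell.  The
elements of `L` which the other cells force to be the boundaries of the `4`-cells satisfy the
boundary of this identity, so that the missing `4`-cell has the required boundary. -/
lemma HornFilled.exists_filled_five (c : T.HornFilled 5 r g h l m) (h₀ : 0 < r) (h₅ : r < 5) :
    ∃ m', T.Filled 5 g h l m' ∧ AgreeOnHorn 5 r g g h h l l m m' := by
  -- `f 0, …, f 4` are the vertices of the missing face
  let f (t : ℕ) := if t < r then t else t + 1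
  have hf (t : ℕ) : t < r ∧ f t = t ∨ r ≤ t ∧ f t = t + 1 := by simp only [f]; split <;> lia
  clear_value f
  have f0 := hf 0
  have f1 := hf 1
  have f2 := hf 2
  have f3 := hf 3
  have f4 := hf 4
  obtain ⟨z, hz⟩ := exists_five_iff T.peiffer T.liftings g h l m (r := r) (a := f 0) (b := f 1)
    (c := f 2) (d := f 3) (e := f 4)
    (fun x => (MulAction.bijective x : Function.Bijective (x • · : M → M)))
    h₀ h₅ (by lia) (by lia) (by lia) (by lia) (by lia) (by lia) (by lia) (by lia) (by lia) (by lia)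
  let m' (i j k p q : ℕ) :=
    if i = f 0 ∧ j = f 1 ∧ k = f 2 ∧ p = f 3 ∧ q = f 4 then z else m i j k p q
  have hn (i j k p q : ℕ) (hi : ¬ (i = f 0 ∧ j = f 1 ∧ k = f 2 ∧ p = f 3 ∧ q = f 4)) :
      m' i j k p q = m i j k p q := if_neg hi
  have hn' (i j k p q : ℕ) (hr : r = i ∨ r = j ∨ r = k ∨ r = p ∨ r = q) :
      m' i j k p q = m i j k p q := hn _ _ _ _ _ (by lia)
  have five := (hz m' fun i j k p q _ _ _ _ _ => hn' i j k p q).mpr (if_pos (by lia))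
  clear_value m'
  have c' : T.peiffer.Coherent 5 g h l (T.peiffer.pentatope g h l) :=
    ⟨fun _ _ _ => c.g_mul_of_le (by lia), fun _ _ _ _ => c.h_mul_of_le (by lia),
      fun i j k p q _ _ _ _ _ => by rw [PeifferComplex.pentatope]; group⟩
  obtain ⟨y, hy⟩ := exists_five_iff T.peiffer T.peiffer.boundary g h l (T.peiffer.pentatope g h l)
    (r := r) (a := f 0) (b := f 1) (c := f 2) (d := f 3) (e := f 4)
    (fun x => (MulAut.conj x).bijective)
    h₀ h₅ (by lia) (by lia) (by lia) (by lia) (by lia) (by lia) (by lia) (by lia) (by lia) (by lia)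
  have hd (i j k p q : ℕ) (hij : i < j) (hjk : j < k) (hkp : k < p) (hpq : p < q) (hq : q ≤ 5)
      (hr : r = i ∨ r = j ∨ r = k ∨ r = p ∨ r = q) :
      T.dM (m' i j k p q) = T.peiffer.pentatope g h l i j k p q := by
    rw [hn' _ _ _ _ _ hr, PeifferComplex.pentatope, eq_mul_inv_iff_mul_eq]
    have := c.l_mul (15 - (i + j + k + p + q)) i j k p q (by lia) (by lia) (by lia) (by lia)
      (by lia) (by lia) (by lia) hij hjk hkp hpq hq
    simp only [mul_assoc] at this ⊢
    exact this
  -- both candidates for the boundary of the missing `4`-cell solve the same equation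
  have hb := (hy _ fun _ _ _ _ _ _ _ _ _ _ _ => rfl).mp
    (c'.fiveLeft_eq_fiveRight (by lia) (by lia) (by lia) (by lia) (by lia) le_rfl)
  have hb' := (hy (fun i j k p q => T.dM (m' i j k p q)) hd).mp <| by
    have e₁ := T.isHom_dM.map_fiveLeft g h l m' 0 1 2 3 4 5
    have e₂ := T.isHom_dM.map_fiveRight g h l m' 0 1 2 3 4 5
    rw [five] at e₁
    exact e₁.symm.trans e₂
  refine ⟨m', ⟨⟨c.g_refl, c.h_left, c.h_right, c.l_left, c.l_mid, c.l_right, fun i j k p => ?_,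
    fun i j k p => ?_, fun i j k p => ?_, fun i j k p => ?_⟩, ⟨c'.g_mul, c'.h_mul,
    fun i j k p q hij hjk hkp hpq hq => ?_⟩, fun i j k p q x hij hjk hkp hpq hqx hx => ?_⟩,
    { AgreeOnHorn.refl (N := 5) (r := r) (g := g) (h := h) (l := l) (m := m) with
      m_eq := fun d i j k p q _ _ _ _ _ _ _ => hn _ _ _ _ _ (by lia) }⟩
  · rw [hn _ _ _ _ _ (by lia), c.m_1]
  · rw [hn _ _ _ _ _ (by lia), c.m_2]
  · rw [hn _ _ _ _ _ (by lia), c.m_3]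
  · rw [hn _ _ _ _ _ (by lia), c.m_4]
  · have e : T.dM (m' i j k p q) = T.peiffer.pentatope g h l i j k p q := by
      by_cases hr : r = i ∨ r = j ∨ r = k ∨ r = p ∨ r = q
      · exact hd _ _ _ _ _ hij hjk hkp hpq hq hr
      · obtain ⟨rfl, rfl, rfl, rfl, rfl⟩ : i = f 0 ∧ j = f 1 ∧ k = f 2 ∧ p = f 3 ∧ q = f 4 := by lia
        exact hb'.trans hb.symm
    rw [e]
    exact c'.l_mul i j k p q hij hjk hkp hpq hq
  · obtain ⟨rfl, rfl, rfl, rfl, rfl, rfl⟩ :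
      i = 0 ∧ j = 1 ∧ k = 2 ∧ p = 3 ∧ q = 4 ∧ x = 5 := by lia
    exact five

/-- Every inner horn can be filled. -/
theorem HornFilled.exists_filled {N : ℕ} (c : T.HornFilled N r g h l m) (hN : 2 ≤ N) (h₀ : 0 < r)
    (hr : r < N) : ∃ g' h' l' m', T.Filled N g' h' l' m' ∧ AgreeOnHorn N r g g' h h' l l' m m' := by
  obtain rfl | rfl | rfl | rfl | rfl | hN : N = 2 ∨ N = 3 ∨ N = 4 ∨ N = 5 ∨ N = 6 ∨ 7 ≤ N := by lia
  · obtain rfl : r = 1 := by lia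
    obtain ⟨g', hg'⟩ := c.exists_filled_two
    exact ⟨g', h, l, m, hg'⟩
  · obtain ⟨h', hh'⟩ := c.exists_filled_three h₀ hr
    exact ⟨g, h', l, m, hh'⟩
  · obtain ⟨l', hl'⟩ := c.exists_filled_four h₀ hr
    exact ⟨g, h, l', m, hl'⟩
  · obtain ⟨m', hm'⟩ := c.exists_filled_five h₀ hr
    exact ⟨g, h, l, m', hm'⟩
  · exact ⟨g, h, l, m, c.filled_six hr.le, .refl⟩
  · exact ⟨g, h, l, m, c.filled_of_seven_le hN, .refl⟩

end ThreeCrossedModule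

/-! ### Simplices and horns as families of total functions -/

namespace ThreeCrossedModule

variable {G : Type u₁} {H : Type u₂} {L : Type u₃} {M : Type u₄}
  [Group G] [Group H] [Group L] [Group M]
  [MulDistribMulAction G H] [MulDistribMulAction G L] [MulDistribMulAction G M]
  [MulDistribMulAction H L] [MulDistribMulAction H M] [MulDistribMulAction L M]
  {T : ThreeCrossedModule G H L M}

/-- The coloring of `[n]` obtained from total functions and a sequence of `n + 1` vertices. -/
abbrev Coloring.ofFun {n : ℕ} (g : ℕ → ℕ → G) (h : ℕ → ℕ → ℕ → H) (l : ℕ → ℕ → ℕ → ℕ → L)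
    (m : ℕ → ℕ → ℕ → ℕ → ℕ → M) (v : Fin (n + 1) → ℕ) : Coloring G H L M n where
  g i j _ := g (v i) (v j)
  h i j k _ _ := h (v i) (v j) (v k)
  l i j k p _ _ _ := l (v i) (v j) (v k) (v p)
  m i j k p q _ _ _ _ := m (v i) (v j) (v k) (v p) (v q)

/-- A simplex given by total functions. -/
def Filled.simplex {N : ℕ} {g : ℕ → ℕ → G} {h : ℕ → ℕ → ℕ → H} {l : ℕ → ℕ → ℕ → ℕ → L}
    {m : ℕ → ℕ → ℕ → ℕ → ℕ → M} (c : T.Filled N g h l m) : T.Simplex N where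
  toColoring := .ofFun g h l m Fin.val
  cocycle₂ i j k hij hjk := by
    rw [Fin.le_iff_val_le_val] at hij hjk
    obtain hij | hij := hij.eq_or_lt
    · simp [hij, c.h_left, c.g_refl]
    obtain hjk | hjk := hjk.eq_or_lt
    · simp [hjk, c.h_right, c.g_refl]
    exact c.coherent.g_mul _ _ _ hij hjk (Fin.is_le k)
  cocycle₃ i j k p hij hjk hkp := by
    rw [Fin.le_iff_val_le_val] at hij hjk hkp
    obtain hij | hij := hij.eq_or_lt
    · simp [hij, c.l_left, c.h_left]
    obtain hjk | hjk := hjk.eq_or_lt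
    · simp [hjk, c.l_mid, c.h_left, c.h_right]
    obtain hkp | hkp := hkp.eq_or_lt
    · simp [hkp, c.l_right, c.h_right, c.g_refl]
    exact c.coherent.h_mul _ _ _ _ hij hjk hkp (Fin.is_le p)
  cocycle₄ i j k p q hij hjk hkp hpq := by
    rw [Fin.le_iff_val_le_val] at hij hjk hkp hpq
    obtain hij | hij := hij.eq_or_lt
    · simp [hij, c.m_1, c.l_left, c.h_left, T.pf_one_right]
    obtain hjk | hjk := hjk.eq_or_lt
    · simp [hjk, c.m_2, c.l_left, c.l_mid, c.h_right, T.pf_one_right]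
    obtain hkp | hkp := hkp.eq_or_lt
    · simp [hkp, c.m_3, c.l_mid, c.l_right, c.h_left, T.pf_one_left]
    obtain hpq | hpq := hpq.eq_or_lt
    · simp [hpq, c.m_4, c.l_right, c.h_right, c.g_refl, T.pf_one_left]
    exact c.coherent.l_mul _ _ _ _ _ hij hjk hkp hpq (Fin.is_le q)
  cocycle₅ i j k p q x hij hjk hkp hpq hqx := by
    change fiveLeft T.peiffer T.liftings g h l m i j k p q x =
      fiveRight T.peiffer T.liftings g h l m i j k p q x
    rw [Fin.le_iff_val_le_val] at hij hjk hkp hpq hqx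
    by_cases hd : (i : ℕ) = j ∨ (j : ℕ) = k ∨ (k : ℕ) = p ∨ (p : ℕ) = q ∨ (q : ℕ) = x
    · exact c.toNormalized.fiveLeft_eq_fiveRight T hd
    · exact c.five _ _ _ _ _ _ (by lia) (by lia) (by lia) (by lia) (by lia) (Fin.is_le x)
  g_refl _ := c.g_refl _
  h_left _ _ _ := c.h_left _ _
  h_right _ _ _ := c.h_right _ _
  l_left _ _ _ _ _ := c.l_left _ _ _
  l_mid _ _ _ _ _ := c.l_mid _ _ _
  l_right _ _ _ _ _ := c.l_right _ _ _
  m_1 _ _ _ _ _ _ _ := c.m_1 _ _ _ _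
  m_2 _ _ _ _ _ _ _ := c.m_2 _ _ _ _
  m_3 _ _ _ _ _ _ _ := c.m_3 _ _ _ _
  m_4 _ _ _ _ _ _ _ := c.m_4 _ _ _ _

/-- Sequences of vertices of a face of an `N`-simplex which is not opposite to `r`. -/
structure IsHornPath (N r : ℕ) {n : ℕ} (v : Fin (n + 1) → ℕ) : Prop where
  monotone : Monotone v
  le : ∀ i, v i ≤ N
  avoid : ∃ d, d ≤ N ∧ d ≠ r ∧ ∀ i, v i ≠ d

lemma IsHornPath.comp {N r n n' : ℕ} {v : Fin (n + 1) → ℕ} (hv : IsHornPath N r v)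
    (δ : Fin (n' + 1) →o Fin (n + 1)) : IsHornPath N r (v ∘ δ) :=
  ⟨hv.monotone.comp δ.monotone, fun _ => hv.le _,
    hv.avoid.imp fun _ h => ⟨h.1, h.2.1, fun _ => h.2.2 _⟩⟩

lemma IsHornPath.reindex {N r n n' : ℕ} {v : Fin (n + 1) → ℕ} (hv : IsHornPath N r v)
    {δ : Fin (n' + 1) → Fin (n + 1)} (hδ : Monotone δ) {v' : Fin (n' + 1) → ℕ} (h : v' = v ∘ δ) :
    IsHornPath N r v' := by
  subst h
  exact hv.comp ⟨δ, hδ⟩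

/-- A map from a horn to the simplicial set of `T`, evaluated on sequences of vertices. -/
structure HornMap (T : ThreeCrossedModule G H L M) (N r : ℕ) where
  eval {n : ℕ} (v : Fin (n + 1) → ℕ) (hv : IsHornPath N r v) : T.Simplex n
  eval_comp {n n' : ℕ} (v : Fin (n + 1) → ℕ) (hv : IsHornPath N r v)
    (δ : Fin (n' + 1) →o Fin (n + 1)) : eval (v ∘ δ) (hv.comp δ) = (eval v hv).comap δ

section monotone

variable {α : Type*} [Preorder α] {i j k p q x : α}

lemma monotone_vec_one : Monotone ![i] := fun _ _ _ => by simp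

lemma monotone_vec_cons {n : ℕ} {v : Fin (n + 1) → α} (h : i ≤ v 0) (hv : Monotone v) :
    Monotone (Matrix.vecCons i v) := by
  rw [Fin.monotone_iff_le_succ] at hv ⊢
  intro a
  cases a using Fin.cases with
  | zero => exact h
  | succ a => exact hv a

end monotone

namespace HornMap

variable {N r : ℕ} (E : HornMap T N r)

/-- A sequence which repeats and omits vertices of a path in a horn is a path in this horn, and the
horn map is compatible with this operation. -/
lemma eval_eq {n n' : ℕ} {v : Fin (n + 1) → ℕ} (hv : IsHornPath N r v)
    {δ : Fin (n' + 1) → Fin (n + 1)} (hδ : Monotone δ) {v' : Fin (n' + 1) → ℕ} (h : v' = v ∘ δ) :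
    ∃ hv' : IsHornPath N r v', E.eval v' hv' = (E.eval v hv).comap ⟨δ, hδ⟩ := by
  subst h
  exact ⟨_, E.eval_comp v hv ⟨δ, hδ⟩⟩

open Classical in
/-- The elements of `G` assigned to the edges of a horn, and `1` for other pairs. -/
noncomputable def g (i j : ℕ) : G :=
  if hv : IsHornPath N r ![i, j] then (E.eval ![i, j] hv).g 0 1 (by decide) else 1

open Classical in
/-- The elements of `H` assigned to the triangles of a horn, and `1` for other triples. -/
noncomputable def h (i j k : ℕ) : H :=
  if hv : IsHornPath N r ![i, j, k] then
    (E.eval ![i, j, k] hv).h 0 1 2 (by decide) (by decide) else 1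

open Classical in
/-- The elements of `L` assigned to the tetrahedra of a horn, and `1` for other quadruples. -/
noncomputable def l (i j k p : ℕ) : L :=
  if hv : IsHornPath N r ![i, j, k, p] then
    (E.eval ![i, j, k, p] hv).l 0 1 2 3 (by decide) (by decide) (by decide) else 1

open Classical in
/-- The elements of `M` assigned to the `4`-simplices of a horn, and `1` for other quintuples. -/
noncomputable def m (i j k p q : ℕ) : M :=
  if hv : IsHornPath N r ![i, j, k, p, q] then
    (E.eval ![i, j, k, p, q] hv).m 0 1 2 3 4 (by decide) (by decide) (by decide) (by decide)
  else 1

/-- A horn map is determined by its values on the generators: a simplex consists of the values on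
sequences of at most five of its vertices. -/
lemma eval_toColoring {n : ℕ} {v : Fin (n + 1) → ℕ} (hv : IsHornPath N r v) :
    (E.eval v hv).toColoring = .ofFun E.g E.h E.l E.m v := by
  refine Coloring.ext ?_ ?_ ?_ ?_
  · funext i j hij
    obtain ⟨hv', e⟩ := E.eval_eq hv (δ := ![i, j]) (v' := ![v i, v j])
      (monotone_vec_cons hij monotone_vec_one) (by ext a; fin_cases a <;> rfl)
    change _ = E.g (v i) (v j)
    rw [g, dif_pos hv', e]
    rfl
  · funext i j k hij hjk
    obtain ⟨hv', e⟩ := E.eval_eq hv (δ := ![i, j, k]) (v' := ![v i, v j, v k])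
      (monotone_vec_cons hij (monotone_vec_cons hjk monotone_vec_one))
      (by ext a; fin_cases a <;> rfl)
    change _ = E.h (v i) (v j) (v k)
    rw [h, dif_pos hv', e]
    rfl
  · funext i j k p hij hjk hkp
    obtain ⟨hv', e⟩ := E.eval_eq hv (δ := ![i, j, k, p]) (v' := ![v i, v j, v k, v p])
      (monotone_vec_cons hij (monotone_vec_cons hjk (monotone_vec_cons hkp monotone_vec_one)))
      (by ext a; fin_cases a <;> rfl)
    change _ = E.l (v i) (v j) (v k) (v p)
    rw [l, dif_pos hv', e]
    rfl
  · funext i j k p q hij hjk hkp hpq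
    obtain ⟨hv', e⟩ := E.eval_eq hv (δ := ![i, j, k, p, q]) (v' := ![v i, v j, v k, v p, v q])
      (monotone_vec_cons hij (monotone_vec_cons hjk (monotone_vec_cons hkp
        (monotone_vec_cons hpq monotone_vec_one))))
      (by ext a; fin_cases a <;> rfl)
    change _ = E.m (v i) (v j) (v k) (v p) (v q)
    rw [m, dif_pos hv', e]
    rfl

lemma hornFilled : T.HornFilled N r E.g E.h E.l E.m where
  g_refl i := by
    by_cases hv : IsHornPath N r ![i, i]
    · have hv' := hv.reindex (δ := ![0]) (v' := ![i])
        monotone_vec_one (by ext a; fin_cases a; rfl)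
      have := (E.eval _ hv').g_refl 0
      rw [E.eval_toColoring hv'] at this
      exact this
    · exact dif_neg hv
  h_left i j := by
    by_cases hv : IsHornPath N r ![i, i, j]
    · have hv' := hv.reindex (δ := ![0, 2]) (v' := ![i, j])
        (monotone_vec_cons (by decide) monotone_vec_one)
        (by ext a; fin_cases a <;> rfl)
      have := (E.eval _ hv').h_left 0 1 (by decide)
      rw [E.eval_toColoring hv'] at this
      exact this
    · exact dif_neg hv
  h_right i j := by
    by_cases hv : IsHornPath N r ![i, j, j]
    · have hv' := hv.reindex (δ := ![0, 1]) (v' := ![i, j])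
        (monotone_vec_cons (by decide) monotone_vec_one)
        (by ext a; fin_cases a <;> rfl)
      have := (E.eval _ hv').h_right 0 1 (by decide)
      rw [E.eval_toColoring hv'] at this
      exact this
    · exact dif_neg hv
  l_left i j k := by
    by_cases hv : IsHornPath N r ![i, i, j, k]
    · have hv' := hv.reindex (δ := ![0, 2, 3]) (v' := ![i, j, k])
        (monotone_vec_cons (by decide) (monotone_vec_cons (by decide) monotone_vec_one))
        (by ext a; fin_cases a <;> rfl)
      have := (E.eval _ hv').l_left 0 1 2 (by decide) (by decide)
      rw [E.eval_toColoring hv'] at this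
      exact this
    · exact dif_neg hv
  l_mid i j k := by
    by_cases hv : IsHornPath N r ![i, j, j, k]
    · have hv' := hv.reindex (δ := ![0, 1, 3]) (v' := ![i, j, k])
        (monotone_vec_cons (by decide) (monotone_vec_cons (by decide) monotone_vec_one))
        (by ext a; fin_cases a <;> rfl)
      have := (E.eval _ hv').l_mid 0 1 2 (by decide) (by decide)
      rw [E.eval_toColoring hv'] at this
      exact this
    · exact dif_neg hv
  l_right i j k := by
    by_cases hv : IsHornPath N r ![i, j, k, k]
    · have hv' := hv.reindex (δ := ![0, 1, 2]) (v' := ![i, j, k])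
        (monotone_vec_cons (by decide) (monotone_vec_cons (by decide) monotone_vec_one))
        (by ext a; fin_cases a <;> rfl)
      have := (E.eval _ hv').l_right 0 1 2 (by decide) (by decide)
      rw [E.eval_toColoring hv'] at this
      exact this
    · exact dif_neg hv
  m_1 i j k p := by
    by_cases hv : IsHornPath N r ![i, i, j, k, p]
    · have hv' := hv.reindex (δ := ![0, 2, 3, 4]) (v' := ![i, j, k, p])
        (monotone_vec_cons (by decide) (monotone_vec_cons (by decide)
          (monotone_vec_cons (by decide) monotone_vec_one)))
        (by ext a; fin_cases a <;> rfl)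
      have := (E.eval _ hv').m_1 0 1 2 3 (by decide) (by decide) (by decide)
      rw [E.eval_toColoring hv'] at this
      exact this
    · exact dif_neg hv
  m_2 i j k p := by
    by_cases hv : IsHornPath N r ![i, j, j, k, p]
    · have hv' := hv.reindex (δ := ![0, 1, 3, 4]) (v' := ![i, j, k, p])
        (monotone_vec_cons (by decide) (monotone_vec_cons (by decide)
          (monotone_vec_cons (by decide) monotone_vec_one)))
        (by ext a; fin_cases a <;> rfl)
      have := (E.eval _ hv').m_2 0 1 2 3 (by decide) (by decide) (by decide)
      rw [E.eval_toColoring hv'] at this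
      exact this
    · exact dif_neg hv
  m_3 i j k p := by
    by_cases hv : IsHornPath N r ![i, j, k, k, p]
    · have hv' := hv.reindex (δ := ![0, 1, 2, 4]) (v' := ![i, j, k, p])
        (monotone_vec_cons (by decide) (monotone_vec_cons (by decide)
          (monotone_vec_cons (by decide) monotone_vec_one)))
        (by ext a; fin_cases a <;> rfl)
      have := (E.eval _ hv').m_3 0 1 2 3 (by decide) (by decide) (by decide)
      rw [E.eval_toColoring hv'] at this
      exact this
    · exact dif_neg hv
  m_4 i j k p := by
    by_cases hv : IsHornPath N r ![i, j, k, p, p]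
    · have hv' := hv.reindex (δ := ![0, 1, 2, 3]) (v' := ![i, j, k, p])
        (monotone_vec_cons (by decide) (monotone_vec_cons (by decide)
          (monotone_vec_cons (by decide) monotone_vec_one)))
        (by ext a; fin_cases a <;> rfl)
      have := (E.eval _ hv').m_4 0 1 2 3 (by decide) (by decide) (by decide)
      rw [E.eval_toColoring hv'] at this
      exact this
    · exact dif_neg hv
  g_mul d i j k hd hr hi hj hk hij hjk hN := by
    have hv : IsHornPath N r ![i, j, k] :=
      ⟨monotone_vec_cons hij.le (monotone_vec_cons hjk.le monotone_vec_one),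
        by intro a; fin_cases a <;> dsimp <;> lia,
        d, hd, hr, by intro a; fin_cases a <;> dsimp <;> lia⟩
    have := (E.eval _ hv).cocycle₂ 0 1 2 (by decide) (by decide)
    rw [E.eval_toColoring hv] at this
    exact this
  h_mul d i j k p hd hr hi hj hk hp hij hjk hkp hN := by
    have hv : IsHornPath N r ![i, j, k, p] :=
      ⟨monotone_vec_cons hij.le (monotone_vec_cons hjk.le <|
        monotone_vec_cons hkp.le monotone_vec_one),
        by intro a; fin_cases a <;> dsimp <;> lia,
        d, hd, hr, by intro a; fin_cases a <;> dsimp <;> lia⟩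
    have := (E.eval _ hv).cocycle₃ 0 1 2 3 (by decide) (by decide) (by decide)
    rw [E.eval_toColoring hv] at this
    exact this
  l_mul d i j k p q hd hr hi hj hk hp hq hij hjk hkp hpq hN := by
    have hv : IsHornPath N r ![i, j, k, p, q] :=
      ⟨monotone_vec_cons hij.le (monotone_vec_cons hjk.le <|
        monotone_vec_cons hkp.le (monotone_vec_cons hpq.le monotone_vec_one)),
        by intro a; fin_cases a <;> dsimp <;> lia,
        d, hd, hr, by intro a; fin_cases a <;> dsimp <;> lia⟩
    have := (E.eval _ hv).cocycle₄ 0 1 2 3 4 (by decide) (by decide) (by decide) (by decide)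
    rw [E.eval_toColoring hv] at this
    exact this
  five d i j k p q x hd hr hi hj hk hp hq hx hij hjk hkp hpq hqx hN := by
    have hv : IsHornPath N r ![i, j, k, p, q, x] :=
      ⟨monotone_vec_cons hij.le (monotone_vec_cons hjk.le <|
        monotone_vec_cons hkp.le <| monotone_vec_cons hpq.le <|
        monotone_vec_cons hqx.le monotone_vec_one),
        by intro a; fin_cases a <;> dsimp <;> lia,
        d, hd, hr, by intro a; fin_cases a <;> dsimp <;> lia⟩
    have := (E.eval _ hv).cocycle₅ 0 1 2 3 4 5 (by decide) (by decide) (by decide) (by decide)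
      (by decide)
    rw [E.eval_toColoring hv] at this
    exact this

end HornMap
end ThreeCrossedModule

/-! ### The filler condition for the simplicial set -/

namespace ThreeCrossedModule
open Opposite Simplicial

variable {G : Type u₁} {H : Type u₂} {L : Type u₃} {M : Type u₄}
  [Group G] [Group H] [Group L] [Group M]
  [MulDistribMulAction G H] [MulDistribMulAction G L] [MulDistribMulAction G M]
  [MulDistribMulAction H L] [MulDistribMulAction H M] [MulDistribMulAction L M]
  {T : ThreeCrossedModule G H L M}

/-- The simplex of a horn with the given vertices. -/
def hornSimplex.{u} {N : ℕ} (i : Fin (N + 1)) {n : ℕ} (v : Fin (n + 1) → ℕ)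
    (hv : IsHornPath N i v) :
    (SSet.horn.{u} N i : SSet).obj (op ⦋n⦌) :=
  ⟨SSet.stdSimplex.objEquiv.symm
    (SimplexCategory.Hom.mk
      ⟨fun a => ⟨v a, Nat.lt_succ_of_le (hv.le a)⟩, fun _ _ h => hv.monotone h⟩), by
    rw [SSet.mem_horn_iff_notMem_range]
    obtain ⟨d, hd, hr, h⟩ := hv.avoid
    refine ⟨⟨d, Nat.lt_succ_of_le hd⟩, fun h => hr (congrArg Fin.val h), ?_⟩
    rintro ⟨a, ha⟩
    exact h a (congrArg Fin.val ha)⟩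

/-- The values of a map from a horn on paths. -/
def hornMap {N : ℕ} {i : Fin (N + 1)} (σ : (SSet.horn N i : SSet) ⟶ T.simplicialSet) :
    HornMap T N i where
  eval v hv := σ.app _ (hornSimplex i v hv)
  eval_comp v hv δ :=
    NatTrans.naturality_apply σ (SimplexCategory.mkHom δ).op (hornSimplex i v hv)

lemma Simplex.ext_coloring {n : ℕ} {s t : T.Simplex n} (h : s.toColoring = t.toColoring) :
    s = t := by
  cases s; cases t; cases h; rfl

end ThreeCrossedModule
open ThreeCrossedModule
theorem mainTheorem2 {G : Type u₁} {H : Type u₂} {L : Type u₃} {M : Type u₄}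
    [Group G] [Group H] [Group L] [Group M]
    [MulDistribMulAction G H] [MulDistribMulAction G L] [MulDistribMulAction G M]
    [MulDistribMulAction H L] [MulDistribMulAction H M] [MulDistribMulAction L M]
    (T : ThreeCrossedModule G H L M) :
    SSet.Quasicategory T.simplicialSet := by
  refine SSet.quasicategory_of_filler _ fun n i σ hi₀ hi => ?_
  let E := hornMap σ
  obtain ⟨g, h, l, m, c, e⟩ := E.hornFilled.exists_filled (by lia) hi₀ hi
  refine ⟨c.simplex, fun j hj => ?_⟩
  -- the vertices of the face opposite to `j`
  let v (a : Fin (n + 2)) : ℕ := j.succAbove a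
  have hv : IsHornPath (n + 2) i v :=
    ⟨fun _ _ h => j.strictMono_succAbove.monotone h, fun _ => Fin.is_le _, j, Fin.is_le j,
      fun h => hj (Fin.ext h), fun a h => j.succAbove_ne a (Fin.ext h)⟩
  have hf : σ.app _ (SSet.horn.face i j hj) = E.eval v hv := rfl
  rw [hf]
  refine Simplex.ext_coloring ?_
  rw [E.eval_toColoring hv]
  have ne (a : Fin (n + 2)) : (j : ℕ) ≠ v a := fun h => j.succAbove_ne a (Fin.ext h.symm)
  have hj' : (j : ℕ) ≠ i := fun h => hj (Fin.ext h)
  refine Coloring.ext ?_ ?_ ?_ ?_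
  · funext a b _
    exact e.g_eq j _ _ (Fin.is_le j) hj' (ne _) (ne _)
  · funext a b c _ _
    exact e.h_eq j _ _ _ (Fin.is_le j) hj' (ne _) (ne _) (ne _)
  · funext a b c d _ _ _
    exact e.l_eq j _ _ _ _ (Fin.is_le j) hj' (ne _) (ne _) (ne _) (ne _)
  · funext a b c d f _ _ _ _
    exact e.m_eq j _ _ _ _ _ (Fin.is_le j) hj' (ne _) (ne _) (ne _) (ne _) (ne _)
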